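/- Let $k\ge 1$ be an integer, $\lambda>1$ and $c\neq 0$ real numbers. Let $$\overline M=\Big\{(z,w)\in(\mathbb C\cup\{\infty\})^2 : w^{k+1}=z\Big(\frac{z-\lambda^{-1}}{\lambda-z}\Big)^k\Big\},\qquad M=\overline M\setminus\{(0,0),(\infty,\infty)\},$$ with universal cover $\pi:\widetilde M\to M$, and put $G=\lambda^{k/(k+1)}w$, $\Omega=c\,\frac{dz}{zw}$, $w_0=\lambda^{-k/(k+1)}$, $\Lambda=e^{2\pi i/(k+1)}$. Fix $e_0\in\widetilde M$ over $(1,w_0)$. We consider solutions $F:\widetilde M\to \mathrm{SL}(2,\mathbb C)$ of $$dF\,F^{-1}=\begin{pmatrix}G&-G^2\\1&-G\end{pmatrix}\Omega .\tag{1}$$ The monodromy of a solution $F$ along a loop in $M$ based at $(1,w_0)$ is $F(e_0)^{-1}F(e_1)$, where $e_1$ is the endpoint of the lift of the loop starting at $e_0$. With $e_3=\mathrm{diag}(1,-1)$ and $a^*=\bar a^{t}$, let $H^3=\{aa^*: a\in \mathrm{SL}(2,\mathbb C)\}$, $S^3_1=\{ae_3a^*: a\in \mathrm{SL}(2,\mathbb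 C)\}$, and $f_H=FF^*:\widetilde M\to H^3$, $f_S=Fe_3F^*:\widetilde M\to S^3_1$. We say that $f_H$ (or $f_S$) closes if it is well defined on $M$, i.e. factors through $\pi$. Let $\gamma_1$ be any loop in $M$ that starts at $(1,w_0)$, goes through $\{\operatorname{Im} z<0\}$ to a point $(x,w)$ with $0<x<\lambda^{-1}$, then through $\{\operatorname{Im} z>0\}$ to $(1,\Lambda w_0)$, then through $\{\operatorname{Im} z>0\}$ to $(1/x,\Lambda/(\lambda^{2k/(k+1)}w))$, and then through $\{\operatorname{Im} z<0\}$ back to $(1,w_0)$. Let $\gamma_2$ be any loop in $M$ that starts at $(1,w_0)$, goes through $\{\operatorname{Im} z<0\}$ to a point with $z$ real and negative, and then through $\{\operatorname{Im} z>0\}$ back to $(1,w_0)$. **Lemma (closing condition).** There are real numbers $r_1,r_2,r_3,r_4$ and complex numbers $p,q$, depending only on $k,\lambda,c$, such that the solution $F$ of (1) with $F(e_0)=\mathrm{id}$ has the monodromies $$\Phi_1=\begin{pmatrix}r_1&p\\-\bar p&r_2\end{pmatrix},\qquad \Phi_2=\begin{pmatrix}q&ir_3\\ir_4&\bar q\end{pmatrix}$$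 along $\gamma_1$ and $\gamma_2$, respectively. Suppose that $r_1\ne r_2$ and $r_3\neq r_4$, and put $$h_1=\frac{2\operatorname{Re}p}{r_2-r_1},\qquad h_2=\frac{2\operatorname{Im}q}{r_4-r_3}.$$ 1. Let $\alpha,\beta\in\mathbb R$ and let $F$ be a solution of (1) with $F(e_0)=\begin{pmatrix}\alpha&\beta\\\beta&\alpha\end{pmatrix}\in \mathrm{SL}(2,\mathbb R)$. The following are equivalent: $f_H$ closes; the monodromies of $F$ along all loops of $M$ based at $(1,w_0)$ lie in $\mathrm{SU}(2)$; the monodromies of $F$ along the loops $\gamma_1$ and $\gamma_2$ lie in $\mathrm{SU}(2)$; $\alpha\beta\ne0$ and $h_1=h_2=\frac{\alpha^2+\beta^2}{2\alpha\beta}$. 2. Let $\alpha,\beta\in\mathbb R$ and let $F$ be a solution of (1) with $F(e_0)=\begin{pmatrix}\alpha&\beta\\\alpha&-\beta\end{pmatrix}\in \mathrm{SL}(2,\mathbb R)$. The following are equivalent: $f_S$ closes; the monodromies of $F$ along all loops of $M$ based at $(1,w_0)$ lie in $\mathrm{SU}(1,1)$; the monodromies of $F$ along the loops $\gamma_1$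 and $\gamma_2$ lie in $\mathrm{SU}(1,1)$; $h_1=h_2=\frac{\alpha^2-\beta^2}{\alpha^2+\beta^2}$. 3. Some solution $F$ as in 1 (for suitable real $\alpha,\beta$) has a closing surface $f_H$ in $H^3$ if and only if $h_1=h_2$ and $|h_1|>1$. 4. Some solution $F$ as in 2 (for suitable real $\alpha,\beta$) has a closing surface $f_S$ in $S^3_1$ if and only if $h_1=h_2$ and $|h_1|<1$. In particular, one of these surfaces closes for suitable $\alpha,\beta$ if and only if $h_1=h_2\in\mathbb R\setminus\{\pm1\}$. -/

import Mathlib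

open Topology unitInterval
open scoped MatrixGroups OnePoint Matrix

noncomputable section

namespace HigherGenusCatenoid

/-- The rational function `z ↦ z * ((z - 1/lam) / (lam - z)) ^ k` as a self-map of the Riemann
sphere `ℂ ∪ {∞}`; it has poles at `lam` and at `∞`. -/
def curveFun (k : ℕ) (lam : ℝ) (z : OnePoint ℂ) : OnePoint ℂ :=
  OnePoint.elim z ∞ fun z =>
    open Classical in
    if z = (lam : ℂ) then ∞ else ((z * ((z - (lam : ℂ)⁻¹) / ((lam : ℂ) - z)) ^ k : ℂ) : OnePoint ℂ)

/-- The compact curve `w ^ (k + 1) = z * ((z - 1/lam) / (lam - z)) ^ k` in `(ℂ ∪ {∞}) ^ 2`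
(here `∞ ^ (k + 1) = ∞`). -/
def compactCurve (k : ℕ) (lam : ℝ) : Set (OnePoint ℂ × OnePoint ℂ) :=
  {P | OnePoint.map (fun w : ℂ => w ^ (k + 1)) P.2 = curveFun k lam P.1}

/-- The curve `M`: the compact curve without the two points `(0, 0)` and `(∞, ∞)`. -/
def puncturedCurve (k : ℕ) (lam : ℝ) : Set (OnePoint ℂ × OnePoint ℂ) :=
  {P | P ∈ compactCurve k lam ∧ P ≠ (((0 : ℂ) : OnePoint ℂ), ((0 : ℂ) : OnePoint ℂ)) ∧ P ≠ (∞, ∞)}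

/-- The finite value of a point of the Riemann sphere (with the value `0` assigned to `∞`). -/
def finiteValue (z : OnePoint ℂ) : ℂ := OnePoint.elim z 0 id

/-- The coordinate `z` on `M`. It is finite and nonzero at all points of `M`. -/
def zCoord {k : ℕ} {lam : ℝ} (P : puncturedCurve k lam) : ℂ := finiteValue P.1.1

/-- The coordinate `w` on `M`. It is finite at all points of `M` with `z ≠ lam`. -/
def wCoord {k : ℕ} {lam : ℝ} (P : puncturedCurve k lam) : ℂ := finiteValue P.1.2

/-- The real number `w₀ = lam ^ (-k/(k+1))`. -/
def w₀ (k : ℕ) (lam : ℝ) : ℝ := lam ^ (-((k : ℝ) / ((k : ℝ) + 1)))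

/-- The root of unity `Λ = exp (2 π i / (k+1))`. -/
def rootΛ (k : ℕ) : ℂ := Complex.exp (2 * Real.pi * Complex.I / ((k : ℂ) + 1))

/-- The point of `(ℂ ∪ {∞}) ^ 2` with finite coordinates `z` and `w`. -/
def finPoint (z w : ℂ) : OnePoint ℂ × OnePoint ℂ := ((z : OnePoint ℂ), (w : OnePoint ℂ))

/-- The base point `(1, w₀)` of `M`. -/
def basePair (k : ℕ) (lam : ℝ) : OnePoint ℂ × OnePoint ℂ := finPoint 1 (w₀ k lam : ℂ)

/-- The matrix `(G, -G²; 1, -G) * (Ω / dz)` at the point `(z, w)`, for the Weierstrass data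
`G = lam ^ (k/(k+1)) * w` and `Ω = c * dz / (z * w)`. -/
def bryantMatrix (k : ℕ) (lam c : ℝ) (z w : ℂ) : Matrix (Fin 2) (Fin 2) ℂ :=
  let G : ℂ := ((lam ^ ((k : ℝ) / ((k : ℝ) + 1)) : ℝ) : ℂ) * w
  ((c : ℂ) / (z * w)) • !![G, -G ^ 2; 1, -G]

/-- `F : E → SL(2, ℂ)` is a solution of `dF * F⁻¹ = (G, -G²; 1, -G) * Ω` on the covering space
`π : E → M`: it is continuous and, near every point of `E` where `z` is a local coordinate
(i.e. where `z ≠ lam` and `z ≠ 1/lam`), it is a function of `z` with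
`dF/dz = (G, -G²; 1, -G) * (Ω/dz) * F`. The remaining points form a discrete set, at which the
matrix-valued one-form extends holomorphically; by continuity and the removable singularity
theorem, `F` is holomorphic there and satisfies the equation there as well. -/
def IsSolution {k : ℕ} {lam : ℝ} (c : ℝ) {E : Type} [TopologicalSpace E]
    (π : E → puncturedCurve k lam) (F : E → SL(2, ℂ)) : Prop :=
  (Continuous fun x => (F x : Matrix (Fin 2) (Fin 2) ℂ)) ∧
  ∀ x : E, zCoord (π x) ≠ (lam : ℂ) → zCoord (π x) ≠ (lam : ℂ)⁻¹ →
    ∃ Y : ℂ → Matrix (Fin 2) (Fin 2) ℂ,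
      (∀ᶠ y in 𝓝 x, (F y : Matrix (Fin 2) (Fin 2) ℂ) = Y (zCoord (π y))) ∧
      ∀ i j, HasDerivAt (fun ζ => Y ζ i j)
        ((bryantMatrix k lam c (zCoord (π x)) (wCoord (π x)) *
          (F x : Matrix (Fin 2) (Fin 2) ℂ)) i j)
        (zCoord (π x))

/-- `γ` is a loop `γ₁`: it starts at `(1, w₀)`, runs through `Im z < 0` to a point `(x, w)` with
`0 < x < 1/lam`, then through `Im z > 0` to `(1, Λ * w₀)`, then through `Im z > 0` to
`(1/x, Λ / (lam ^ (2k/(k+1)) * w))`, and then through `Im z < 0` back to `(1, w₀)`. -/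
def IsLoop₁ {k : ℕ} {lam : ℝ} (γ : I → puncturedCurve k lam) : Prop :=
  Continuous γ ∧ ∃ (t₁ t₂ t₃ : I) (x : ℝ) (w : ℂ),
    0 < t₁ ∧ t₁ < t₂ ∧ t₂ < t₃ ∧ t₃ < 1 ∧ 0 < x ∧ x < lam⁻¹ ∧
    (γ 0).1 = basePair k lam ∧
    (∀ t, 0 < t → t < t₁ → (zCoord (γ t)).im < 0) ∧
    (γ t₁).1 = finPoint x w ∧
    (∀ t, t₁ < t → t < t₂ → 0 < (zCoord (γ t)).im) ∧
    (γ t₂).1 = finPoint 1 (rootΛ k * (w₀ k lam : ℂ)) ∧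
    (∀ t, t₂ < t → t < t₃ → 0 < (zCoord (γ t)).im) ∧
    (γ t₃).1 = finPoint (1 / (x : ℂ))
      (rootΛ k / (((lam ^ (2 * (k : ℝ) / ((k : ℝ) + 1)) : ℝ) : ℂ) * w)) ∧
    (∀ t, t₃ < t → t < 1 → (zCoord (γ t)).im < 0) ∧
    (γ 1).1 = basePair k lam

/-- `γ` is a loop `γ₂`: it starts at `(1, w₀)`, runs through `Im z < 0` to a point with `z`
real and negative, and then through `Im z > 0` back to `(1, w₀)`. -/
def IsLoop₂ {k : ℕ} {lam : ℝ} (γ : I → puncturedCurve k lam) : Prop :=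
  Continuous γ ∧ ∃ (t₁ : I) (x : ℝ),
    0 < t₁ ∧ t₁ < 1 ∧ x < 0 ∧
    (γ 0).1 = basePair k lam ∧
    (∀ t, 0 < t → t < t₁ → (zCoord (γ t)).im < 0) ∧
    zCoord (γ t₁) = (x : ℂ) ∧
    (∀ t, t₁ < t → t < 1 → 0 < (zCoord (γ t)).im) ∧
    (γ 1).1 = basePair k lam

/-- The monodromy `Φ` of `F` along the loop `π ∘ Γ`, where `Γ` is a path in the universal cover:
`F (Γ 1) = F (Γ 0) * Φ`. If `τ` is the deck transformation with `τ (Γ 0) = Γ 1`, then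
`F ∘ τ = F * Φ`. -/
def monodromy {E : Type} [TopologicalSpace E] (F : E → SL(2, ℂ)) (Γ : C(I, E)) : SL(2, ℂ) :=
  (F (Γ 0))⁻¹ * F (Γ 1)

/-- The matrix `e₃ = diag (1, -1)`. -/
def e₃ : Matrix (Fin 2) (Fin 2) ℂ := !![1, 0; 0, -1]

/-- `SU(2)`, inside `SL(2, ℂ)`. -/
def SU2 : Set SL(2, ℂ) :=
  {a | (a : Matrix (Fin 2) (Fin 2) ℂ) ∈ Matrix.specialUnitaryGroup (Fin 2) ℂ}

/-- `SU(1, 1)`, inside `SL(2, ℂ)`. -/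
def SU11 : Set SL(2, ℂ) :=
  {a | (a : Matrix (Fin 2) (Fin 2) ℂ) * e₃ * (a : Matrix (Fin 2) (Fin 2) ℂ)ᴴ = e₃}

/-- Hyperbolic space `H³ = {a a* | a ∈ SL(2, ℂ)}`. -/
def hyperbolicSpace : Set (Matrix (Fin 2) (Fin 2) ℂ) :=
  Set.range fun a : SL(2, ℂ) =>
    (a : Matrix (Fin 2) (Fin 2) ℂ) * (a : Matrix (Fin 2) (Fin 2) ℂ)ᴴ

/-- De Sitter space `S³₁ = {a e₃ a* | a ∈ SL(2, ℂ)}`. -/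
def deSitterSpace : Set (Matrix (Fin 2) (Fin 2) ℂ) :=
  Set.range fun a : SL(2, ℂ) =>
    (a : Matrix (Fin 2) (Fin 2) ℂ) * e₃ * (a : Matrix (Fin 2) (Fin 2) ℂ)ᴴ

/-- The surface `f_H = F F*`. -/
def surfaceH {E : Type} (F : E → SL(2, ℂ)) (x : E) : hyperbolicSpace :=
  ⟨(F x : Matrix (Fin 2) (Fin 2) ℂ) * (F x : Matrix (Fin 2) (Fin 2) ℂ)ᴴ, F x, rfl⟩

/-- The surface `f_S = F e₃ F*`. -/
def surfaceS {E : Type} (F : E → SL(2, ℂ)) (x : E) : deSitterSpace :=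
  ⟨(F x : Matrix (Fin 2) (Fin 2) ℂ) * e₃ * (F x : Matrix (Fin 2) (Fin 2) ℂ)ᴴ, F x, rfl⟩

/-- The map `f` on the cover `π : E → M` is well defined on `M` itself. -/
def ClosesUp {E X M : Type} (π : E → M) (f : E → X) : Prop :=
  ∃ g : M → X, ∀ x, g (π x) = f x

/-- The solution `F` has the initial value `(α, β; β, α)` at `e`. -/
def HasInitialH {E : Type} (F : E → SL(2, ℂ)) (e : E) (α β : ℝ) : Prop :=
  (F e : Matrix (Fin 2) (Fin 2) ℂ) = !![(α : ℂ), (β : ℂ); (β : ℂ), (α : ℂ)]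

/-- The solution `F` has the initial value `(α, β; α, -β)` at `e`. -/
def HasInitialS {E : Type} (F : E → SL(2, ℂ)) (e : E) (α β : ℝ) : Prop :=
  (F e : Matrix (Fin 2) (Fin 2) ℂ) = !![(α : ℂ), (β : ℂ); (α : ℂ), -(β : ℂ)]

/-- All monodromies of `F` along loops of `M` based at `π e` lie in `S`. -/
def AllMonodromiesIn {E M : Type} [TopologicalSpace E] (π : E → M) (F : E → SL(2, ℂ)) (e : E)
    (S : Set SL(2, ℂ)) : Prop :=
  ∀ Γ : C(I, E), Γ 0 = e → π (Γ 1) = π e → monodromy F Γ ∈ S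

/-- The monodromies of `F` along the loops `γ₁` and `γ₂` lie in `S`. -/
def LoopMonodromiesIn {k : ℕ} {lam : ℝ} {E : Type} [TopologicalSpace E]
    (π : E → puncturedCurve k lam) (F : E → SL(2, ℂ)) (e : E) (S : Set SL(2, ℂ)) : Prop :=
  ∀ Γ : C(I, E), Γ 0 = e → (IsLoop₁ (π ∘ Γ) ∨ IsLoop₂ (π ∘ Γ)) → monodromy F Γ ∈ S

end HigherGenusCatenoid

end

/-!
The four real intervals cut out of the real axis by `0`, `1/lam` and `lam` are treated separately.
On the plane cut along the complement of one of them, `w` has a continuous branch, and the equation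
has a solution for it; on a half plane, two solutions over branches that differ by a rotation
`w ↦ d² w` differ by the left factor `diag (d, 1/d)` and a constant right factor. So, starting from
the solution `Y` on the plane cut along `(-∞, 1/lam]` and `[lam, ∞)` with `Y(1) = 1`, all analytic
continuation is encoded by three constant matrices `B`, `P`, `Q`, for the crossings of
`(0, 1/lam)`, `(-∞, 0)` and `(lam, ∞)` (`IsConnectionData`). The solutions are not constructed:
they are read off from a solution on any covering of `M`, and by uniqueness they do not depend on
it. The monodromies along the two loops are `Q⁻¹ B` and `P` (`monodromy_of_isLoop₁`,
`monodromy_of_isLoop₂`).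

The symmetries of the curve give their shape. Complex conjugation yields `B * conj B = 1` and
`P * conj P = 1`, so that both have conjugate diagonal entries and purely imaginary off-diagonal
entries; the inversion `z ↦ 1/z` yields `Q⁻¹ = K B K⁻¹` with `K = (0, i; i, 0)` (`mul_conj_left`,
`mul_conj_neg`, `right_mul_flip`).

Let `N` be `SU(2)` or `SU(1, 1)`, and `H` the initial value of `F`. The heart of the matter is that
the surface closes as soon as `H⁻¹ B H`, `H⁻¹ P H` and `H⁻¹ Q H` lie in `N` (`closesUp_of_mem`).
No generators of the fundamental group of `M` are needed: over the upper and lower half planes,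
`F = diag (d, 1/d) * Y(z) * C` with `w = d² v(z)`, where `d` and `C` are unique up to a common sign,
and the property `C ∈ H N` is locally constant,
also across the real axis, and around the two branch points because their small punctured
neighbourhoods are connected. Hence `C ∈ H N` everywhere, so that the coset `F N` depends only
on the point `(z, w)`, first over the half planes and then everywhere by continuity.

Conversely, if `r₁ ≠ r₂`, then `H⁻¹ Q⁻¹ B H ∈ N` forces `H⁻¹ B H ∈ N`: both are one and the same
real equation, up to the factor `s + t`, the sum of the imaginary parts of the off-diagonal entries
of `B`, which divides `r₂ - r₁`. As `H⁻¹ K H` is in `N`, the condition on `Q` follows. It remains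
to write the conditions as equations between `h₁`, `h₂` and the entries of `H`, and to exhibit loops
of both types (`exists_isLoop₁`, `exists_isLoop₂`), without which the conditions on the
monodromies would be empty.
-/

noncomputable section

namespace HigherGenusCatenoid

/-! ### The differential equation on domains of the `z`-plane -/

section Equation

/-- The factor `lam ^ (k/(k+1))`, so that `G = gFactor * w`. -/
def gFactor (k : ℕ) (lam : ℝ) : ℂ := ((lam ^ ((k : ℝ) / ((k : ℝ) + 1)) : ℝ) : ℂ)

/-- `Y` solves `dY/dz = (G, -G²; 1, -G) * (Ω/dz) * Y` on the domain `U` of the `z`-plane, where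
`w = v z`. -/
def SolvesOn (k : ℕ) (lam c : ℝ) (U : Set ℂ) (v : ℂ → ℂ) (Y : ℂ → SL(2, ℂ)) : Prop :=
  ∀ z ∈ U, ∀ i j, HasDerivAt (fun ζ => (Y ζ : Matrix (Fin 2) (Fin 2) ℂ) i j)
    ((bryantMatrix k lam c z (v z) * (Y z : Matrix (Fin 2) (Fin 2) ℂ)) i j) z

/-- The diagonal matrix `diag (d, d⁻¹)`. The rotation `w ↦ d² w` acts on solutions by left
multiplication with it. -/
def diagSL (d : ℂˣ) : SL(2, ℂ) :=
  ⟨!![(d : ℂ), 0; 0, (d : ℂ)⁻¹], by simp [Matrix.det_fin_two]⟩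

/-- The matrix `(0, i; i, 0)`; conjugation with it is conjugation with `(0, 1; 1, 0)`, which has
determinant `-1`. -/
def flipSL : SL(2, ℂ) :=
  ⟨!![0, Complex.I; Complex.I, 0], by simp [Matrix.det_fin_two]⟩

/-- The entrywise complex conjugate of a matrix in `SL(2, ℂ)`. -/
def conjSL : SL(2, ℂ) →* SL(2, ℂ) := Matrix.SpecialLinearGroup.map (starRingEnd ℂ)

lemma coe_diagSL (d : ℂˣ) :
    (diagSL d : Matrix (Fin 2) (Fin 2) ℂ) = !![(d : ℂ), 0; 0, (d : ℂ)⁻¹] := rfl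

lemma coe_flipSL :
    (flipSL : Matrix (Fin 2) (Fin 2) ℂ) = !![0, Complex.I; Complex.I, 0] := rfl

lemma coe_inv_SL (A : SL(2, ℂ)) : ((A⁻¹ : SL(2, ℂ)) : Matrix (Fin 2) (Fin 2) ℂ) =
    !![(A : Matrix (Fin 2) (Fin 2) ℂ) 1 1, -(A : Matrix (Fin 2) (Fin 2) ℂ) 0 1;
      -(A : Matrix (Fin 2) (Fin 2) ℂ) 1 0, (A : Matrix (Fin 2) (Fin 2) ℂ) 0 0] := by
  rw [Matrix.SpecialLinearGroup.SL2_inv_expl]; rfl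

lemma conjSL_apply (A : SL(2, ℂ)) (i j : Fin 2) :
    (conjSL A : Matrix (Fin 2) (Fin 2) ℂ) i j =
      starRingEnd ℂ ((A : Matrix (Fin 2) (Fin 2) ℂ) i j) :=
  rfl

lemma diagSL_mul (d e : ℂˣ) : diagSL (d * e) = diagSL d * diagSL e := by
  ext i j
  fin_cases i <;> fin_cases j <;> simp [coe_diagSL, mul_comm]

lemma diagSL_one : diagSL 1 = 1 := by
  ext i j
  fin_cases i <;> fin_cases j <;> simp [coe_diagSL]

lemma diagSL_inv (d : ℂˣ) : diagSL d⁻¹ = (diagSL d)⁻¹ := by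
  rw [eq_inv_iff_mul_eq_one, ← diagSL_mul, inv_mul_cancel, diagSL_one]

lemma diagSL_neg (d : ℂˣ) : diagSL (-d) = -diagSL d := by
  ext i j
  fin_cases i <;> fin_cases j <;> simp [coe_diagSL, inv_neg]

lemma flipSL_mul_diagSL (d : ℂˣ) : flipSL * diagSL d = diagSL d⁻¹ * flipSL := by
  ext i j
  fin_cases i <;> fin_cases j <;> simp [coe_diagSL, coe_flipSL, Matrix.mul_apply, mul_comm]

lemma flipSL_inv : flipSL⁻¹ = -flipSL := by
  rw [inv_eq_iff_mul_eq_one]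
  ext i j
  fin_cases i <;> fin_cases j <;> simp [coe_flipSL]

variable {k : ℕ} {lam c : ℝ} {U V : Set ℂ} {v v' : ℂ → ℂ} {Y Z : ℂ → SL(2, ℂ)}

lemma gFactor_ne_zero (hlam : 1 < lam) : gFactor k lam ≠ 0 := by
  have : (0 : ℝ) < lam ^ ((k : ℝ) / ((k : ℝ) + 1)) := by positivity
  exact Complex.ofReal_ne_zero.2 this.ne'

lemma bryantMatrix_eq (z w : ℂ) : bryantMatrix k lam c z w =
    ((c : ℂ) / (z * w)) •
      !![gFactor k lam * w, -(gFactor k lam * w) ^ 2; 1, -(gFactor k lam * w)] :=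
  rfl

lemma SolvesOn.mono (h : SolvesOn k lam c U v Y) (hV : V ⊆ U) : SolvesOn k lam c V v Y :=
  fun z hz => h z (hV hz)

lemma SolvesOn.congr_branch (h : SolvesOn k lam c U v Y) (hv : ∀ z ∈ U, v z = v' z) :
    SolvesOn k lam c U v' Y := fun z hz i j => by
  rw [← hv z hz]; exact h z hz i j

/-- The rotation `w ↦ d² w` of the curve. -/
lemma SolvesOn.diag_mul (h : SolvesOn k lam c U v Y) (d : ℂˣ) (hv : ∀ z ∈ U, v z ≠ 0) :
    SolvesOn k lam c U (fun z => d ^ 2 * v z) (fun z => diagSL d * Y z) := fun z hz i j => by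
  have h0 := (h z hz 0 j).const_mul (d : ℂ)
  have h1 := (h z hz 1 j).const_mul ((d : ℂ)⁻¹)
  have hv := hv z hz
  have hd := d.ne_zero
  fin_cases i
  · convert! h0 using 1
    · funext ζ; simp [coe_diagSL, Matrix.mul_apply, Fin.sum_univ_two]
    · simp [Matrix.SpecialLinearGroup.coe_mul, coe_diagSL, bryantMatrix_eq, Matrix.mul_apply,
        Fin.sum_univ_two, -Matrix.cons_mul]
      rcases eq_or_ne z 0 with rfl | hz0
      · simp
      · field_simp
  · convert! h1 using 1
    · funext ζ; simp [coe_diagSL, Matrix.mul_apply, Fin.sum_univ_two]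
    · simp [Matrix.SpecialLinearGroup.coe_mul, coe_diagSL, bryantMatrix_eq, Matrix.mul_apply,
        Fin.sum_univ_two, -Matrix.cons_mul]
      rcases eq_or_ne z 0 with rfl | hz0
      · simp
      · field_simp

/-- The reflection `(z, w) ↦ (conj z, conj w)` of the curve. -/
lemma SolvesOn.conj (h : SolvesOn k lam c U v Y) :
    SolvesOn k lam c (starRingEnd ℂ ⁻¹' U) (fun z => starRingEnd ℂ (v (starRingEnd ℂ z)))
      (fun z => conjSL (Y (starRingEnd ℂ z))) := fun z hz i j => by
  have h0 := (h _ hz i j).conj_conj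
  convert! h0 using 1
  · simp [Matrix.mul_apply, Fin.sum_univ_two, bryantMatrix_eq, conjSL_apply, gFactor]
    fin_cases i <;> simp
  · simp

/-- The symmetry `(z, w) ↦ (1/z, 1 / (lam ^ (2k/(k+1)) * w))` of the curve. -/
lemma SolvesOn.inversion (h : SolvesOn k lam c U v Y) (hlam : 1 < lam) (h0 : ∀ z ∈ U, z ≠ 0)
    (hv : ∀ z ∈ U, v z ≠ 0) :
    SolvesOn k lam c ((·⁻¹) ⁻¹' U) (fun z => (gFactor k lam ^ 2 * v z⁻¹)⁻¹)
      (fun z => flipSL * Y z⁻¹ * flipSL⁻¹) := fun z hz i j => by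
  have hz0 : z ≠ 0 := fun h => h0 _ hz (by simp [h])
  have hg := gFactor_ne_zero (k := k) hlam
  have hvz := hv _ hz
  have h1 := fun i j => (h _ hz i j).comp z (hasDerivAt_inv hz0)
  have hY' : ∀ ζ i j, ((flipSL * Y ζ⁻¹ * flipSL⁻¹ : SL(2, ℂ)) : Matrix (Fin 2) (Fin 2) ℂ) i j =
      (Y ζ⁻¹ : Matrix (Fin 2) (Fin 2) ℂ) (1 - i) (1 - j) := fun ζ i j => by
    fin_cases i <;> fin_cases j <;>
      simp [Matrix.SpecialLinearGroup.coe_mul, coe_inv_SL, coe_flipSL, Matrix.mul_apply,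
        Fin.sum_univ_two, -Matrix.SpecialLinearGroup.coe_inv, -Matrix.cons_mul] <;>
      (ring_nf; simp)
  convert! h1 (1 - i) (1 - j) using 1
  · funext ζ; exact hY' ζ i j
  · rw [Matrix.mul_apply, Fin.sum_univ_two, hY', hY', Matrix.mul_apply, Fin.sum_univ_two]
    fin_cases i <;> fin_cases j <;> simp [bryantMatrix_eq] <;> field_simp <;> ring

/-- Two solutions differ by a constant right factor, because `Y⁻¹ * Z` has derivative zero. -/
lemma SolvesOn.exists_eq_mul (hY : SolvesOn k lam c U v Y) (hZ : SolvesOn k lam c U v Z)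
    (hU : IsOpen U) (hU' : IsPreconnected U) : ∃ C : SL(2, ℂ), ∀ z ∈ U, Z z = Y z * C := by
  have key : ∀ i j, ∀ z ∈ U, HasDerivAt
      (fun ζ => (((Y ζ)⁻¹ * Z ζ : SL(2, ℂ)) : Matrix (Fin 2) (Fin 2) ℂ) i j) 0 z := by
    intro i j z hz
    have a := hY z hz
    have b := hZ z hz
    have a00 := a 0 0
    have a01 := a 0 1
    have a10 := a 1 0
    have a11 := a 1 1
    have b0 := b 0 j
    have b1 := b 1 j
    fin_cases i
    · convert! (a11.mul b0).sub (a01.mul b1) using 1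
      · funext ζ
        simp [Matrix.mul_apply, Fin.sum_univ_two, coe_inv_SL, -Matrix.SpecialLinearGroup.coe_inv,
          sub_eq_add_neg]
      · simp [Matrix.mul_apply, Fin.sum_univ_two, bryantMatrix_eq]
        ring
    · convert! (a00.mul b1).sub (a10.mul b0) using 1
      · funext ζ
        simp [Matrix.mul_apply, Fin.sum_univ_two, coe_inv_SL, -Matrix.SpecialLinearGroup.coe_inv]
        ring
      · simp [Matrix.mul_apply, Fin.sum_univ_two, bryantMatrix_eq]
        ring
  rcases U.eq_empty_or_nonempty with rfl | ⟨a, ha⟩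
  · exact ⟨1, by simp⟩
  refine ⟨(Y a)⁻¹ * Z a, fun z hz => ?_⟩
  rw [eq_comm, ← eq_inv_mul_iff_mul_eq]
  ext i j
  exact hU.is_const_of_fderiv_eq_zero (𝕜 := ℂ) hU'
    (fun x hx => (key i j x hx).differentiableAt.differentiableWithinAt)
    (fun x hx => by
      ext; simpa using (key i j x hx).deriv) ha hz

end Equation

/-! ### Slit domains and branches of `w` -/

section Branches

/-- The complex plane cut along the part of the real axis outside `S`. -/
def slitDomain (S : Set ℝ) : Set ℂ := {z | z.im ≠ 0 ∨ z.re ∈ S}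

/-- The Möbius transformation `m` with `w ^ (k + 1) = z * m(z) ^ k` on the curve. -/
def mobius (lam : ℝ) (z : ℂ) : ℂ := (z - (lam : ℂ)⁻¹) / ((lam : ℂ) - z)

/-- `v` is a continuous branch of `w` as a function of `z` on the domain `U`, which contains none
of the values `0`, `lam`, `1/lam`. -/
def IsBranch (k : ℕ) (lam : ℝ) (U : Set ℂ) (v : ℂ → ℂ) : Prop :=
  ContinuousOn v U ∧ ∀ z ∈ U, z ≠ 0 ∧ z ≠ (lam : ℂ) ∧ z ≠ (lam : ℂ)⁻¹ ∧
    v z ^ (k + 1) = z * mobius lam z ^ k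

/-- `exp ((a + k b) / (k + 1))`, a `(k + 1)`-th root of `exp a * (exp b) ^ k`. -/
def rootExp (k : ℕ) (a b : ℂ) : ℂ := Complex.exp ((a + k * b) / (k + 1))

/-- The branch of `w` that is positive on `(1/lam, lam)`. -/
def branchMid (k : ℕ) (lam : ℝ) (z : ℂ) : ℂ :=
  rootExp k (Complex.log z) (Complex.log (mobius lam z))

/-- The continuation of `branchMid` from the lower half plane across `(0, 1/lam)` or
`(lam, ∞)`. -/
def branchSide (k : ℕ) (lam : ℝ) (z : ℂ) : ℂ :=
  rootExp k (Complex.log z) (Complex.log (-mobius lam z) - Real.pi * Complex.I)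

/-- The continuation of `branchMid` from the lower half plane across `(-∞, 0)`. -/
def branchNeg (k : ℕ) (lam : ℝ) (z : ℂ) : ℂ :=
  rootExp k (Complex.log (-z) - Real.pi * Complex.I)
    (Complex.log (-mobius lam z) - Real.pi * Complex.I)

/-- The square root `exp (π i / (k+1))` of `Λ`. -/
def rootEps (k : ℕ) : ℂˣ := Units.mk0 (Complex.exp (Real.pi * Complex.I / (k + 1)))
  (Complex.exp_ne_zero _)

variable {k : ℕ} {lam : ℝ} {S : Set ℝ} {z : ℂ}

lemma natCast_add_one_ne_zero' (k : ℕ) : (k : ℂ) + 1 ≠ 0 := by exact_mod_cast k.succ_ne_zero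

lemma rootEps_sq (k : ℕ) : (rootEps k : ℂ) ^ 2 = rootΛ k := by
  simp only [rootEps, rootΛ, Units.val_mk0, ← Complex.exp_nat_mul]
  congr 1
  push_cast
  ring

lemma conj_rootEps (k : ℕ) : starRingEnd ℂ (rootEps k : ℂ) = (rootEps k : ℂ)⁻¹ := by
  simp only [rootEps, Units.val_mk0, ← Complex.exp_conj, ← Complex.exp_neg]
  congr 1
  simp [neg_div]

lemma conjSL_diagSL_rootEps (k : ℕ) : conjSL (diagSL (rootEps k)) = diagSL (rootEps k)⁻¹ := by
  ext i j
  rw [conjSL_apply, coe_diagSL, coe_diagSL]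
  fin_cases i <;> fin_cases j <;> simp [conj_rootEps]

lemma rootExp_ne_zero (a b : ℂ) : rootExp k a b ≠ 0 := Complex.exp_ne_zero _

lemma rootExp_pow (a b : ℂ) :
    rootExp k a b ^ (k + 1) = Complex.exp a * Complex.exp b ^ k := by
  have h := natCast_add_one_ne_zero' k
  rw [rootExp, ← Complex.exp_nat_mul, ← Complex.exp_nat_mul, ← Complex.exp_add]
  congr 1
  push_cast
  field_simp

lemma rootExp_add (a b a' b' : ℂ) :
    rootExp k (a + a') (b + b') = rootExp k a b * rootExp k a' b' := by
  rw [rootExp, rootExp, rootExp, ← Complex.exp_add]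
  congr 1
  ring

/-- A turn of `m(z)` alone around `0` rotates `w` by `Λ`. -/
lemma rootExp_zero_neg_two_pi :
    rootExp k 0 (-(2 * Real.pi * Complex.I)) = (rootEps k : ℂ) ^ 2 := by
  have h := natCast_add_one_ne_zero' k
  rw [rootEps_sq, rootExp, rootΛ, ← Complex.exp_periodic ((0 + _) / _)]
  congr 1
  field_simp
  ring

/-- A simultaneous turn of `z` and `m(z)` around `0` leaves `w` unchanged. -/
lemma rootExp_neg_two_pi :
    rootExp k (-(2 * Real.pi * Complex.I)) (-(2 * Real.pi * Complex.I)) = 1 := by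
  have h := natCast_add_one_ne_zero' k
  rw [rootExp, ← Complex.exp_periodic]
  refine Eq.trans ?_ Complex.exp_zero
  congr 1
  field_simp
  ring

lemma rootExp_zero_two_pi :
    rootExp k 0 (2 * Real.pi * Complex.I) = ((rootEps k)⁻¹ : ℂˣ) ^ 2 := by
  have h1 := rootExp_zero_neg_two_pi (k := k)
  have h2 : rootExp k 0 (2 * Real.pi * Complex.I) *
      rootExp k 0 (-(2 * Real.pi * Complex.I)) = 1 := by
    rw [← rootExp_add]; simp [rootExp]
  rw [h1] at h2
  rw [Units.val_inv_eq_inv_val, inv_pow]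
  exact eq_inv_of_mul_eq_one_left h2

lemma rootExp_two_pi :
    rootExp k (2 * Real.pi * Complex.I) (2 * Real.pi * Complex.I) = 1 := by
  have h1 := rootExp_neg_two_pi (k := k)
  have h2 : rootExp k (2 * Real.pi * Complex.I) (2 * Real.pi * Complex.I) *
      rootExp k (-(2 * Real.pi * Complex.I)) (-(2 * Real.pi * Complex.I)) = 1 := by
    rw [← rootExp_add]; simp [rootExp]
  rwa [h1, mul_one] at h2

lemma conj_rootExp (a b : ℂ) : starRingEnd ℂ (rootExp k a b) =
    rootExp k (starRingEnd ℂ a) (starRingEnd ℂ b) := by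
  simp [rootExp, ← Complex.exp_conj]

lemma rootExp_neg (a b : ℂ) : rootExp k (-a) (-b) = (rootExp k a b)⁻¹ := by
  rw [rootExp, rootExp, ← Complex.exp_neg]
  congr 1
  ring

lemma rootExp_zero_log (hlam : 1 < lam) :
    rootExp k 0 (2 * Real.log lam) = gFactor k lam ^ 2 := by
  rw [gFactor, Real.rpow_def_of_pos (by linarith), Complex.ofReal_exp, ← Complex.exp_nat_mul,
    rootExp]
  congr 1
  push_cast
  ring

lemma isOpen_slitDomain (hI : IsOpen S) : IsOpen (slitDomain S) :=
  (isOpen_ne_fun Complex.continuous_im continuous_const).union (hI.preimage Complex.continuous_re)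

lemma starConvex_slitDomain (hI : Convex ℝ S) {a : ℝ} (ha : a ∈ S) :
    StarConvex ℝ (a : ℂ) (slitDomain S) := by
  intro z hz s t hs ht hst
  rcases ht.eq_or_lt with rfl | ht
  · right
    have : s = 1 := by linarith
    simpa [this] using ha
  rcases hz with hz | hz
  · left
    simp [hz, ht.ne']
  · right
    simpa using hI ha hz hs ht.le hst

lemma isPreconnected_slitDomain (hI : Convex ℝ S) {a : ℝ} (ha : a ∈ S) :
    IsPreconnected (slitDomain S) :=
  ((starConvex_slitDomain hI ha).isPathConnected
    (Or.inr (by simpa using ha))).isConnected.isPreconnected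

lemma slitDomain_cases (hz : z ∈ slitDomain S) : z.im ≠ 0 ∨ ∃ x ∈ S, z = (x : ℝ) := by
  by_cases h : z.im = 0
  · rcases hz with hz | hz
    · exact absurd h hz
    · exact Or.inr ⟨z.re, hz, Complex.ext rfl h⟩
  · exact Or.inl h

lemma ofReal_mem_slitDomain {x : ℝ} (hx : x ∈ S) : (x : ℂ) ∈ slitDomain S := Or.inr hx

lemma conj_preimage_slitDomain (S : Set ℝ) : starRingEnd ℂ ⁻¹' slitDomain S = slitDomain S := by
  ext z
  simp [slitDomain]

lemma inv_mem_slitDomain {J : Set ℝ} (hIJ : ∀ x ∈ S, x⁻¹ ∈ J) (hz : z ∈ slitDomain S) :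
    z⁻¹ ∈ slitDomain J := by
  rcases slitDomain_cases hz with h | ⟨x, hx, rfl⟩
  · left
    rw [Complex.inv_im]
    have : z ≠ 0 := by rintro rfl; simp at h
    exact div_ne_zero (neg_ne_zero.2 h) (Complex.normSq_pos.2 this).ne'
  · rw [← Complex.ofReal_inv]
    exact ofReal_mem_slitDomain (hIJ x hx)

lemma slitDomain_ne_ofReal {x : ℝ} (hx : x ∉ S) (hz : z ∈ slitDomain S) : z ≠ x := by
  rintro rfl
  rcases hz with h | h
  · simp at h
  · exact hx (by simpa using h)

lemma mobius_ofReal (x : ℝ) : mobius lam (x : ℂ) = (((x - lam⁻¹) / (lam - x) : ℝ) : ℂ) := by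
  simp [mobius]

/-- The coefficients of `m` are real with positive determinant, so it preserves both half
planes. -/
lemma mobius_im (z : ℂ) (hlam : 1 < lam) (hz : z ≠ lam) :
    ∃ r : ℝ, 0 < r ∧ (mobius lam z).im = r * z.im := by
  have h1 : (lam : ℂ) - z ≠ 0 := sub_ne_zero.2 hz.symm
  have h2 := Complex.normSq_pos.2 h1
  refine ⟨(lam - lam⁻¹) / Complex.normSq ((lam : ℂ) - z), ?_, ?_⟩
  · have : lam⁻¹ < 1 := inv_lt_one_of_one_lt₀ hlam
    exact div_pos (by linarith) h2
  · rw [mobius, Complex.div_im]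
    simp only [Complex.sub_im, Complex.sub_re, Complex.inv_im, Complex.inv_re, Complex.ofReal_re,
      Complex.ofReal_im, Complex.normSq_ofReal]
    have : lam ≠ 0 := by linarith
    field_simp
    ring

lemma ne_ofReal_of_im_ne_zero (hz : z.im ≠ 0) (x : ℝ) : z ≠ x := by
  rintro rfl; simp at hz

lemma mobius_im_ne_zero (hlam : 1 < lam) (hz : z.im ≠ 0) : (mobius lam z).im ≠ 0 := by
  obtain ⟨r, hr, h⟩ := mobius_im z hlam (ne_ofReal_of_im_ne_zero hz lam)
  rw [h]; exact mul_ne_zero hr.ne' hz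

lemma mobius_inv (hlam : 1 < lam) (h0 : z ≠ 0) (h1 : z ≠ lam) (h2 : z ≠ (lam : ℂ)⁻¹) :
    mobius lam z⁻¹ = ((lam ^ 2 : ℝ) : ℂ)⁻¹ * (mobius lam z)⁻¹ := by
  have hl : (lam : ℂ) ≠ 0 := by exact_mod_cast (by linarith : lam ≠ 0)
  have h1 : (lam : ℂ) - z ≠ 0 := sub_ne_zero.2 h1.symm
  have h2 : (lam : ℂ) * z - 1 ≠ 0 := by
    intro h; apply h2; field_simp; linear_combination h
  unfold mobius
  push_cast
  have h3 : (lam : ℂ) - z⁻¹ ≠ 0 := by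
    intro h; apply h2; field_simp at h; linear_combination h
  field_simp

lemma mem_slitPlane_of_mem (hI : ∀ x ∈ S, 0 < x) (hz : z ∈ slitDomain S) :
    z ∈ Complex.slitPlane := by
  rcases slitDomain_cases hz with h | ⟨x, hx, rfl⟩
  · exact Or.inr h
  · exact Or.inl (by simpa using hI x hx)

lemma neg_mem_slitPlane_of_mem (hI : ∀ x ∈ S, x < 0) (hz : z ∈ slitDomain S) :
    -z ∈ Complex.slitPlane := by
  rcases slitDomain_cases hz with h | ⟨x, hx, rfl⟩
  · exact Or.inr (by simpa using h)
  · exact Or.inl (by simpa using hI x hx)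

lemma mobius_mem_slitPlane_of_mem (hlam : 1 < lam) (hI : ∀ x ∈ S, 0 < (x - lam⁻¹) / (lam - x))
    (hz : z ∈ slitDomain S) : mobius lam z ∈ Complex.slitPlane := by
  rcases slitDomain_cases hz with h | ⟨x, hx, rfl⟩
  · exact Or.inr (mobius_im_ne_zero hlam h)
  · exact Or.inl (by rw [mobius_ofReal, Complex.ofReal_re]; exact hI x hx)

lemma neg_mobius_mem_slitPlane_of_mem (hlam : 1 < lam)
    (hI : ∀ x ∈ S, (x - lam⁻¹) / (lam - x) < 0)
    (hz : z ∈ slitDomain S) : -mobius lam z ∈ Complex.slitPlane := by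
  rcases slitDomain_cases hz with h | ⟨x, hx, rfl⟩
  · exact Or.inr (by simpa using mobius_im_ne_zero hlam h)
  · exact Or.inl (by rw [mobius_ofReal, Complex.neg_re, Complex.ofReal_re]; linarith [hI x hx])

lemma continuousAt_mobius (hz : z ≠ lam) : ContinuousAt (mobius lam) z := by
  have : (lam : ℂ) - z ≠ 0 := sub_ne_zero.2 hz.symm
  unfold mobius
  fun_prop (disch := assumption)

lemma continuousAt_rootExp {X : Type*} [TopologicalSpace X] {a b : X → ℂ} {x : X}
    (ha : ContinuousAt a x) (hb : ContinuousAt b x) :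
    ContinuousAt (fun x => rootExp k (a x) (b x)) x := by
  unfold rootExp
  have := natCast_add_one_ne_zero' k
  fun_prop (disch := assumption)

lemma mobius_real_pos {x : ℝ} (hx : x ∈ Set.Ioo lam⁻¹ lam) :
    0 < (x - lam⁻¹) / (lam - x) :=
  div_pos (sub_pos.2 hx.1) (sub_pos.2 hx.2)

lemma mobius_real_neg_left (hlam : 1 < lam) {x : ℝ} (hx : x < lam⁻¹) :
    (x - lam⁻¹) / (lam - x) < 0 :=
  div_neg_of_neg_of_pos (sub_neg.2 hx) (by
    have : lam⁻¹ < 1 := inv_lt_one_of_one_lt₀ hlam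
    linarith)

lemma mobius_real_neg_right (hlam : 1 < lam) {x : ℝ} (hx : lam < x) :
    (x - lam⁻¹) / (lam - x) < 0 :=
  div_neg_of_pos_of_neg (by
    have : lam⁻¹ < 1 := inv_lt_one_of_one_lt₀ hlam
    linarith) (sub_neg.2 hx)

lemma slitDomain_ne_special (h0 : (0 : ℝ) ∉ S) (h1 : lam ∉ S) (h2 : lam⁻¹ ∉ S)
    (hz : z ∈ slitDomain S) : z ≠ 0 ∧ z ≠ (lam : ℂ) ∧ z ≠ (lam : ℂ)⁻¹ :=
  ⟨by simpa using slitDomain_ne_ofReal h0 hz, slitDomain_ne_ofReal h1 hz,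
    by simpa using slitDomain_ne_ofReal h2 hz⟩

lemma mobius_ne_zero (h1 : z ≠ lam) (h2 : z ≠ (lam : ℂ)⁻¹) : mobius lam z ≠ 0 :=
  div_ne_zero (sub_ne_zero.2 h2) (sub_ne_zero.2 h1.symm)

lemma isBranch_branchMid (hlam : 1 < lam) :
    IsBranch k lam (slitDomain (Set.Ioo lam⁻¹ lam)) (branchMid k lam) := by
  have hl : 0 < lam⁻¹ := by positivity
  have hs : ∀ z ∈ slitDomain (Set.Ioo lam⁻¹ lam), z ≠ 0 ∧ z ≠ (lam : ℂ) ∧ z ≠ (lam : ℂ)⁻¹ :=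
    fun z hz => slitDomain_ne_special (fun h => by linarith [h.1]) (fun h => lt_irrefl _ h.2)
      (fun h => lt_irrefl _ h.1) hz
  refine ⟨fun z hz => ContinuousAt.continuousWithinAt ?_, fun z hz => ⟨(hs z hz).1, (hs z hz).2.1,
    (hs z hz).2.2, ?_⟩⟩
  · exact continuousAt_rootExp
      (continuousAt_id.clog (mem_slitPlane_of_mem (fun x hx => hl.trans hx.1) hz))
      ((continuousAt_mobius (hs z hz).2.1).clog
        (mobius_mem_slitPlane_of_mem hlam (fun _ => mobius_real_pos) hz))
  · rw [branchMid, rootExp_pow, Complex.exp_log (hs z hz).1,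
      Complex.exp_log (mobius_ne_zero (hs z hz).2.1 (hs z hz).2.2)]

lemma exp_log_neg_sub_pi {x : ℂ} (hx : x ≠ 0) :
    Complex.exp (Complex.log (-x) - Real.pi * Complex.I) = x := by
  rw [Complex.exp_sub, Complex.exp_log (neg_ne_zero.2 hx), Complex.exp_pi_mul_I]
  ring

/-- The common part of the two cases `S = (0, 1/lam)` and `S = (lam, ∞)`. -/
lemma isBranch_branchSide_of (hlam : 1 < lam) (h1 : lam ∉ S) (h2 : lam⁻¹ ∉ S)
    (hI : ∀ x ∈ S, 0 < x) (hI' : ∀ x ∈ S, (x - lam⁻¹) / (lam - x) < 0) :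
    IsBranch k lam (slitDomain S) (branchSide k lam) := by
  have hs : ∀ z ∈ slitDomain S, z ≠ 0 ∧ z ≠ (lam : ℂ) ∧ z ≠ (lam : ℂ)⁻¹ :=
    fun z hz => slitDomain_ne_special (fun h => lt_irrefl _ (hI _ h)) h1 h2 hz
  refine ⟨fun z hz => ContinuousAt.continuousWithinAt ?_, fun z hz => ⟨(hs z hz).1, (hs z hz).2.1,
    (hs z hz).2.2, ?_⟩⟩
  · exact continuousAt_rootExp (continuousAt_id.clog (mem_slitPlane_of_mem hI hz))
      (((continuousAt_mobius (hs z hz).2.1).neg.clog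
        (neg_mobius_mem_slitPlane_of_mem hlam hI' hz)).sub continuousAt_const)
  · rw [branchSide, rootExp_pow, Complex.exp_log (hs z hz).1,
      exp_log_neg_sub_pi (mobius_ne_zero (hs z hz).2.1 (hs z hz).2.2)]

lemma isBranch_branchSide_left (hlam : 1 < lam) :
    IsBranch k lam (slitDomain (Set.Ioo 0 lam⁻¹)) (branchSide k lam) := by
  have : lam⁻¹ < 1 := inv_lt_one_of_one_lt₀ hlam
  exact isBranch_branchSide_of hlam (fun h => by linarith [h.2]) (fun h => lt_irrefl _ h.2)
    (fun x hx => hx.1) fun x hx => mobius_real_neg_left hlam hx.2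

lemma isBranch_branchSide_right (hlam : 1 < lam) :
    IsBranch k lam (slitDomain (Set.Ioi lam)) (branchSide k lam) := by
  have : lam⁻¹ < 1 := inv_lt_one_of_one_lt₀ hlam
  exact isBranch_branchSide_of hlam (fun h => lt_irrefl lam h)
    (fun h => by linarith [Set.mem_Ioi.1 h]) (fun x hx => by linarith [Set.mem_Ioi.1 hx])
    fun x hx => mobius_real_neg_right hlam hx

lemma isBranch_branchNeg (hlam : 1 < lam) :
    IsBranch k lam (slitDomain (Set.Iio 0)) (branchNeg k lam) := by
  have hl : 0 < lam⁻¹ := by positivity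
  have hs : ∀ z ∈ slitDomain (Set.Iio 0), z ≠ 0 ∧ z ≠ (lam : ℂ) ∧ z ≠ (lam : ℂ)⁻¹ :=
    fun z hz => slitDomain_ne_special (S := Set.Iio 0) (fun h => lt_irrefl (0 : ℝ) h)
      (fun h => by linarith [Set.mem_Iio.1 h]) (fun h => by linarith [Set.mem_Iio.1 h]) hz
  refine ⟨fun z hz => ContinuousAt.continuousWithinAt ?_, fun z hz => ⟨(hs z hz).1, (hs z hz).2.1,
    (hs z hz).2.2, ?_⟩⟩
  · exact continuousAt_rootExp
      ((continuousAt_id.neg.clog (neg_mem_slitPlane_of_mem (fun x hx => hx) hz)).sub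
        continuousAt_const)
      (((continuousAt_mobius (hs z hz).2.1).neg.clog
        (neg_mobius_mem_slitPlane_of_mem hlam
          (fun x hx => mobius_real_neg_left hlam (hl.trans' hx)) hz)).sub continuousAt_const)
  · rw [branchNeg, rootExp_pow, exp_log_neg_sub_pi (hs z hz).1,
      exp_log_neg_sub_pi (mobius_ne_zero (hs z hz).2.1 (hs z hz).2.2)]

lemma log_neg_of_im_neg {x : ℂ} (hx : x.im < 0) :
    Complex.log (-x) = Complex.log x + Real.pi * Complex.I := by
  rw [Complex.log, Complex.log, norm_neg, Complex.arg_neg_eq_arg_add_pi_of_im_neg hx]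
  push_cast
  ring

lemma log_neg_of_im_pos {x : ℂ} (hx : 0 < x.im) :
    Complex.log (-x) = Complex.log x - Real.pi * Complex.I := by
  rw [Complex.log, Complex.log, norm_neg, Complex.arg_neg_eq_arg_sub_pi_of_im_pos hx]
  push_cast
  ring

lemma mobius_im_neg (hlam : 1 < lam) (hz : z.im < 0) : (mobius lam z).im < 0 := by
  obtain ⟨r, hr, h⟩ := mobius_im z hlam (ne_ofReal_of_im_ne_zero hz.ne lam)
  rw [h]; exact mul_neg_of_pos_of_neg hr hz

lemma mobius_im_pos (hlam : 1 < lam) (hz : 0 < z.im) : 0 < (mobius lam z).im := by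
  obtain ⟨r, hr, h⟩ := mobius_im z hlam (ne_ofReal_of_im_ne_zero hz.ne' lam)
  rw [h]; exact mul_pos hr hz

lemma branchSide_of_im_neg (hlam : 1 < lam) (hz : z.im < 0) :
    branchSide k lam z = branchMid k lam z := by
  rw [branchSide, branchMid, log_neg_of_im_neg (mobius_im_neg hlam hz), add_sub_cancel_right]

lemma branchNeg_of_im_neg (hlam : 1 < lam) (hz : z.im < 0) :
    branchNeg k lam z = branchMid k lam z := by
  rw [branchNeg, branchMid, log_neg_of_im_neg (mobius_im_neg hlam hz), log_neg_of_im_neg hz,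
    add_sub_cancel_right, add_sub_cancel_right]

lemma branchSide_of_im_pos (hlam : 1 < lam) (hz : 0 < z.im) :
    branchSide k lam z = (rootEps k : ℂ) ^ 2 * branchMid k lam z := by
  rw [branchSide, branchMid, log_neg_of_im_pos (mobius_im_pos hlam hz),
    ← rootExp_zero_neg_two_pi, ← rootExp_add]
  congr 1 <;> ring

lemma branchNeg_of_im_pos (hlam : 1 < lam) (hz : 0 < z.im) :
    branchNeg k lam z = branchMid k lam z := by
  rw [branchNeg, branchMid, log_neg_of_im_pos (mobius_im_pos hlam hz), log_neg_of_im_pos hz,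
    ← one_mul (rootExp k (Complex.log z) _), ← rootExp_neg_two_pi, ← rootExp_add]
  congr 1 <;> ring

lemma mobius_conj (z : ℂ) : mobius lam (starRingEnd ℂ z) = starRingEnd ℂ (mobius lam z) := by
  simp [mobius]

lemma conj_log {x : ℂ} (hx : x ∈ Complex.slitPlane) :
    starRingEnd ℂ (Complex.log (starRingEnd ℂ x)) = Complex.log x := by
  rw [Complex.log_conj _ (Complex.slitPlane_arg_ne_pi hx), Complex.conj_conj]

lemma conj_branchMid (hlam : 1 < lam) (hz : z ∈ slitDomain (Set.Ioo lam⁻¹ lam)) :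
    starRingEnd ℂ (branchMid k lam (starRingEnd ℂ z)) = branchMid k lam z := by
  have hl : 0 < lam⁻¹ := by positivity
  rw [branchMid, conj_rootExp, mobius_conj, conj_log (mobius_mem_slitPlane_of_mem hlam
    (fun _ => mobius_real_pos) hz),
    conj_log (mem_slitPlane_of_mem (fun x hx => hl.trans hx.1) hz)]
  rfl

lemma conj_branchSide (hlam : 1 < lam) (hz : z ∈ slitDomain (Set.Ioo 0 lam⁻¹)) :
    starRingEnd ℂ (branchSide k lam (starRingEnd ℂ z)) =
      ((rootEps k)⁻¹ : ℂˣ) ^ 2 * branchSide k lam z := by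
  rw [branchSide, conj_rootExp, mobius_conj, map_sub, ← map_neg, conj_log
    (neg_mobius_mem_slitPlane_of_mem hlam (fun x hx => mobius_real_neg_left hlam hx.2) hz),
    conj_log (mem_slitPlane_of_mem (fun x hx => hx.1) hz), branchSide, ← rootExp_zero_two_pi,
    ← rootExp_add]
  congr 1
  · ring
  · simp; ring

lemma conj_branchNeg (hlam : 1 < lam) (hz : z ∈ slitDomain (Set.Iio 0)) :
    starRingEnd ℂ (branchNeg k lam (starRingEnd ℂ z)) = branchNeg k lam z := by
  have hl : 0 < lam⁻¹ := by positivity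
  rw [branchNeg, conj_rootExp, mobius_conj, map_sub, map_sub, ← map_neg, ← map_neg, conj_log
    (neg_mobius_mem_slitPlane_of_mem hlam
      (fun x hx => mobius_real_neg_left hlam (hl.trans' hx)) hz),
    conj_log (neg_mem_slitPlane_of_mem (fun x hx => hx) hz), branchNeg,
    ← one_mul (rootExp k (Complex.log (-z) - Real.pi * Complex.I) _), ← rootExp_two_pi,
    ← rootExp_add]
  congr 1 <;> simp <;> ring

lemma log_inv_sq_mul_inv (hlam : 1 < lam) {x : ℂ} (hx : x ∈ Complex.slitPlane) :
    Complex.log (((lam ^ 2 : ℝ) : ℂ)⁻¹ * x⁻¹) = -(2 * Real.log lam) - Complex.log x := by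
  have hx0 := Complex.slitPlane_ne_zero hx
  rw [← Complex.ofReal_inv, Complex.log_ofReal_mul (by positivity) (inv_ne_zero hx0),
    Complex.log_inv _ (Complex.slitPlane_arg_ne_pi hx), Real.log_inv, Real.log_pow]
  push_cast
  ring

lemma inversion_branchMid (hlam : 1 < lam) (hz : z ∈ slitDomain (Set.Ioo lam⁻¹ lam)) :
    (gFactor k lam ^ 2 * branchMid k lam z⁻¹)⁻¹ = branchMid k lam z := by
  have hl : 0 < lam⁻¹ := by positivity
  obtain ⟨h0, h1, h2, -⟩ := (isBranch_branchMid (k := k) hlam).2 z hz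
  have hz' := mem_slitPlane_of_mem (fun x hx => hl.trans hx.1) hz
  have hm := mobius_mem_slitPlane_of_mem hlam (fun _ => mobius_real_pos) hz
  rw [branchMid, mobius_inv hlam h0 h1 h2, log_inv_sq_mul_inv hlam hm,
    Complex.log_inv _ (Complex.slitPlane_arg_ne_pi hz'), ← rootExp_zero_log hlam, ← rootExp_add,
    ← rootExp_neg, branchMid]
  congr 1 <;> ring

lemma inversion_branchSide (hlam : 1 < lam) (hz : z ∈ slitDomain (Set.Ioi lam)) :
    (gFactor k lam ^ 2 * branchSide k lam z⁻¹)⁻¹ =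
      ((rootEps k)⁻¹ : ℂˣ) ^ 2 * branchSide k lam z := by
  obtain ⟨h0, h1, h2, -⟩ := (isBranch_branchSide_right (k := k) hlam).2 z hz
  have hz' := mem_slitPlane_of_mem (fun x hx => by linarith [Set.mem_Ioi.1 hx]) hz
  have hm := neg_mobius_mem_slitPlane_of_mem hlam (fun x => mobius_real_neg_right hlam) hz
  rw [branchSide, mobius_inv hlam h0 h1 h2, ← mul_neg, ← inv_neg, log_inv_sq_mul_inv hlam hm,
    Complex.log_inv _ (Complex.slitPlane_arg_ne_pi hz'), ← rootExp_zero_log hlam, ← rootExp_add,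
    ← rootExp_neg, branchSide, ← rootExp_zero_two_pi, ← rootExp_add]
  congr 1 <;> ring

lemma rootExp_zero_neg_log (hlam : 1 < lam) :
    rootExp k 0 (-Real.log lam) = (w₀ k lam : ℂ) := by
  rw [w₀, Real.rpow_def_of_pos (by linarith), Complex.ofReal_exp, rootExp]
  congr 1
  push_cast
  ring

lemma mobius_one (hlam : 1 < lam) : mobius lam 1 = ((lam⁻¹ : ℝ) : ℂ) := by
  have : lam - 1 ≠ 0 := by linarith
  have : lam ≠ 0 := by linarith
  rw [← Complex.ofReal_one, mobius_ofReal]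
  congr 1
  field_simp

lemma branchMid_one (hlam : 1 < lam) : branchMid k lam 1 = (w₀ k lam : ℂ) := by
  rw [branchMid, mobius_one hlam, Complex.log_one, ← rootExp_zero_neg_log hlam,
    ← Complex.ofReal_log (by positivity), Real.log_inv]
  push_cast
  rfl

end Branches

/-! ### The curve -/

section Curve

variable {k : ℕ} {lam : ℝ}

lemma curveFun_coe {z : ℂ} (hz : z ≠ lam) :
    curveFun k lam z = ((z * mobius lam z ^ k : ℂ) : OnePoint ℂ) := by
  simp [curveFun, hz, mobius]

lemma curveFun_lam : curveFun k lam ((lam : ℂ) : OnePoint ℂ) = ∞ := by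
  simp [curveFun]

lemma map_pow_eq_infty {w : OnePoint ℂ}
    (h : OnePoint.map (fun w : ℂ => w ^ (k + 1)) w = ∞) : w = ∞ := by
  induction w using OnePoint.rec with
  | infty => rfl
  | coe w => simp at h

lemma map_pow_eq_coe {w : OnePoint ℂ} {a : ℂ}
    (h : OnePoint.map (fun w : ℂ => w ^ (k + 1)) w = (a : OnePoint ℂ)) :
    ∃ b : ℂ, w = b ∧ b ^ (k + 1) = a := by
  induction w using OnePoint.rec with
  | infty => simp at h
  | coe w => exact ⟨w, rfl, by simpa using h⟩

lemma coe_zCoord (P : puncturedCurve k lam) : P.1.1 = (zCoord P : OnePoint ℂ) := by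
  obtain ⟨⟨a, b⟩, hP, h0, h1⟩ := P
  induction a using OnePoint.rec with
  | infty =>
    refine absurd ?_ h1
    have : b = ∞ := map_pow_eq_infty (k := k) (by
      rw [compactCurve, Set.mem_ofPred_eq] at hP
      simpa [curveFun] using hP)
    rw [this]
  | coe a => rfl

lemma snd_eq_infty {P : puncturedCurve k lam} (h : zCoord P = lam) : P.1.2 = ∞ := by
  have hP : OnePoint.map (fun w : ℂ => w ^ (k + 1)) P.1.2 = curveFun k lam P.1.1 := P.2.1
  rw [coe_zCoord, h, curveFun_lam] at hP
  exact map_pow_eq_infty hP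

lemma coe_wCoord {P : puncturedCurve k lam} (h : zCoord P ≠ lam) :
    P.1.2 = (wCoord P : OnePoint ℂ) ∧
      wCoord P ^ (k + 1) = zCoord P * mobius lam (zCoord P) ^ k := by
  have hP : OnePoint.map (fun w : ℂ => w ^ (k + 1)) P.1.2 = curveFun k lam P.1.1 := P.2.1
  rw [coe_zCoord, curveFun_coe h] at hP
  obtain ⟨b, hb, hb'⟩ := map_pow_eq_coe hP
  have : wCoord P = b := by rw [wCoord, hb]; rfl
  rw [this]
  exact ⟨hb, hb'⟩

lemma zCoord_ne_zero (hlam : 1 < lam) (P : puncturedCurve k lam) : zCoord P ≠ 0 := by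
  intro h
  have h0 : zCoord P ≠ lam := by
    rw [h]; exact_mod_cast (by linarith : (0 : ℝ) ≠ lam)
  obtain ⟨h1, h2⟩ := coe_wCoord h0
  rw [h, zero_mul] at h2
  have h3 := coe_zCoord P
  rw [eq_zero_of_pow_eq_zero h2] at h1
  rw [h] at h3
  exact P.2.2.1 (Prod.ext h3 h1)

lemma curve_ext {P Q : puncturedCurve k lam} (h1 : zCoord P = zCoord Q)
    (h2 : wCoord P = wCoord Q) : P = Q := by
  refine Subtype.ext (Prod.ext (by rw [coe_zCoord, coe_zCoord, h1]) ?_)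
  by_cases h : zCoord P = lam
  · rw [snd_eq_infty h, snd_eq_infty (h1 ▸ h)]
  · rw [(coe_wCoord h).1, (coe_wCoord (h1 ▸ h)).1, h2]

/-- The point of the curve with finite coordinates `z` and `w`. -/
def curvePoint (z w : ℂ) (h0 : z ≠ 0) (h1 : z ≠ lam)
    (h : w ^ (k + 1) = z * mobius lam z ^ k) : puncturedCurve k lam :=
  ⟨finPoint z w, by simp [compactCurve, finPoint, curveFun_coe h1, h], by simp [finPoint, h0],
    by simp [finPoint]⟩

lemma zCoord_of_eq {P : puncturedCurve k lam} {z w : ℂ} (h : P.1 = finPoint z w) :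
    zCoord P = z := by
  rw [zCoord, h]; rfl

lemma wCoord_of_eq {P : puncturedCurve k lam} {z w : ℂ} (h : P.1 = finPoint z w) :
    wCoord P = w := by
  rw [wCoord, h]; rfl

lemma eq_finPoint {P : puncturedCurve k lam} (h : zCoord P ≠ lam) :
    P.1 = finPoint (zCoord P) (wCoord P) := Prod.ext (coe_zCoord P) (coe_wCoord h).1

lemma continuousAt_finiteValue {x : OnePoint ℂ} (hx : x ≠ ∞) : ContinuousAt finiteValue x := by
  induction x using OnePoint.rec with
  | infty => exact absurd rfl hx
  | coe x => exact OnePoint.continuousAt_coe.2 continuousAt_id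

lemma continuous_zCoord : Continuous (zCoord : puncturedCurve k lam → ℂ) := by
  refine continuous_iff_continuousAt.2 fun P => ?_
  have h : ContinuousAt finiteValue P.1.1 := continuousAt_finiteValue (by simp [coe_zCoord])
  exact h.comp (f := fun P : puncturedCurve k lam => P.1.1)
    (continuous_fst.comp continuous_subtype_val).continuousAt

lemma continuousAt_wCoord {P : puncturedCurve k lam} (h : zCoord P ≠ lam) :
    ContinuousAt (wCoord : puncturedCurve k lam → ℂ) P := by
  have h : ContinuousAt finiteValue P.1.2 := continuousAt_finiteValue (by simp [coe_wCoord h])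
  exact h.comp (f := fun P : puncturedCurve k lam => P.1.2)
    (continuous_snd.comp continuous_subtype_val).continuousAt

lemma continuousOn_curve {X : Type*} [TopologicalSpace X] {s : Set X} {f : X → puncturedCurve k lam}
    {a b : X → ℂ} (ha : ContinuousOn a s) (hb : ContinuousOn b s)
    (h : ∀ x ∈ s, (f x).1 = finPoint (a x) (b x)) : ContinuousOn f s := by
  rw [Topology.IsInducing.subtypeVal.continuousOn_iff]
  refine ContinuousOn.congr ?_ h
  exact (OnePoint.continuous_coe.comp_continuousOn ha).prodMk
    (OnePoint.continuous_coe.comp_continuousOn hb)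

/-- At a point over `lam` or `1/lam`, where the projection `z` is totally ramified, the sets
`{|z - z₀| < r}` form a neighbourhood basis on the curve. -/
lemma comap_zCoord_le_nhds (hk : 1 ≤ k) (hlam : 1 < lam) {P : puncturedCurve k lam}
    (hP : zCoord P = lam ∨ zCoord P = (lam : ℂ)⁻¹) :
    Filter.comap zCoord (𝓝 (zCoord P)) ≤ 𝓝 P := by
  have hl : (lam : ℂ) ≠ 0 := by exact_mod_cast (by linarith : lam ≠ 0)
  have hll : (lam : ℂ) ≠ (lam : ℂ)⁻¹ := by
    rw [← Complex.ofReal_inv]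
    have : lam⁻¹ < 1 := inv_lt_one_of_one_lt₀ hlam
    exact_mod_cast (by linarith : lam ≠ lam⁻¹)
  have hk0 : k ≠ 0 := by omega
  rw [Topology.IsInducing.subtypeVal.nhds_eq_comap, ← Filter.map_le_iff_le_comap, nhds_prod_eq]
  refine Filter.Tendsto.prodMk (f := Filter.comap zCoord (𝓝 (zCoord P))) (m₁ := fun Q => Q.1.1)
    (m₂ := fun Q => Q.1.2) ?_ ?_
  · rw [coe_zCoord P]
    have : (fun Q : puncturedCurve k lam => Q.1.1) = fun Q => ((zCoord Q : ℂ) : OnePoint ℂ) :=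
      funext coe_zCoord
    rw [this]
    exact (OnePoint.continuous_coe.tendsto _).comp Filter.tendsto_comap
  · rcases hP with hP | hP
    · rw [snd_eq_infty hP, hP, OnePoint.hasBasis_nhds_infty.tendsto_right_iff]
      rintro s ⟨-, hs⟩
      obtain ⟨R, hR⟩ := hs.isBounded.exists_norm_le
      have hc : ∀ᶠ z in 𝓝 (lam : ℂ),
          R ^ (k + 1) * ‖(lam : ℂ) - z‖ ^ k < ‖z * (z - (lam : ℂ)⁻¹) ^ k‖ := by
        refine (ContinuousAt.eventually_lt (by fun_prop) (by fun_prop) ?_)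
        simpa [hk0, sub_ne_zero.2 hll] using hl
      filter_upwards [Filter.preimage_mem_comap hc] with Q hQ
      by_cases hz : zCoord Q = lam
      · exact Or.inr (snd_eq_infty hz)
      · obtain ⟨h1, h2⟩ := coe_wCoord hz
        left
        refine ⟨wCoord Q, fun hws => ?_, h1.symm⟩
        have h3 : (lam : ℂ) - zCoord Q ≠ 0 := sub_ne_zero.2 (Ne.symm hz)
        have h4 : wCoord Q ^ (k + 1) * ((lam : ℂ) - zCoord Q) ^ k =
            zCoord Q * (zCoord Q - (lam : ℂ)⁻¹) ^ k := by
          rw [h2, mobius, div_pow]; field_simp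
        rw [Set.mem_preimage, Set.mem_ofPred_eq] at hQ
        refine absurd hQ (not_lt.2 ?_)
        rw [← h4, norm_mul, norm_pow, norm_pow]
        gcongr
        exact hR _ hws
    · have hz : zCoord P ≠ lam := by rw [hP]; exact hll.symm
      obtain ⟨h1, h2⟩ := coe_wCoord hz
      have hm : mobius lam (lam : ℂ)⁻¹ = 0 := by simp [mobius]
      rw [hP, hm, zero_pow hk0, mul_zero] at h2
      rw [h1, eq_zero_of_pow_eq_zero h2, hP]
      have hc : ContinuousAt (fun z : ℂ => ‖z * mobius lam z ^ k‖) (lam : ℂ)⁻¹ :=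
        (continuousAt_id.mul ((continuousAt_mobius hll.symm).pow k)).norm
      have hw : Filter.Tendsto (wCoord : puncturedCurve k lam → ℂ)
          (Filter.comap zCoord (𝓝 (lam : ℂ)⁻¹)) (𝓝 0) := by
        rw [tendsto_zero_iff_norm_tendsto_zero, Metric.tendsto_nhds]
        intro ε hε
        have hc' : ∀ᶠ z in 𝓝 (lam : ℂ)⁻¹, ‖z * mobius lam z ^ k‖ < ε ^ (k + 1) := by
          refine hc.eventually_lt continuousAt_const ?_
          rw [hm, zero_pow hk0, mul_zero, norm_zero]
          positivity
        filter_upwards [Filter.preimage_mem_comap hc',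
          Filter.preimage_mem_comap (isOpen_ne.mem_nhds hll.symm)] with Q hQ hQ'
        rw [Set.mem_preimage, Set.mem_ofPred_eq, ← (coe_wCoord hQ').2, norm_pow] at hQ
        simpa using lt_of_pow_lt_pow_left₀ _ hε.le hQ
      refine ((OnePoint.continuous_coe.tendsto 0).comp hw).congr' ?_
      filter_upwards [Filter.preimage_mem_comap (isOpen_ne.mem_nhds hll.symm)] with Q hQ
      exact (coe_wCoord hQ).1.symm

lemma eq_basePair (hlam : 1 < lam) {P : puncturedCurve k lam} :
    P.1 = basePair k lam ↔ zCoord P = 1 ∧ wCoord P = w₀ k lam := by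
  constructor
  · exact fun h => ⟨zCoord_of_eq h, wCoord_of_eq h⟩
  · rintro ⟨h1, h2⟩
    have : zCoord P ≠ lam := by rw [h1]; exact_mod_cast hlam.ne
    rw [eq_finPoint this, h1, h2]
    rfl

end Curve

/-! ### Solutions over slit domains -/

section Sheets

variable {k : ℕ} {lam c : ℝ} {E : Type} {π : E → puncturedCurve k lam}
  {F : E → SL(2, ℂ)} {U : Set ℂ} {v : ℂ → ℂ} {Y : ℂ → SL(2, ℂ)} {ℓ : ℂ → E} {x : E} {a : ℂ}

/-- Near the point `y` of the cover, which lies on the sheet `w = d² v(z)`, the solution `F` is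
the solution `diag (d, d⁻¹) * Y * C` there. -/
def OnSheet (π : E → puncturedCurve k lam) (F : E → SL(2, ℂ)) (v : ℂ → ℂ) (Y : ℂ → SL(2, ℂ))
    (d : ℂˣ) (C : SL(2, ℂ)) (y : E) : Prop :=
  wCoord (π y) = d ^ 2 * v (zCoord (π y)) ∧ F y = diagSL d * Y (zCoord (π y)) * C

lemma OnSheet.unique {d d' : ℂˣ} {C C' : SL(2, ℂ)} {y : E} (h : OnSheet π F v Y d C y)
    (h' : OnSheet π F v Y d' C' y) (hv : v (zCoord (π y)) ≠ 0) :
    (d' = d ∧ C' = C) ∨ (d' = -d ∧ C' = -C) := by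
  have h1 : (d' : ℂ) ^ 2 = (d : ℂ) ^ 2 := mul_right_cancel₀ hv (h'.1.symm.trans h.1)
  have h2 := h'.2.symm.trans h.2
  rcases sq_eq_sq_iff_eq_or_eq_neg.1 h1 with h3 | h3
  · left
    have h3 : d' = d := Units.ext h3
    subst h3
    exact ⟨rfl, mul_left_cancel h2⟩
  · right
    have h3 : d' = -d := Units.ext (by simpa using h3)
    subst h3
    rw [diagSL_neg, neg_mul, neg_mul, ← mul_neg] at h2
    exact ⟨rfl, neg_eq_iff_eq_neg.1 (mul_left_cancel h2)⟩

lemma OnSheet.neg {d : ℂˣ} {C : SL(2, ℂ)} {y : E} (h : OnSheet π F v Y d C y) :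
    OnSheet π F v Y (-d) (-C) y := by
  refine ⟨by simpa using h.1, ?_⟩
  rw [diagSL_neg, neg_mul, neg_mul_neg]
  exact h.2

variable [TopologicalSpace E]

lemma IsBranch.ne_zero (h : IsBranch k lam U v) {z : ℂ} (hz : z ∈ U) : v z ≠ 0 := by
  intro h0
  obtain ⟨h1, h2, h3, h4⟩ := h.2 z hz
  rw [h0, zero_pow k.succ_ne_zero] at h4
  exact mul_ne_zero h1 (pow_ne_zero k (mobius_ne_zero h2 h3)) h4.symm

lemma IsBranch.rotate (h : IsBranch k lam U v) {d : ℂˣ} (hd : d ^ (2 * (k + 1)) = 1) :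
    IsBranch k lam U (fun z => d ^ 2 * v z) := by
  refine ⟨continuousOn_const.mul h.1, fun z hz => ?_⟩
  obtain ⟨h1, h2, h3, h4⟩ := h.2 z hz
  refine ⟨h1, h2, h3, ?_⟩
  have : (d : ℂ) ^ (2 * (k + 1)) = 1 := by
    rw [← Units.val_pow_eq_pow_val, hd, Units.val_one]
  rw [mul_pow, h4, ← pow_mul, this, one_mul]

/-- `ℓ` is a lift to the cover `π` of the sheet `w = v z` of the curve over `U`. -/
def IsSheetLift (π : E → puncturedCurve k lam) (U : Set ℂ) (v : ℂ → ℂ) (ℓ : ℂ → E) : Prop :=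
  ContinuousOn ℓ U ∧ ∀ z ∈ U, zCoord (π (ℓ z)) = z ∧ wCoord (π (ℓ z)) = v z

/-- The sheet over a star-shaped domain lifts to the cover, since the domain is simply
connected. -/
lemma exists_isSheetLift (hπ : IsCoveringMap π) (hv : IsBranch k lam U v) (hU : IsOpen U)
    (hs : StarConvex ℝ a U) (hx : zCoord (π x) ∈ U) (hw : wCoord (π x) = v (zCoord (π x))) :
    ∃ ℓ, IsSheetLift π U v ℓ ∧ ℓ (zCoord (π x)) = x := by
  have : ContractibleSpace U := hs.contractibleSpace ⟨_, hx⟩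
  have : SimplyConnectedSpace U := inferInstance
  have : LocallyPathConnectedSpace U := hU.locallyPathConnectedSpace
  have hp : ∀ z ∈ U, z ≠ 0 ∧ z ≠ (lam : ℂ) ∧ z ≠ (lam : ℂ)⁻¹ ∧
    v z ^ (k + 1) = z * mobius lam z ^ k := hv.2
  let f : C(U, puncturedCurve k lam) :=
    ⟨fun z => curvePoint z (v z) (hp z z.2).1 (hp z z.2).2.1 (hp z z.2).2.2.2, by
      rw [← continuousOn_univ]
      exact continuousOn_curve (continuous_subtype_val.continuousOn)
        (continuousOn_iff_continuous_domRestrict.1 hv.1).continuousOn fun x _ => rfl⟩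
  have hf : π x = f ⟨_, hx⟩ := curve_ext rfl hw
  obtain ⟨τ, ⟨h1, h2⟩, -⟩ := hπ.existsUnique_continuousMap_lifts f ⟨_, hx⟩ x hf
  classical
  refine ⟨fun z => if hz : z ∈ U then τ ⟨z, hz⟩ else x, ⟨?_, fun z hz => ?_⟩, ?_⟩
  · rw [continuousOn_iff_continuous_domRestrict]
    convert! τ.continuous using 1
    funext z
    simp
  · have : π (τ ⟨z, hz⟩) = f ⟨z, hz⟩ := congrFun h2 ⟨z, hz⟩
    simp only [hz, dif_pos, this]
    exact ⟨rfl, rfl⟩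
  · simp [hx, h1]

/-- The values of a sheet lift fill a neighbourhood of each of them. -/
lemma IsSheetLift.eventually_eq (hℓ : IsSheetLift π U v ℓ) (hπ : IsCoveringMap π)
    (hv : IsBranch k lam U v) (hU : IsOpen U) (ha : a ∈ U) :
    ∀ᶠ y in 𝓝 (ℓ a), zCoord (π y) ∈ U ∧ y = ℓ (zCoord (π y)) := by
  have hz : ContinuousAt (fun y => zCoord (π y)) (ℓ a) :=
    (continuous_zCoord.comp hπ.continuous).continuousAt
  obtain ⟨hza, hwa⟩ := hℓ.2 a ha
  have hlam : zCoord (π (ℓ a)) ≠ lam := by rw [hza]; exact (hv.2 a ha).2.1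
  have hw : ContinuousAt (fun y => wCoord (π y)) (ℓ a) :=
    (continuousAt_wCoord hlam).comp (f := π) hπ.continuous.continuousAt
  have hUe : ∀ᶠ y in 𝓝 (ℓ a), zCoord (π y) ∈ U :=
    hz.eventually_mem (hU.mem_nhds (by rwa [hza]))
  have hvc : ContinuousAt (fun y => v (zCoord (π y))) (ℓ a) := by
    refine ContinuousAt.comp (g := v) ?_ hz
    rw [hza]
    exact hv.1.continuousAt (hU.mem_nhds ha)
  have hva := hv.ne_zero ha
  have hq : Filter.Tendsto (fun y => wCoord (π y) / v (zCoord (π y))) (𝓝 (ℓ a)) (𝓝 1) := by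
    have := (hw.div hvc (by rwa [hza])).tendsto
    rw [Pi.div_apply, hza, hwa, div_self hva] at this
    exact this
  -- the quotient `w / v` is a `(k+1)`-th root of unity, and `1` is isolated among those
  have hroot : ∀ᶠ q in 𝓝 (1 : ℂ), q ^ (k + 1) = 1 → q = 1 := by
    have hfin : {q : ℂ | q ^ (k + 1) = 1}.Finite := by
      refine (Polynomial.nthRoots (k + 1) (1 : ℂ)).toFinset.finite_toSet.subset fun q hq => ?_
      simpa [Polynomial.mem_nthRoots] using hq
    have := (hfin.subset (Set.sdiff_subset (t := {1}))).isClosed.isOpen_compl.mem_nhds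
      (show (1 : ℂ) ∈ ({q : ℂ | q ^ (k + 1) = 1} \ {1})ᶜ by simp)
    filter_upwards [this] with q hq hq1
    by_contra h
    exact hq ⟨hq1, h⟩
  obtain ⟨e, he, he'⟩ := hπ.isLocalHomeomorph (ℓ a)
  have hV : ∀ᶠ y in 𝓝 (ℓ a), y ∈ e.source := e.open_source.mem_nhds he
  have hℓV : ∀ᶠ y in 𝓝 (ℓ a), ℓ (zCoord (π y)) ∈ e.source := by
    have : ContinuousAt (fun y => ℓ (zCoord (π y))) (ℓ a) := by
      refine ContinuousAt.comp (g := ℓ) ?_ hz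
      rw [hza]
      exact hℓ.1.continuousAt (hU.mem_nhds ha)
    exact this.eventually_mem (e.open_source.mem_nhds (by simpa [hza] using he))
  filter_upwards [hUe, hq.eventually hroot, hV, hℓV] with y h1 h2 h3 h4
  refine ⟨h1, e.injOn h3 h4 ?_⟩
  rw [← he']
  obtain ⟨h5, h6⟩ := hℓ.2 _ h1
  obtain ⟨-, h7, -, h8⟩ := hv.2 _ h1
  refine curve_ext h5.symm ?_
  rw [h6]
  have hvy := hv.ne_zero h1
  have := h2 (by
    rw [div_pow, (coe_wCoord h7).2, h8]
    exact div_self (by rw [← h8]; exact pow_ne_zero _ hvy))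
  exact (div_eq_one_iff_eq hvy).1 this

lemma IsSheetLift.solvesOn (hℓ : IsSheetLift π U v ℓ) (hv : IsBranch k lam U v) (hU : IsOpen U)
    (hF : IsSolution c π F) : SolvesOn k lam c U v (fun z => F (ℓ z)) := by
  intro z hz i j
  obtain ⟨h1, h2⟩ := hℓ.2 z hz
  obtain ⟨-, h3, h4, -⟩ := hv.2 z hz
  obtain ⟨Y, hY, hY'⟩ := hF.2 (ℓ z) (by rwa [h1]) (by rwa [h1])
  rw [h1, h2] at hY'
  refine (hY' i j).congr_of_eventuallyEq ?_
  have hc : ContinuousAt ℓ z := hℓ.1.continuousAt (hU.mem_nhds hz)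
  filter_upwards [hc.eventually hY, hU.mem_nhds hz] with ζ h5 h6
  rw [h5, (hℓ.2 ζ h6).1]

/-- Every point of the cover over a star-shaped domain lies on a lift of a rotated sheet. -/
lemma exists_isSheetLift_through (hπ : IsCoveringMap π) (hv : IsBranch k lam U v) (hU : IsOpen U)
    (hs : StarConvex ℝ a U) (hx : zCoord (π x) ∈ U) :
    ∃ (d : ℂˣ) (ℓ : ℂ → E), d ^ (2 * (k + 1)) = 1 ∧ IsSheetLift π U (fun z => d ^ 2 * v z) ℓ ∧
      ℓ (zCoord (π x)) = x := by
  obtain ⟨-, h2, -, h4⟩ := hv.2 _ hx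
  have hvx := hv.ne_zero hx
  obtain ⟨d, hd⟩ := IsAlgClosed.exists_pow_nat_eq (wCoord (π x) / v (zCoord (π x))) two_pos
  have hd1 : d ^ (2 * (k + 1)) = 1 := by
    rw [pow_mul, hd, div_pow, (coe_wCoord h2).2, h4]
    exact div_self (by rw [← h4]; exact pow_ne_zero _ hvx)
  have hd0 : d ≠ 0 := by
    rintro rfl
    simp at hd1
  have hu : (Units.mk0 d hd0) ^ (2 * (k + 1)) = 1 := Units.ext (by simpa using hd1)
  obtain ⟨ℓ, hℓ, hℓx⟩ := exists_isSheetLift hπ (hv.rotate hu) hU hs hx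
    (by rw [Units.val_mk0, hd]; field_simp)
  exact ⟨_, ℓ, hu, hℓ, hℓx⟩

/-- Every point of the cover over a star-shaped domain has a neighbourhood on one sheet, on which
`F` is one solution. -/
lemma exists_eventually_onSheet (hπ : IsCoveringMap π) (hF : IsSolution c π F)
    (hv : IsBranch k lam U v) (hU : IsOpen U) (hs : StarConvex ℝ a U)
    (hY : SolvesOn k lam c U v Y) (hx : zCoord (π x) ∈ U) :
    ∃ (d : ℂˣ) (C : SL(2, ℂ)), ∀ᶠ y in 𝓝 x, OnSheet π F v Y d C y := by
  obtain ⟨u, ℓ, hu, hℓ, hℓx⟩ := exists_isSheetLift_through hπ hv hU hs hx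
  have hv' := hv.rotate hu
  obtain ⟨C, hC⟩ := (hY.diag_mul u fun z hz => hv.ne_zero hz).exists_eq_mul
    (hℓ.solvesOn hv' hU hF) hU
    (hs.isPathConnected
      (by simpa using hs hx zero_le_one le_rfl (by simp))).isConnected.isPreconnected
  refine ⟨u, C, ?_⟩
  have := hℓ.eventually_eq hπ hv' hU hx
  rw [hℓx] at this
  filter_upwards [this] with y ⟨hy1, hy2⟩
  refine ⟨?_, ?_⟩
  · have := (hℓ.2 _ hy1).2
    rwa [← hy2] at this
  · rw [← hC _ hy1, ← hy2]

/-- A predicate that is locally constant near the points of a preconnected set is constant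
on it. -/
lemma _root_.IsPreconnected.of_eventually_or {X : Type*} [TopologicalSpace X] {s : Set X}
    (hs : IsPreconnected s) {p : X → Prop}
    (h : ∀ x ∈ s, (∀ᶠ y in 𝓝 x, p y) ∨ ∀ᶠ y in 𝓝 x, ¬p y) {x y : X} (hx : x ∈ s) (hy : y ∈ s)
    (hp : p x) : p y := by
  by_contra hn
  obtain ⟨z, -, hz1, hz2⟩ := hs {x | ∀ᶠ y in 𝓝 x, p y} {x | ∀ᶠ y in 𝓝 x, ¬p y}
    isOpen_setOfPred_eventually_nhds isOpen_setOfPred_eventually_nhds (fun x hx => h x hx)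
    ⟨x, hx, (h x hx).resolve_right fun h' => h'.self_of_nhds hp⟩
    ⟨y, hy, (h y hy).resolve_left fun h' => hn h'.self_of_nhds⟩
  exact hz2.self_of_nhds hz1.self_of_nhds

/-- Analytic continuation along a connected set over one star-shaped domain. -/
lemma OnSheet.of_isPreconnected (hπ : IsCoveringMap π) (hF : IsSolution c π F)
    (hv : IsBranch k lam U v) (hU : IsOpen U) (hs : StarConvex ℝ a U)
    (hY : SolvesOn k lam c U v Y) {A : Set E} (hA : IsPreconnected A)
    (hAU : ∀ y ∈ A, zCoord (π y) ∈ U) {d : ℂˣ} {C : SL(2, ℂ)} {x y : E} (hx : x ∈ A) (hy : y ∈ A)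
    (h : OnSheet π F v Y d C x) : OnSheet π F v Y d C y := by
  refine hA.of_eventually_or (fun x hx => ?_) hx hy h
  obtain ⟨d', C', h'⟩ := exists_eventually_onSheet hπ hF hv hU hs hY (hAU x hx)
  by_cases hd : OnSheet π F v Y d C x
  · left
    filter_upwards [h'] with z hz
    rcases hd.unique h'.self_of_nhds (hv.ne_zero (hAU x hx)) with ⟨rfl, rfl⟩ | ⟨rfl, rfl⟩
    · exact hz
    · simpa using hz.neg
  · right
    have hz : ContinuousAt (fun y => zCoord (π y)) x :=
      (continuous_zCoord.comp hπ.continuous).continuousAt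
    filter_upwards [h', hz.eventually_mem (hU.mem_nhds (hAU x hx))] with z hz hzU hz'
    rcases hz.unique hz' (hv.ne_zero hzU) with ⟨rfl, rfl⟩ | ⟨rfl, rfl⟩
    · exact hd h'.self_of_nhds
    · exact hd h'.self_of_nhds.neg

end Sheets

/-! ### Connection matrices across the real axis -/

section Data

variable {k : ℕ} {lam c : ℝ}

/-- `Y` is the solution on the plane cut along `(-∞, 1/lam]` and `[lam, ∞)` with `Y 1 = 1`; the
solutions `Y₁`, `Y₂`, `Y₃` continue it from the lower half plane across `(0, 1/lam)`, `(-∞, 0)`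
and `(lam, ∞)`; and `B`, `P`, `Q` are the connection matrices that express these continuations
in the upper half plane by `Y`. -/
structure IsConnectionData (k : ℕ) (lam c : ℝ) (Y Y₁ Y₂ Y₃ : ℂ → SL(2, ℂ))
    (B P Q : SL(2, ℂ)) : Prop where
  mid : SolvesOn k lam c (slitDomain (Set.Ioo lam⁻¹ lam)) (branchMid k lam) Y
  left : SolvesOn k lam c (slitDomain (Set.Ioo 0 lam⁻¹)) (branchSide k lam) Y₁
  neg : SolvesOn k lam c (slitDomain (Set.Iio 0)) (branchNeg k lam) Y₂
  right : SolvesOn k lam c (slitDomain (Set.Ioi lam)) (branchSide k lam) Y₃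
  one : Y 1 = 1
  left_lower : ∀ z : ℂ, z.im < 0 → Y₁ z = Y z
  neg_lower : ∀ z : ℂ, z.im < 0 → Y₂ z = Y z
  right_lower : ∀ z : ℂ, z.im < 0 → Y₃ z = Y z
  left_upper : ∀ z : ℂ, 0 < z.im → Y₁ z = diagSL (rootEps k) * Y z * B
  neg_upper : ∀ z : ℂ, 0 < z.im → Y₂ z = Y z * P
  right_upper : ∀ z : ℂ, 0 < z.im → Y₃ z = diagSL (rootEps k) * Y z * Q

lemma isPreconnected_im_pos : IsPreconnected {z : ℂ | 0 < z.im} :=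
  (convex_halfSpace_im_gt 0).isPreconnected

lemma isPreconnected_im_neg : IsPreconnected {z : ℂ | z.im < 0} :=
  (convex_halfSpace_im_lt 0).isPreconnected

lemma isOpen_im_pos : IsOpen {z : ℂ | 0 < z.im} :=
  isOpen_lt continuous_const Complex.continuous_im

lemma isOpen_im_neg : IsOpen {z : ℂ | z.im < 0} :=
  isOpen_lt Complex.continuous_im continuous_const

lemma mem_slitDomain_of_im_neg {S : Set ℝ} {z : ℂ} (hz : z.im < 0) : z ∈ slitDomain S :=
  Or.inl hz.ne

lemma mem_slitDomain_of_im_pos {S : Set ℝ} {z : ℂ} (hz : 0 < z.im) : z ∈ slitDomain S :=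
  Or.inl hz.ne'

lemma one_mem_Ioo (hlam : 1 < lam) : (1 : ℝ) ∈ Set.Ioo lam⁻¹ lam :=
  ⟨inv_lt_one_of_one_lt₀ hlam, hlam⟩

lemma one_mem_slitDomain (hlam : 1 < lam) : (1 : ℂ) ∈ slitDomain (Set.Ioo lam⁻¹ lam) := by
  simpa using ofReal_mem_slitDomain (one_mem_Ioo hlam)

lemma starConvex_mid (hlam : 1 < lam) :
    StarConvex ℝ ((1 : ℝ) : ℂ) (slitDomain (Set.Ioo lam⁻¹ lam)) :=
  starConvex_slitDomain (convex_Ioo _ _) (one_mem_Ioo hlam)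

lemma half_mem_Ioo (hlam : 1 < lam) : lam⁻¹ / 2 ∈ Set.Ioo 0 lam⁻¹ := by
  have : 0 < lam⁻¹ := by positivity
  exact ⟨by linarith, by linarith⟩

lemma starConvex_left (hlam : 1 < lam) :
    StarConvex ℝ ((lam⁻¹ / 2 : ℝ) : ℂ) (slitDomain (Set.Ioo 0 lam⁻¹)) :=
  starConvex_slitDomain (convex_Ioo _ _) (half_mem_Ioo hlam)

lemma starConvex_neg : StarConvex ℝ ((-1 : ℝ) : ℂ) (slitDomain (Set.Iio 0)) :=
  starConvex_slitDomain (convex_Iio _) (by simp)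

lemma starConvex_right : StarConvex ℝ ((lam + 1 : ℝ) : ℂ) (slitDomain (Set.Ioi lam)) :=
  starConvex_slitDomain (convex_Ioi _) (by simp)

/-- On the upper half plane, solutions on rotated sheets differ by a connection matrix. -/
lemma exists_connection {S T : Set ℝ} {v v' : ℂ → ℂ} {Y Y' : ℂ → SL(2, ℂ)} {d : ℂˣ}
    (hY : SolvesOn k lam c (slitDomain S) v Y) (hY' : SolvesOn k lam c (slitDomain T) v' Y')
    (hv : IsBranch k lam (slitDomain S) v) (h : ∀ z : ℂ, 0 < z.im → v' z = d ^ 2 * v z) :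
    ∃ C, ∀ z : ℂ, 0 < z.im → Y' z = diagSL d * Y z * C :=
  (((hY.diag_mul d fun _ hz => hv.ne_zero hz).mono
    fun _ hz => mem_slitDomain_of_im_pos hz).exists_eq_mul
    ((hY'.mono fun _ hz => mem_slitDomain_of_im_pos hz).congr_branch h)
    isOpen_im_pos isPreconnected_im_pos)

section Existence

variable {E : Type} [TopologicalSpace E] {π : E → puncturedCurve k lam} {F : E → SL(2, ℂ)} {e₀ : E}

/-- Continuation of a solution from the lower half plane to another slit domain. -/
lemma exists_continuation {S T : Set ℝ} {v v' : ℂ → ℂ} {a : ℂ} {ℓ : ℂ → E}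
    (hπ : IsCoveringMap π) (hF : IsSolution c π F)
    (hℓ : IsSheetLift π (slitDomain S) v ℓ) (hv : IsBranch k lam (slitDomain S) v)
    (hS : IsOpen S) (hv' : IsBranch k lam (slitDomain T) v') (hT : IsOpen T)
    (hs : StarConvex ℝ a (slitDomain T)) (h : ∀ z : ℂ, z.im < 0 → v' z = v z) :
    ∃ Y', SolvesOn k lam c (slitDomain T) v' Y' ∧ ∀ z : ℂ, z.im < 0 → Y' z = F (ℓ z) := by
  have hi : (-Complex.I).im < 0 := by simp
  obtain ⟨h1, h2⟩ := hℓ.2 (-Complex.I) (mem_slitDomain_of_im_neg hi)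
  obtain ⟨ℓ', hℓ', h3⟩ := exists_isSheetLift (x := ℓ (-Complex.I)) hπ hv'
    (isOpen_slitDomain hT) hs (by rw [h1]; exact mem_slitDomain_of_im_neg hi)
    (by rw [h2, h1, h _ hi])
  have hY := (hℓ.solvesOn hv (isOpen_slitDomain hS) hF).mono
    fun z (hz : z.im < 0) => mem_slitDomain_of_im_neg hz
  have hY' := hℓ'.solvesOn hv' (isOpen_slitDomain hT) hF
  obtain ⟨C, hC⟩ := hY.exists_eq_mul
    ((hY'.mono fun z (hz : z.im < 0) => mem_slitDomain_of_im_neg hz).congr_branch h)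
    isOpen_im_neg isPreconnected_im_neg
  have hC1 : C = 1 := by
    have := hC _ hi
    rw [h1] at h3
    rw [h3] at this
    exact (mul_eq_left.1 this.symm)
  exact ⟨_, hY', fun z hz => by simpa [hC1] using hC z hz⟩

/-- A solution on some covering provides connection data. -/
lemma exists_isConnectionData (hlam : 1 < lam) (hπ : IsCoveringMap π)
    (he₀ : (π e₀).1 = basePair k lam) (hF : IsSolution c π F) (hF₀ : F e₀ = 1) :
    ∃ Y Y₁ Y₂ Y₃ B P Q, IsConnectionData k lam c Y Y₁ Y₂ Y₃ B P Q := by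
  obtain ⟨hz, hw⟩ := (eq_basePair hlam).1 he₀
  have hmid := isBranch_branchMid (k := k) hlam
  obtain ⟨ℓ, hℓ, hℓ₀⟩ := exists_isSheetLift (x := e₀) hπ hmid (isOpen_slitDomain isOpen_Ioo)
    (starConvex_mid hlam) (by rw [hz]; exact one_mem_slitDomain hlam)
    (by rw [hz, hw, branchMid_one hlam])
  have hY := hℓ.solvesOn hmid (isOpen_slitDomain isOpen_Ioo) hF
  obtain ⟨Y₁, h₁, h₁'⟩ := exists_continuation hπ hF hℓ hmid isOpen_Ioo
    (isBranch_branchSide_left hlam) isOpen_Ioo (starConvex_left hlam)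
    fun z hz => branchSide_of_im_neg hlam hz
  obtain ⟨Y₂, h₂, h₂'⟩ := exists_continuation hπ hF hℓ hmid isOpen_Ioo
    (isBranch_branchNeg hlam) isOpen_Iio starConvex_neg
    fun z hz => branchNeg_of_im_neg hlam hz
  obtain ⟨Y₃, h₃, h₃'⟩ := exists_continuation hπ hF hℓ hmid isOpen_Ioo
    (isBranch_branchSide_right hlam) isOpen_Ioi starConvex_right
    fun z hz => branchSide_of_im_neg hlam hz
  obtain ⟨B, hB⟩ := exists_connection hY h₁ hmid fun z hz => branchSide_of_im_pos hlam hz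
  obtain ⟨P, hP⟩ := exists_connection (d := 1) hY h₂ hmid
    fun z hz => by simpa using branchNeg_of_im_pos hlam hz
  obtain ⟨Q, hQ⟩ := exists_connection hY h₃ hmid fun z hz => branchSide_of_im_pos hlam hz
  refine ⟨_, Y₁, Y₂, Y₃, B, P, Q, hY, h₁, h₂, h₃, ?_, h₁', h₂', h₃', hB, ?_, hQ⟩
  · rw [hz] at hℓ₀
    rw [hℓ₀, hF₀]
  · simpa [diagSL_one] using hP

end Existence

namespace IsConnectionData

variable {Y Y₁ Y₂ Y₃ : ℂ → SL(2, ℂ)} {B P Q : SL(2, ℂ)}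

/-- By uniqueness, since conjugation preserves the branch and the initial value at `1`. -/
lemma conj_mid (h : IsConnectionData k lam c Y Y₁ Y₂ Y₃ B P Q) (hlam : 1 < lam) {z : ℂ}
    (hz : z ∈ slitDomain (Set.Ioo lam⁻¹ lam)) : conjSL (Y (starRingEnd ℂ z)) = Y z := by
  have hc := h.mid.conj
  rw [conj_preimage_slitDomain] at hc
  obtain ⟨C, hC⟩ := h.mid.exists_eq_mul (hc.congr_branch fun z hz => conj_branchMid hlam hz)
    (isOpen_slitDomain isOpen_Ioo) (isPreconnected_slitDomain (convex_Ioo _ _) (one_mem_Ioo hlam))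
  have h1 := hC 1 (one_mem_slitDomain hlam)
  rw [map_one, h.one, map_one, one_mul] at h1
  rw [hC z hz, ← h1, mul_one]

/-- By uniqueness, since `z ↦ 1/z` preserves the branch and the initial value at `1`. -/
lemma flip_mid (h : IsConnectionData k lam c Y Y₁ Y₂ Y₃ B P Q) (hlam : 1 < lam) {z : ℂ}
    (hz : z ∈ slitDomain (Set.Ioo lam⁻¹ lam)) : flipSL * Y z⁻¹ * flipSL⁻¹ = Y z := by
  have hmid := isBranch_branchMid (k := k) hlam
  have hl : 0 < lam⁻¹ := by positivity
  have hc := (h.mid.inversion hlam (fun z hz => (hmid.2 z hz).1) fun z hz => hmid.ne_zero hz).mono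
    (V := slitDomain (Set.Ioo lam⁻¹ lam)) fun z hz => inv_mem_slitDomain
      (fun x hx => ⟨inv_strictAnti₀ (hl.trans hx.1) hx.2, by
        simpa using inv_strictAnti₀ hl hx.1⟩) hz
  obtain ⟨C, hC⟩ := h.mid.exists_eq_mul (hc.congr_branch fun z hz => inversion_branchMid hlam hz)
    (isOpen_slitDomain isOpen_Ioo) (isPreconnected_slitDomain (convex_Ioo _ _) (one_mem_Ioo hlam))
  have h1 := hC 1 (one_mem_slitDomain hlam)
  rw [inv_one, h.one, mul_one, mul_inv_cancel, one_mul] at h1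
  rw [hC z hz, ← h1, mul_one]

/-- The reflection `z ↦ conj z` fixes `(0, 1/lam)`, so continuing across it twice gives the
identity. -/
lemma mul_conj_left (h : IsConnectionData k lam c Y Y₁ Y₂ Y₃ B P Q) (hlam : 1 < lam) :
    B * conjSL B = 1 := by
  have hb := isBranch_branchSide_left (k := k) hlam
  have hc := h.left.conj
  rw [conj_preimage_slitDomain] at hc
  have hc := ((hc.congr_branch fun z hz => conj_branchSide hlam hz).diag_mul (rootEps k)
    fun z hz => mul_ne_zero (by simp) (hb.ne_zero hz)).congr_branch
    (v' := branchSide k lam) fun z hz => by simp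
  obtain ⟨C, hC⟩ := h.left.exists_eq_mul hc (isOpen_slitDomain isOpen_Ioo)
    (isPreconnected_slitDomain (convex_Ioo _ _) (half_mem_Ioo hlam))
  have hi : (0 : ℝ) < Complex.I.im := by simp
  have hi' : (-Complex.I).im < 0 := by simp
  have h1 := hC _ (mem_slitDomain_of_im_neg hi')
  rw [map_neg, Complex.conj_I, neg_neg, h.left_upper _ hi, h.left_lower _ hi', map_mul, map_mul,
    conjSL_diagSL_rootEps, mul_assoc, ← mul_assoc, ← diagSL_mul, mul_inv_cancel, diagSL_one,
    one_mul] at h1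
  have h2 := h.conj_mid hlam (z := -Complex.I) (mem_slitDomain_of_im_neg hi')
  rw [map_neg, Complex.conj_I, neg_neg] at h2
  rw [h2] at h1
  have h3 := hC _ (mem_slitDomain_of_im_pos hi)
  have h4 := h.conj_mid hlam (z := Complex.I) (mem_slitDomain_of_im_pos hi)
  rw [Complex.conj_I] at h3 h4
  rw [h.left_lower _ hi', h4, h.left_upper _ hi, ← mul_left_cancel h1, mul_assoc] at h3
  exact mul_eq_left.1 h3.symm

/-- The same for the reflection that fixes `(-∞, 0)`. -/
lemma mul_conj_neg (h : IsConnectionData k lam c Y Y₁ Y₂ Y₃ B P Q) (hlam : 1 < lam) :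
    P * conjSL P = 1 := by
  have hc := h.neg.conj
  rw [conj_preimage_slitDomain] at hc
  have hc := hc.congr_branch fun z hz => conj_branchNeg hlam hz
  obtain ⟨C, hC⟩ := h.neg.exists_eq_mul hc (isOpen_slitDomain isOpen_Iio)
    (isPreconnected_slitDomain (convex_Iio _) (a := -1) (by simp))
  have hi : (0 : ℝ) < Complex.I.im := by simp
  have hi' : (-Complex.I).im < 0 := by simp
  have h1 := hC _ (mem_slitDomain_of_im_neg hi')
  rw [map_neg, Complex.conj_I, neg_neg, h.neg_upper _ hi, h.neg_lower _ hi', map_mul] at h1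
  have h2 := h.conj_mid hlam (z := -Complex.I) (mem_slitDomain_of_im_neg hi')
  rw [map_neg, Complex.conj_I, neg_neg] at h2
  rw [h2] at h1
  have h3 := hC _ (mem_slitDomain_of_im_pos hi)
  have h4 := h.conj_mid hlam (z := Complex.I) (mem_slitDomain_of_im_pos hi)
  rw [Complex.conj_I] at h3 h4
  rw [h.neg_lower _ hi', h4, h.neg_upper _ hi, ← mul_left_cancel h1, mul_assoc] at h3
  exact mul_eq_left.1 h3.symm

/-- The symmetry `z ↦ 1/z` maps the crossing of `(lam, ∞)` to that of `(0, 1/lam)` in the opposite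
direction. -/
lemma right_mul_flip (h : IsConnectionData k lam c Y Y₁ Y₂ Y₃ B P Q) (hlam : 1 < lam) :
    Q * (flipSL * B * flipSL⁻¹) = 1 := by
  have hb := isBranch_branchSide_left (k := k) hlam
  have hb' := isBranch_branchSide_right (k := k) hlam
  have hc := (h.left.inversion hlam (fun z hz => (hb.2 z hz).1) fun z hz => hb.ne_zero hz).mono
    (V := slitDomain (Set.Ioi lam)) fun z hz => inv_mem_slitDomain
      (fun x (hx : lam < x) => ⟨inv_pos.2 (by linarith), inv_strictAnti₀ (by linarith) hx⟩) hz
  have hc := ((hc.congr_branch fun z hz => inversion_branchSide hlam hz).diag_mul (rootEps k)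
    fun z hz => mul_ne_zero (by simp) (hb'.ne_zero hz)).congr_branch
    (v' := branchSide k lam) fun z hz => by simp
  obtain ⟨C, hC⟩ := h.right.exists_eq_mul hc (isOpen_slitDomain isOpen_Ioi)
    (isPreconnected_slitDomain (convex_Ioi _) (a := lam + 1) (by simp))
  have hi : (0 : ℝ) < Complex.I.im := by simp
  have hi' : (-Complex.I).im < 0 := by simp
  have hinv : (-Complex.I)⁻¹ = Complex.I := by rw [inv_neg, Complex.inv_I, neg_neg]
  have h1 := hC _ (mem_slitDomain_of_im_neg hi')
  have h2 := h.flip_mid hlam (z := -Complex.I) (mem_slitDomain_of_im_neg hi')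
  rw [hinv] at h1 h2
  rw [h.right_lower _ hi', h.left_upper _ hi] at h1
  have h5 : diagSL (rootEps k) * (flipSL * (diagSL (rootEps k) * Y Complex.I * B) * flipSL⁻¹) =
      (flipSL * Y Complex.I * flipSL⁻¹) * (flipSL * B * flipSL⁻¹) := by
    have := flipSL_mul_diagSL (rootEps k)
    rw [mul_assoc (diagSL _), ← mul_assoc flipSL, this, diagSL_inv]
    group
  rw [h5, h2] at h1
  have h3 := hC _ (mem_slitDomain_of_im_pos hi)
  have h4 := h.flip_mid hlam (z := Complex.I) (mem_slitDomain_of_im_pos hi)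
  rw [Complex.inv_I] at h3 h4
  rw [h.left_lower _ hi', h4, h.right_upper _ hi, ← mul_left_cancel h1, mul_assoc] at h3
  exact mul_eq_left.1 h3.symm

end IsConnectionData

end Data

/-! ### Monodromies along the two loops -/

section Loops

variable {k : ℕ} {lam c : ℝ} {E : Type} {π : E → puncturedCurve k lam} {F : E → SL(2, ℂ)}
  {v v' : ℂ → ℂ} {Y Y' : ℂ → SL(2, ℂ)}

/-- Passage between two sheets over a half plane changes the constants by the connection
matrix. -/
lemma OnSheet.congr_iff {y : E} {d e : ℂˣ} {B C : SL(2, ℂ)}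
    (hv : v' (zCoord (π y)) = e ^ 2 * v (zCoord (π y)))
    (hY : Y' (zCoord (π y)) = diagSL e * Y (zCoord (π y)) * B) :
    OnSheet π F v' Y' d C y ↔ OnSheet π F v Y (d * e) (B * C) y := by
  simp only [OnSheet, hv, hY, diagSL_mul, Units.val_mul, mul_pow, mul_assoc]

lemma OnSheet.congr_iff_of_eq {y : E} {d : ℂˣ} {B C : SL(2, ℂ)}
    (hv : v' (zCoord (π y)) = v (zCoord (π y)))
    (hY : Y' (zCoord (π y)) = Y (zCoord (π y)) * B) :
    OnSheet π F v' Y' d C y ↔ OnSheet π F v Y d (B * C) y := by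
  simp only [OnSheet, hv, hY, mul_assoc]

lemma OnSheet.congr_iff_of_eq' {y : E} {d : ℂˣ} {C : SL(2, ℂ)}
    (hv : v' (zCoord (π y)) = v (zCoord (π y))) (hY : Y' (zCoord (π y)) = Y (zCoord (π y))) :
    OnSheet π F v' Y' d C y ↔ OnSheet π F v Y d C y := by
  simp only [OnSheet, hv, hY]

variable {Y₁ Y₂ Y₃ : ℂ → SL(2, ℂ)} {B P Q : SL(2, ℂ)}

lemma onSheet_base (h : IsConnectionData k lam c Y Y₁ Y₂ Y₃ B P Q) (hlam : 1 < lam) {x : E}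
    (hx : (π x).1 = basePair k lam) : OnSheet π F (branchMid k lam) Y 1 (F x) x := by
  obtain ⟨hz, hw⟩ := (eq_basePair hlam).1 hx
  refine ⟨?_, ?_⟩
  · simp [hz, hw, branchMid_one hlam]
  · simp [hz, h.one, diagSL_one]

lemma OnSheet.eq_of_base (h : IsConnectionData k lam c Y Y₁ Y₂ Y₃ B P Q) (hlam : 1 < lam) {x : E}
    (hx : (π x).1 = basePair k lam) {C : SL(2, ℂ)}
    (hC : OnSheet π F (branchMid k lam) Y 1 C x) : F x = C := by
  obtain ⟨hz, hw⟩ := (eq_basePair hlam).1 hx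
  simpa [hz, h.one, diagSL_one] using hC.2

variable [TopologicalSpace E]

/-- Analytic continuation along a path over one slit domain. -/
lemma OnSheet.of_path {U : Set ℂ} {a : ℂ} (hπ : IsCoveringMap π) (hF : IsSolution c π F)
    (hv : IsBranch k lam U v) (hU : IsOpen U) (hs : StarConvex ℝ a U)
    (hY : SolvesOn k lam c U v Y) {d : ℂˣ} {C : SL(2, ℂ)} {Γ : C(I, E)} {s t : I} (hst : s ≤ t)
    (hΓ : ∀ r, s ≤ r → r ≤ t → zCoord (π (Γ r)) ∈ U) (h : OnSheet π F v Y d C (Γ s)) :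
    OnSheet π F v Y d C (Γ t) := by
  refine OnSheet.of_isPreconnected hπ hF hv hU hs hY
    (A := Γ '' Set.Icc s t) (isPreconnected_Icc.image _ Γ.continuous.continuousOn) ?_
    ⟨s, ⟨le_rfl, hst⟩, rfl⟩ ⟨t, ⟨hst, le_rfl⟩, rfl⟩ h
  rintro _ ⟨r, hr, rfl⟩
  exact hΓ r hr.1 hr.2

/-- The loop crosses `(0, 1/lam)` upwards, which contributes `B`, stays over the slit domain
around `1`, and crosses `(lam, ∞)` downwards, which contributes `Q⁻¹`. -/
lemma monodromy_of_isLoop₁ (h : IsConnectionData k lam c Y Y₁ Y₂ Y₃ B P Q) (hlam : 1 < lam)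
    (hπ : IsCoveringMap π) (hF : IsSolution c π F) {Γ : C(I, E)} (hΓ : IsLoop₁ (π ∘ Γ)) :
    monodromy F Γ = (F (Γ 0))⁻¹ * (Q⁻¹ * B) * F (Γ 0) := by
  obtain ⟨-, t₁, t₂, t₃, x, w, h01, h12, h23, h34, hx0, hx1, b0, l1, b1, l2, b2, l3, b3, l4, b4⟩ :=
    hΓ
  simp only [Function.comp_apply] at *
  have hmid := isBranch_branchMid (k := k) hlam
  have hmidO := isOpen_slitDomain (isOpen_Ioo (a := lam⁻¹) (b := lam))
  have z0 := zCoord_of_eq b0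
  have z1 := zCoord_of_eq b1
  have z2 := zCoord_of_eq b2
  have z3 := zCoord_of_eq b3
  have z4 := zCoord_of_eq b4
  have m1 := one_mem_slitDomain hlam
  -- the chosen parameters lie over the half planes, where two slit domains overlap
  obtain ⟨s₁, hs1, hs1'⟩ := exists_between h01
  obtain ⟨s₂, hs2, hs2'⟩ := exists_between h12
  obtain ⟨s₃, hs3, hs3'⟩ := exists_between h23
  obtain ⟨s₄, hs4, hs4'⟩ := exists_between h34
  have e1 := (onSheet_base (F := F) h hlam b0).of_path (t := s₁) hπ hF hmid hmidO
    (starConvex_mid hlam) h.mid hs1.le fun r hr hr' => by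
      rcases hr.eq_or_lt with rfl | hr
      · rwa [z0]
      · exact mem_slitDomain_of_im_neg (l1 r hr (hr'.trans_lt hs1'))
  have e2 := ((OnSheet.congr_iff_of_eq' (branchSide_of_im_neg hlam (l1 _ hs1 hs1'))
    (h.left_lower _ (l1 _ hs1 hs1'))).2 e1).of_path (t := s₂) hπ hF
    (isBranch_branchSide_left hlam) (isOpen_slitDomain isOpen_Ioo) (starConvex_left hlam) h.left
    (hs1'.trans hs2).le fun r hr hr' => by
      rcases lt_trichotomy r t₁ with hr1 | rfl | hr1
      · exact mem_slitDomain_of_im_neg (l1 r (hs1.trans_le hr) hr1)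
      · rw [z1]; exact ofReal_mem_slitDomain ⟨hx0, hx1⟩
      · exact mem_slitDomain_of_im_pos (l2 r hr1 (hr'.trans_lt hs2'))
  have e3 := ((OnSheet.congr_iff (branchSide_of_im_pos hlam (l2 _ hs2 hs2'))
    (h.left_upper _ (l2 _ hs2 hs2'))).1 e2).of_path (t := s₃) hπ hF hmid hmidO
    (starConvex_mid hlam) h.mid (hs2'.trans hs3).le fun r hr hr' => by
      rcases lt_trichotomy r t₂ with hr1 | rfl | hr1
      · exact mem_slitDomain_of_im_pos (l2 r (hs2.trans_le hr) hr1)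
      · rwa [z2]
      · exact mem_slitDomain_of_im_pos (l3 r hr1 (hr'.trans_lt hs3'))
  have e4 := ((OnSheet.congr_iff (C := Q⁻¹ * (B * F (Γ 0)))
    (branchSide_of_im_pos hlam (l3 _ hs3 hs3'))
    (h.right_upper _ (l3 _ hs3 hs3'))).2 (by rwa [mul_inv_cancel_left])).of_path (t := s₄) hπ hF
    (isBranch_branchSide_right hlam) (isOpen_slitDomain isOpen_Ioi) starConvex_right h.right
    (hs3'.trans hs4).le fun r hr hr' => by
      rcases lt_trichotomy r t₃ with hr1 | rfl | hr1
      · exact mem_slitDomain_of_im_pos (l3 r (hs3.trans_le hr) hr1)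
      · rw [z3, one_div, ← Complex.ofReal_inv]
        refine ofReal_mem_slitDomain ?_
        simpa using inv_strictAnti₀ hx0 hx1
      · exact mem_slitDomain_of_im_neg (l4 r hr1 (hr'.trans_lt hs4'))
  have e5 := ((OnSheet.congr_iff_of_eq' (branchSide_of_im_neg hlam (l4 _ hs4 hs4'))
    (h.right_lower _ (l4 _ hs4 hs4'))).1 e4).of_path (t := 1) hπ hF hmid hmidO
    (starConvex_mid hlam) h.mid hs4'.le fun r hr hr' => by
      rcases hr'.eq_or_lt with rfl | hr'
      · rwa [z4]
      · exact mem_slitDomain_of_im_neg (l4 r (hs4.trans_le hr) hr')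
  rw [monodromy, e5.eq_of_base h hlam b4]
  group

/-- The loop crosses `(-∞, 0)` upwards once, which contributes `P`. -/
lemma monodromy_of_isLoop₂ (h : IsConnectionData k lam c Y Y₁ Y₂ Y₃ B P Q) (hlam : 1 < lam)
    (hπ : IsCoveringMap π) (hF : IsSolution c π F) {Γ : C(I, E)} (hΓ : IsLoop₂ (π ∘ Γ)) :
    monodromy F Γ = (F (Γ 0))⁻¹ * P * F (Γ 0) := by
  obtain ⟨-, t₁, x, h01, h12, hx0, b0, l1, z1, l2, b2⟩ := hΓ
  simp only [Function.comp_apply] at *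
  have hmid := isBranch_branchMid (k := k) hlam
  have hmidO := isOpen_slitDomain (isOpen_Ioo (a := lam⁻¹) (b := lam))
  have z0 := zCoord_of_eq b0
  have z2 := zCoord_of_eq b2
  have m1 := one_mem_slitDomain hlam
  obtain ⟨s₁, hs1, hs1'⟩ := exists_between h01
  obtain ⟨s₂, hs2, hs2'⟩ := exists_between h12
  have e1 := (onSheet_base (F := F) h hlam b0).of_path (t := s₁) hπ hF hmid hmidO
    (starConvex_mid hlam) h.mid hs1.le fun r hr hr' => by
      rcases hr.eq_or_lt with rfl | hr
      · rwa [z0]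
      · exact mem_slitDomain_of_im_neg (l1 r hr (hr'.trans_lt hs1'))
  have e2 := ((OnSheet.congr_iff_of_eq' (branchNeg_of_im_neg hlam (l1 _ hs1 hs1'))
    (h.neg_lower _ (l1 _ hs1 hs1'))).2 e1).of_path (t := s₂) hπ hF
    (isBranch_branchNeg hlam) (isOpen_slitDomain isOpen_Iio) starConvex_neg h.neg
    (hs1'.trans hs2).le fun r hr hr' => by
      rcases lt_trichotomy r t₁ with hr1 | rfl | hr1
      · exact mem_slitDomain_of_im_neg (l1 r (hs1.trans_le hr) hr1)
      · rw [z1]; exact ofReal_mem_slitDomain hx0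
      · exact mem_slitDomain_of_im_pos (l2 r hr1 (hr'.trans_lt hs2'))
  have e3 := ((OnSheet.congr_iff_of_eq (branchNeg_of_im_pos hlam (l2 _ hs2 hs2'))
    (h.neg_upper _ (l2 _ hs2 hs2'))).1 e2).of_path (t := 1) hπ hF hmid hmidO
    (starConvex_mid hlam) h.mid hs2'.le fun r hr hr' => by
      rcases hr'.eq_or_lt with rfl | hr'
      · rwa [z2]
      · exact mem_slitDomain_of_im_pos (l2 r (hs2.trans_le hr) hr')
  rw [monodromy, e3.eq_of_base h hlam b2]
  group

end Loops

/-! ### Punctured neighbourhoods of the branch points -/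

section BranchPoints

variable {k : ℕ} {lam : ℝ}

/-- If near `z₀` the curve is parametrized by `z = z₀ + η exp ((k+1) s)`, `w = u(s) g(z)` on left
half planes, then its punctured neighbourhoods `0 < |z - z₀| < r` are connected. The last
hypothesis says that shifts of `s` reach all `k + 1` values of `w` over a given `z`. -/
lemma isPreconnected_punctured_of_param {z₀ η : ℂ} (hη : ‖η‖ = 1) {u g : ℂ → ℂ} {r : ℝ}
    (hr : 0 < r) (hg : ContinuousOn g (Metric.ball z₀ r)) (hu : Continuous u)
    (hrel : ∀ s : ℂ, z₀ + η * Complex.exp ((k + 1) * s) ∈ Metric.ball z₀ r →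
      z₀ + η * Complex.exp ((k + 1) * s) ≠ 0 ∧ z₀ + η * Complex.exp ((k + 1) * s) ≠ lam ∧
      u s * g (z₀ + η * Complex.exp ((k + 1) * s)) ≠ 0 ∧
      (u s * g (z₀ + η * Complex.exp ((k + 1) * s))) ^ (k + 1) =
        (z₀ + η * Complex.exp ((k + 1) * s)) *
          mobius lam (z₀ + η * Complex.exp ((k + 1) * s)) ^ k)
    (hshift : ∀ ζ : ℂ, ζ ^ (k + 1) = 1 → ∃ s₁ : ℂ, s₁.re = 0 ∧
      Complex.exp ((k + 1) * s₁) = 1 ∧ ∀ s, u (s + s₁) = ζ * u s) :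
    IsPreconnected {P : puncturedCurve k lam | zCoord P ≠ z₀ ∧ ‖zCoord P - z₀‖ < r} := by
  have hk : (0 : ℝ) < k + 1 := by positivity
  have hkc := natCast_add_one_ne_zero' k
  have hη0 : η ≠ 0 := by rintro rfl; simp at hη
  set T : Set ℂ := {s | s.re < Real.log r / (k + 1)} with hT
  have hTc : IsPreconnected T := (convex_halfSpace_re_lt _).isPreconnected
  have hnorm : ∀ s : ℂ, ‖η * Complex.exp ((k + 1) * s)‖ < r ↔ s ∈ T := by
    intro s
    rw [norm_mul, hη, one_mul, Complex.norm_exp, ← Real.lt_log_iff_exp_lt hr, hT,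
      Set.mem_ofPred_eq, lt_div_iff₀ hk, mul_comm s.re]
    have : ((k + 1 : ℂ) * s).re = (k + 1) * s.re := by simp
    rw [this]
  have hmem : ∀ s ∈ T, z₀ + η * Complex.exp ((k + 1) * s) ∈ Metric.ball z₀ r := by
    intro s hs
    rw [mem_ball_iff_norm, add_sub_cancel_left]
    exact (hnorm s).2 hs
  have hex : ∀ s : ℂ, ∃ P : puncturedCurve k lam, s ∈ T →
      P.1 = finPoint (z₀ + η * Complex.exp ((k + 1) * s))
        (u s * g (z₀ + η * Complex.exp ((k + 1) * s))) := by
    intro s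
    by_cases hs : s ∈ T
    · obtain ⟨h1, h2, -, h3⟩ := hrel s (hmem s hs)
      exact ⟨curvePoint _ _ h1 h2 h3, fun _ => rfl⟩
    · refine ⟨?_, fun h => absurd h hs⟩
      have hr' : Real.log r / (k + 1) - 1 < Real.log r / (k + 1) := by linarith
      obtain ⟨h1, h2, -, h3⟩ := hrel ((Real.log r / (k + 1) - 1 : ℝ) : ℂ)
        (hmem _ (by simpa only [hT, Set.mem_ofPred_eq, Complex.ofReal_re] using hr'))
      exact curvePoint _ _ h1 h2 h3
  choose ψ hψ using hex
  have hz : Continuous fun s : ℂ => z₀ + η * Complex.exp ((k + 1) * s) := by fun_prop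
  have hψc : ContinuousOn ψ T := continuousOn_curve hz.continuousOn
    (hu.continuousOn.mul (hg.comp hz.continuousOn hmem)) hψ
  convert! hTc.image ψ hψc using 1
  ext P
  constructor
  · rintro ⟨h1, h2⟩
    have h1' : (zCoord P - z₀) / η ≠ 0 := div_ne_zero (sub_ne_zero.2 h1) hη0
    set s₀ : ℂ := Complex.log ((zCoord P - z₀) / η) / (k + 1) with hs₀
    have hzs : zCoord P = z₀ + η * Complex.exp ((k + 1) * s₀) := by
      rw [hs₀, mul_div_cancel₀ _ hkc, Complex.exp_log h1']
      field_simp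
      ring
    have hs₀T : s₀ ∈ T := by
      rw [← hnorm]
      rwa [hzs, add_sub_cancel_left] at h2
    obtain ⟨h3, h4, h5, h6⟩ := hrel s₀ (hmem s₀ hs₀T)
    rw [← hzs] at h3 h4 h5 h6
    obtain ⟨s₁, h7, h8, h9⟩ := hshift (wCoord P / (u s₀ * g (zCoord P))) (by
      rw [div_pow, (coe_wCoord h4).2, h6]
      exact div_self (by rw [← h6]; exact pow_ne_zero _ h5))
    have hz' : z₀ + η * Complex.exp ((k + 1) * (s₀ + s₁)) = zCoord P := by
      rw [mul_add, Complex.exp_add, h8, mul_one, ← hzs]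
    have hsT : s₀ + s₁ ∈ T := by
      have : (s₀ + s₁).re = s₀.re := by simp [h7]
      rw [hT, Set.mem_ofPred_eq, this]
      exact hs₀T
    refine ⟨s₀ + s₁, hsT, ?_⟩
    have h10 := hψ _ hsT
    rw [hz', h9] at h10
    refine curve_ext (zCoord_of_eq h10) ?_
    rw [wCoord_of_eq h10]
    have : u s₀ ≠ 0 := left_ne_zero_of_mul h5
    have : g (zCoord P) ≠ 0 := right_ne_zero_of_mul h5
    field_simp
  · rintro ⟨s, hs, rfl⟩
    have := zCoord_of_eq (hψ s hs)
    constructor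
    · rw [this]
      simp [hη0, Complex.exp_ne_zero]
    · rw [this, add_sub_cancel_left]
      exact (hnorm s).2 hs

/-- Since `exp ((k+1) s₁) = 1`, the value `exp (k s₁)` is the inverse of `exp s₁`, so a logarithm
of `ζ` serves as `s₁`. -/
lemma exists_shift_pos {ζ : ℂ} (hζ : ζ ^ (k + 1) = 1) : ∃ s₁ : ℂ, s₁.re = 0 ∧
    Complex.exp ((k + 1) * s₁) = 1 ∧ Complex.exp (k * s₁) = ζ⁻¹ := by
  have h0 : ζ ≠ 0 := by rintro rfl; simp at hζ
  have h1 : Complex.exp ((k + 1) * Complex.log ζ) = 1 := by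
    have := Complex.exp_nat_mul (Complex.log ζ) (k + 1)
    push_cast at this
    rw [this, Complex.exp_log h0, hζ]
  refine ⟨Complex.log ζ, ?_, h1, ?_⟩
  · rw [Complex.log_re, Complex.norm_eq_one_of_pow_eq_one hζ k.succ_ne_zero, Real.log_one]
  · rw [add_mul, Complex.exp_add, one_mul, Complex.exp_log h0] at h1
    exact eq_inv_of_mul_eq_one_left h1

/-- A function with a positive value at `x` maps a small ball into the slit plane, where roots are
continuous. -/
lemma exists_ball_cpow {f : ℂ → ℂ} {x : ℝ} (hf : ContinuousAt f x)
    (h : ∃ y : ℝ, 0 < y ∧ f x = y) :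
    ∃ r > 0, ∀ z ∈ Metric.ball (x : ℂ) r, f z ∈ Complex.slitPlane := by
  obtain ⟨y, hy, hy'⟩ := h
  have : f x ∈ Complex.slitPlane := by
    rw [hy']
    exact Or.inl (by simpa using hy)
  exact Metric.eventually_nhds_iff_ball.1
    (hf.eventually_mem (Complex.isOpen_slitPlane.mem_nhds this))

lemma cpow_inv_pow (x : ℂ) : (x ^ ((k : ℂ) + 1)⁻¹) ^ (k + 1) = x := by
  have := Complex.cpow_nat_inv_pow x k.succ_ne_zero
  push_cast at this
  exact this

/-- Small punctured neighbourhoods of the point over `1/lam` are connected. -/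
lemma exists_isPreconnected_inv (hlam : 1 < lam) : ∃ r > 0, ∀ r' > 0, r' ≤ r →
    IsPreconnected {P : puncturedCurve k lam |
      zCoord P ≠ (lam : ℂ)⁻¹ ∧ ‖zCoord P - (lam : ℂ)⁻¹‖ < r'} := by
  have hl : (lam : ℂ) ≠ 0 := by exact_mod_cast (by linarith : lam ≠ 0)
  have hl1 : lam⁻¹ < 1 := inv_lt_one_of_one_lt₀ hlam
  have hl0 : 0 < lam⁻¹ := by positivity
  have hll : (lam : ℂ) - (lam : ℂ)⁻¹ ≠ 0 := by
    rw [← Complex.ofReal_inv]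
    exact_mod_cast (by linarith : lam - lam⁻¹ ≠ 0)
  obtain ⟨r, hr, h⟩ := exists_ball_cpow (f := fun z : ℂ => z / ((lam : ℂ) - z) ^ k) (x := lam⁻¹)
    (by
      push_cast
      exact continuousAt_id.div (by fun_prop) (pow_ne_zero _ hll))
    ⟨lam⁻¹ / (lam - lam⁻¹) ^ k, div_pos hl0 (pow_pos (by linarith) _), by push_cast; rfl⟩
  rw [Complex.ofReal_inv] at h
  have hne : ∀ z ∈ Metric.ball (lam : ℂ)⁻¹ (min r (lam - lam⁻¹)), z ≠ lam := by
    rintro z hz rfl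
    rw [mem_ball_iff_norm, ← Complex.ofReal_inv, ← Complex.ofReal_sub, Complex.norm_real,
      Real.norm_eq_abs, abs_of_pos (by linarith)] at hz
    exact absurd (hz.trans_le (min_le_right _ _)) (lt_irrefl _)
  refine ⟨min r (lam - lam⁻¹), lt_min hr (by linarith), fun r' hr' hrr => ?_⟩
  have hsub : Metric.ball (lam : ℂ)⁻¹ r' ⊆ Metric.ball (lam : ℂ)⁻¹ (min r (lam - lam⁻¹)) :=
    Metric.ball_subset_ball hrr
  have hsub' : Metric.ball (lam : ℂ)⁻¹ r' ⊆ Metric.ball (lam : ℂ)⁻¹ r :=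
    Metric.ball_subset_ball (hrr.trans (min_le_left _ _))
  refine isPreconnected_punctured_of_param (η := 1) (by simp) (u := fun s => Complex.exp (k * s))
    (g := fun z => (z / ((lam : ℂ) - z) ^ k) ^ ((k : ℂ) + 1)⁻¹) hr' ?_ (by fun_prop) ?_ ?_
  · intro z hz
    have h1 : (lam : ℂ) - z ≠ 0 := sub_ne_zero.2 (hne z (hsub hz)).symm
    have h2 : ContinuousAt (fun z : ℂ => z / ((lam : ℂ) - z) ^ k) z :=
      continuousAt_id.div (by fun_prop) (pow_ne_zero _ h1)
    exact (h2.cpow continuousAt_const (h z (hsub' hz))).continuousWithinAt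
  · intro s hs
    simp only [one_mul] at hs ⊢
    set z := (lam : ℂ)⁻¹ + Complex.exp ((k + 1) * s) with hz
    have h1 : (lam : ℂ) - z ≠ 0 := sub_ne_zero.2 (hne z (hsub hs)).symm
    have h2 := h z (hsub' hs)
    have h3 : z ≠ 0 := by
      rintro h3
      rw [h3] at h2
      simp at h2
    refine ⟨h3, hne z (hsub hs), mul_ne_zero (Complex.exp_ne_zero _) ?_, ?_⟩
    · intro h4
      have := cpow_inv_pow (k := k) (z / ((lam : ℂ) - z) ^ k)
      rw [h4, zero_pow k.succ_ne_zero] at this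
      exact Complex.slitPlane_ne_zero h2 this.symm
    · rw [mul_pow, cpow_inv_pow, mobius, div_pow, hz, add_sub_cancel_left, ← Complex.exp_nat_mul,
        ← Complex.exp_nat_mul]
      push_cast
      rw [show ((k : ℂ) + 1) * (k * s) = k * ((k + 1) * s) by ring]
      ring
  · intro ζ hζ
    obtain ⟨s₁, h1, h2, h3⟩ := exists_shift_pos (k := k) (ζ := ζ⁻¹) (by rw [inv_pow, hζ, inv_one])
    refine ⟨s₁, h1, h2, fun s => ?_⟩
    rw [mul_add, Complex.exp_add, h3, inv_inv, mul_comm]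

/-- Small punctured neighbourhoods of the point over `lam` are connected. -/
lemma exists_isPreconnected_lam (hlam : 1 < lam) : ∃ r > 0, ∀ r' > 0, r' ≤ r →
    IsPreconnected {P : puncturedCurve k lam | zCoord P ≠ lam ∧ ‖zCoord P - lam‖ < r'} := by
  have hl1 : lam⁻¹ < 1 := inv_lt_one_of_one_lt₀ hlam
  obtain ⟨r, hr, h⟩ := exists_ball_cpow (f := fun z : ℂ => z * (z - (lam : ℂ)⁻¹) ^ k) (x := lam)
    (by fun_prop)
    ⟨lam * (lam - lam⁻¹) ^ k, mul_pos (by linarith) (pow_pos (by linarith) _), by push_cast; rfl⟩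
  refine ⟨r, hr, fun r' hr' hrr => ?_⟩
  have hsub' : Metric.ball (lam : ℂ) r' ⊆ Metric.ball (lam : ℂ) r := Metric.ball_subset_ball hrr
  refine isPreconnected_punctured_of_param (η := -1) (by simp)
    (u := fun s => Complex.exp (-(k * s)))
    (g := fun z => (z * (z - (lam : ℂ)⁻¹) ^ k) ^ ((k : ℂ) + 1)⁻¹) hr' ?_ (by fun_prop) ?_ ?_
  · intro z hz
    refine ContinuousAt.continuousWithinAt ?_
    exact ContinuousAt.cpow (f := fun z => z * (z - (lam : ℂ)⁻¹) ^ k) (by fun_prop)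
      continuousAt_const (h z (hsub' hz))
  · intro s hs
    have he := Complex.exp_ne_zero ((k + 1) * s)
    set z := (lam : ℂ) + -1 * Complex.exp ((k + 1) * s) with hz
    have h2 := h z (hsub' hs)
    have h3 : z ≠ 0 := by
      rintro h3
      rw [h3] at h2
      simp at h2
    have h4 : (lam : ℂ) - z = Complex.exp ((k + 1) * s) := by rw [hz]; ring
    refine ⟨h3, ?_, mul_ne_zero (Complex.exp_ne_zero _) ?_, ?_⟩
    · rw [Ne, eq_comm, ← sub_eq_zero, h4]
      exact he
    · intro h4
      have := cpow_inv_pow (k := k) (z * (z - (lam : ℂ)⁻¹) ^ k)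
      rw [h4, zero_pow k.succ_ne_zero] at this
      exact Complex.slitPlane_ne_zero h2 this.symm
    · rw [mul_pow, cpow_inv_pow, mobius, div_pow, h4, ← Complex.exp_nat_mul,
        ← Complex.exp_nat_mul, mul_neg, Complex.exp_neg]
      push_cast
      rw [show ((k : ℂ) + 1) * (k * s) = k * ((k + 1) * s) by ring]
      ring
  · intro ζ hζ
    obtain ⟨s₁, h1, h2, h3⟩ := exists_shift_pos hζ
    refine ⟨s₁, h1, h2, fun s => ?_⟩
    rw [mul_add, neg_add, Complex.exp_add, Complex.exp_neg (k * s₁), h3, inv_inv, mul_comm]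

lemma exists_isPreconnected_punctured (hlam : 1 < lam) {z₀ : ℂ}
    (hz₀ : z₀ = lam ∨ z₀ = (lam : ℂ)⁻¹) : ∃ r > 0, ∀ r' > 0, r' ≤ r →
    IsPreconnected {P : puncturedCurve k lam | zCoord P ≠ z₀ ∧ ‖zCoord P - z₀‖ < r'} := by
  rcases hz₀ with rfl | rfl
  · exact exists_isPreconnected_lam hlam
  · exact exists_isPreconnected_inv hlam

/-- Over every value of `z` other than `0` and `lam` there is a point of the curve. -/
lemma exists_curve_zCoord_eq {z : ℂ} (h0 : z ≠ 0) (h1 : z ≠ lam) :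
    ∃ P : puncturedCurve k lam, zCoord P = z := by
  obtain ⟨w, hw⟩ := IsAlgClosed.exists_pow_nat_eq (z * mobius lam z ^ k) k.succ_pos
  exact ⟨curvePoint z w h0 h1 hw, rfl⟩

end BranchPoints

/-! ### The surface closes -/

section Closing

variable {k : ℕ} {lam c : ℝ} {E : Type} [TopologicalSpace E] {π : E → puncturedCurve k lam}
  {F : E → SL(2, ℂ)} {Y Y₁ Y₂ Y₃ : ℂ → SL(2, ℂ)} {B P Q : SL(2, ℂ)} {H : SL(2, ℂ)}
  {N : Subgroup SL(2, ℂ)}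

lemma frequently_im_ne_zero (z : ℂ) : ∃ᶠ ζ in 𝓝 z, ζ.im ≠ 0 := by
  rw [Filter.frequently_iff]
  intro U hU
  obtain ⟨r, hr, h⟩ := Metric.mem_nhds_iff.1 hU
  by_cases hz : z.im = 0
  · refine ⟨z + (r / 2 : ℝ) * Complex.I, h ?_, ?_⟩
    · rw [mem_ball_iff_norm, add_sub_cancel_left, norm_mul, Complex.norm_I, Complex.norm_real,
        Real.norm_eq_abs, abs_of_pos (by linarith)]
      linarith
    · simp [hz, hr.ne']
  · exact ⟨z, mem_of_mem_nhds hU, hz⟩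

/-- Every value of `z` other than `lam` and `1/lam` lies in one of the four slit domains. -/
lemma mem_some_slitDomain {z : ℂ} (h0 : z ≠ 0) (h1 : z ≠ lam) (h2 : z ≠ (lam : ℂ)⁻¹) :
    z ∈ slitDomain (Set.Ioo lam⁻¹ lam) ∨ z ∈ slitDomain (Set.Ioo 0 lam⁻¹) ∨
      z ∈ slitDomain (Set.Iio 0) ∨ z ∈ slitDomain (Set.Ioi lam) := by
  by_cases hz : z.im = 0
  · obtain ⟨x, rfl⟩ : ∃ x : ℝ, z = x := ⟨z.re, Complex.ext rfl hz⟩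
    rw [← Complex.ofReal_inv] at h2
    have h0 : x ≠ 0 := by exact_mod_cast h0
    have h1 : x ≠ lam := by exact_mod_cast h1
    have h2 : x ≠ lam⁻¹ := by exact_mod_cast h2
    simp only [slitDomain, Set.mem_ofPred_eq, Complex.ofReal_im, ne_eq, not_true_eq_false, false_or,
      Complex.ofReal_re, Set.mem_Ioo, Set.mem_Iio, Set.mem_Ioi]
    rcases lt_or_gt_of_ne h0 with h0 | h0 <;> rcases lt_or_gt_of_ne h1 with h1 | h1 <;>
      rcases lt_or_gt_of_ne h2 with h2 | h2 <;> tauto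
  · exact Or.inl (Or.inl hz)

/-- At the point `y` of the cover, `F` differs from a rotated copy of `Y` by an element of the
coset `H N`. -/
def InCoset (π : E → puncturedCurve k lam) (F : E → SL(2, ℂ)) (Y : ℂ → SL(2, ℂ)) (H : SL(2, ℂ))
    (N : Subgroup SL(2, ℂ)) (y : E) : Prop :=
  ∃ (d : ℂˣ) (C : SL(2, ℂ)), H⁻¹ * C ∈ N ∧ OnSheet π F (branchMid k lam) Y d C y

lemma branchMid_ne_zero (z : ℂ) : branchMid k lam z ≠ 0 := rootExp_ne_zero _ _

lemma neg_mem_iff_of_neg_one_mem (hN : -1 ∈ N) {A : SL(2, ℂ)} : -A ∈ N ↔ A ∈ N := by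
  rw [← neg_one_mul, N.mul_mem_cancel_left hN]

omit [TopologicalSpace E] in
lemma OnSheet.inCoset_iff (hN : -1 ∈ N) {d : ℂˣ} {C : SL(2, ℂ)} {y : E}
    (h : OnSheet π F (branchMid k lam) Y d C y) : InCoset π F Y H N y ↔ H⁻¹ * C ∈ N := by
  refine ⟨fun ⟨d', C', h1, h2⟩ => ?_, fun h1 => ⟨d, C, h1, h⟩⟩
  rcases h.unique h2 (branchMid_ne_zero _) with ⟨-, rfl⟩ | ⟨-, rfl⟩
  · exact h1
  · rwa [mul_neg, neg_mem_iff_of_neg_one_mem hN] at h1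

/-- The property `InCoset`, restricted to the points over the upper and lower half planes, is
locally constant at `x`. -/
def CosetLocConst (π : E → puncturedCurve k lam) (F : E → SL(2, ℂ)) (Y : ℂ → SL(2, ℂ))
    (H : SL(2, ℂ)) (N : Subgroup SL(2, ℂ)) (x : E) : Prop :=
  (∀ᶠ y in 𝓝 x, (zCoord (π y)).im ≠ 0 → InCoset π F Y H N y) ∨
    ∀ᶠ y in 𝓝 x, (zCoord (π y)).im ≠ 0 → ¬InCoset π F Y H N y

/-- The connection matrix `R` across the real interval `S` does not affect membership in the
coset. -/
lemma cosetLocConst_of_mem_slitDomain {S : Set ℝ} {v' : ℂ → ℂ} {Y' : ℂ → SL(2, ℂ)} {d : ℂˣ}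
    {R : SL(2, ℂ)} {a : ℂ} {x : E} (hN : -1 ∈ N) (hπ : IsCoveringMap π) (hF : IsSolution c π F)
    (hv : IsBranch k lam (slitDomain S) v') (hS : IsOpen S) (hs : StarConvex ℝ a (slitDomain S))
    (hY' : SolvesOn k lam c (slitDomain S) v' Y')
    (hv₁ : ∀ z : ℂ, z.im < 0 → v' z = branchMid k lam z) (hY₁ : ∀ z : ℂ, z.im < 0 → Y' z = Y z)
    (hv₂ : ∀ z : ℂ, 0 < z.im → v' z = d ^ 2 * branchMid k lam z)
    (hY₂ : ∀ z : ℂ, 0 < z.im → Y' z = diagSL d * Y z * R) (hR : H⁻¹ * R * H ∈ N)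
    (hx : zCoord (π x) ∈ slitDomain S) : CosetLocConst π F Y H N x := by
  obtain ⟨e, C, h⟩ := exists_eventually_onSheet hπ hF hv (isOpen_slitDomain hS) hs hY' hx
  have key : ∀ y, OnSheet π F v' Y' e C y → (zCoord (π y)).im ≠ 0 →
      (InCoset π F Y H N y ↔ H⁻¹ * C ∈ N) := by
    intro y hy hy'
    rcases lt_or_gt_of_ne hy' with hy' | hy'
    · exact ((OnSheet.congr_iff_of_eq' (hv₁ _ hy') (hY₁ _ hy')).1 hy).inCoset_iff hN
    · rw [((OnSheet.congr_iff (hv₂ _ hy') (hY₂ _ hy')).1 hy).inCoset_iff hN,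
        ← N.mul_mem_cancel_left hR (y := H⁻¹ * C)]
      simp only [mul_assoc, mul_inv_cancel_left]
  by_cases hC : H⁻¹ * C ∈ N
  · exact Or.inl (h.mono fun y hy hy' => (key y hy hy').2 hC)
  · exact Or.inr (h.mono fun y hy hy' h' => hC ((key y hy hy').1 h'))

lemma map_nhds_eq_of_covering (hπ : IsCoveringMap π) (x : E) : Filter.map π (𝓝 x) = 𝓝 (π x) :=
  hπ.isLocalHomeomorph.map_nhds_eq x

/-- The points over the upper and lower half planes are dense. -/
lemma frequently_zCoord_im_ne_zero (hk : 1 ≤ k)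
    (hlam : 1 < lam) (hπ : IsCoveringMap π) (x : E) :
    ∃ᶠ y in 𝓝 x, (zCoord (π y)).im ≠ 0 := by
  by_cases hz : zCoord (π x) = lam ∨ zCoord (π x) = (lam : ℂ)⁻¹
  · have hx : ∃ᶠ P in 𝓝 (π x), (zCoord P).im ≠ 0 := by
      rw [Filter.frequently_iff]
      intro U hU
      obtain ⟨V, hV, hVU⟩ := comap_zCoord_le_nhds hk hlam hz hU
      obtain ⟨z, hzV, hz'⟩ := (Filter.frequently_iff.1 (frequently_im_ne_zero (zCoord (π x)))) hV
      obtain ⟨P, hP⟩ := exists_curve_zCoord_eq (k := k) (lam := lam) (z := z)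
        (by rintro rfl; simp at hz') (ne_ofReal_of_im_ne_zero hz' lam)
      exact ⟨P, hVU (by simpa [hP] using hzV), by rwa [hP]⟩
    rw [← map_nhds_eq_of_covering hπ, Filter.frequently_map] at hx
    exact hx
  · push Not at hz
    have key : ∀ {S : Set ℝ} {v' : ℂ → ℂ} {a : ℂ}, IsBranch k lam (slitDomain S) v' → IsOpen S →
        StarConvex ℝ a (slitDomain S) → zCoord (π x) ∈ slitDomain S →
        ∃ᶠ y in 𝓝 x, (zCoord (π y)).im ≠ 0 := by
      intro S v' a hv hS hs hx
      obtain ⟨_, ℓ, -, hℓ, hℓx⟩ := exists_isSheetLift_through hπ hv (isOpen_slitDomain hS) hs hx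
      have hc : ContinuousAt ℓ (zCoord (π x)) :=
        hℓ.1.continuousAt ((isOpen_slitDomain hS).mem_nhds hx)
      have := hc.tendsto
      rw [hℓx] at this
      refine this.frequently (((frequently_im_ne_zero (zCoord (π x))).and_eventually
        ((isOpen_slitDomain hS).mem_nhds hx)).mono fun z hz => ?_)
      rw [(hℓ.2 z hz.2).1]
      exact hz.1
    rcases mem_some_slitDomain (zCoord_ne_zero hlam _) hz.1 hz.2 with hx | hx | hx | hx
    · exact key (isBranch_branchMid hlam) isOpen_Ioo (starConvex_mid hlam) hx
    · exact key (isBranch_branchSide_left hlam) isOpen_Ioo (starConvex_left hlam) hx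
    · exact key (isBranch_branchNeg hlam) isOpen_Iio starConvex_neg hx
    · exact key (isBranch_branchSide_right hlam) isOpen_Ioi starConvex_right hx

/-- On a connected set where `InCoset` is locally constant, it holds near all points or near
none. -/
lemma CosetLocConst.of_isPreconnected {A : Set E} (hA : IsPreconnected A)
    (hd : ∀ x : E, ∃ᶠ y in 𝓝 x, (zCoord (π y)).im ≠ 0)
    (h : ∀ x ∈ A, CosetLocConst π F Y H N x) {x y : E} (hx : x ∈ A) (hy : y ∈ A)
    (hp : ∀ᶠ y in 𝓝 x, (zCoord (π y)).im ≠ 0 → InCoset π F Y H N y) :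
    ∀ᶠ y in 𝓝 y, (zCoord (π y)).im ≠ 0 → InCoset π F Y H N y := by
  refine hA.of_eventually_or
    (p := fun x => ∀ᶠ y in 𝓝 x, (zCoord (π y)).im ≠ 0 → InCoset π F Y H N y)
    (fun x hx => ?_) hx hy hp
  rcases h x hx with h | h
  · exact Or.inl h.eventually_nhds
  · refine Or.inr (h.eventually_nhds.mono fun y hy hy' => ?_)
    obtain ⟨z, hz, hz1, hz2⟩ := ((hd y).and_eventually (hy.and hy')).exists
    exact hz1 hz (hz2 hz)

section

variable (h : IsConnectionData k lam c Y Y₁ Y₂ Y₃ B P Q) (hk : 1 ≤ k) (hlam : 1 < lam)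
  (hπ : IsCoveringMap π) (hF : IsSolution c π F) (hN : -1 ∈ N) (hB : H⁻¹ * B * H ∈ N)
  (hP : H⁻¹ * P * H ∈ N) (hQ : H⁻¹ * Q * H ∈ N)

include h hlam hπ hF hN hB hP hQ

lemma cosetLocConst_of_ne {x : E} (h1 : zCoord (π x) ≠ lam) (h2 : zCoord (π x) ≠ (lam : ℂ)⁻¹) :
    CosetLocConst π F Y H N x := by
  rcases mem_some_slitDomain (zCoord_ne_zero hlam _) h1 h2 with hx | hx | hx | hx
  · exact cosetLocConst_of_mem_slitDomain (d := 1) (R := 1) hN hπ hF (isBranch_branchMid hlam)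
      isOpen_Ioo (starConvex_mid hlam) h.mid (fun _ _ => rfl) (fun _ _ => rfl)
      (fun _ _ => by simp) (fun _ _ => by simp [diagSL_one]) (by simp) hx
  · exact cosetLocConst_of_mem_slitDomain hN hπ hF (isBranch_branchSide_left hlam)
      isOpen_Ioo (starConvex_left hlam) h.left (fun _ => branchSide_of_im_neg hlam) h.left_lower
      (fun _ => branchSide_of_im_pos hlam) h.left_upper hB hx
  · exact cosetLocConst_of_mem_slitDomain (d := 1) hN hπ hF (isBranch_branchNeg hlam)
      isOpen_Iio starConvex_neg h.neg (fun _ => branchNeg_of_im_neg hlam) h.neg_lower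
      (fun _ hz => by simpa using branchNeg_of_im_pos hlam hz)
      (by simpa [diagSL_one] using h.neg_upper) hP hx
  · exact cosetLocConst_of_mem_slitDomain hN hπ hF (isBranch_branchSide_right hlam)
      isOpen_Ioi starConvex_right h.right (fun _ => branchSide_of_im_neg hlam) h.right_lower
      (fun _ => branchSide_of_im_pos hlam) h.right_upper hQ hx

include hk

/-- At the points over `lam` and `1/lam`, a punctured neighbourhood is connected. -/
lemma cosetLocConst (x : E) : CosetLocConst π F Y H N x := by
  by_cases hz : zCoord (π x) = lam ∨ zCoord (π x) = (lam : ℂ)⁻¹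
  swap
  · push Not at hz
    exact cosetLocConst_of_ne h hlam hπ hF hN hB hP hQ hz.1 hz.2
  have hl1 : lam⁻¹ < 1 := inv_lt_one_of_one_lt₀ hlam
  obtain ⟨e, he, he'⟩ := hπ.isLocalHomeomorph x
  have het : e.target ∈ 𝓝 (π x) := e.open_target.mem_nhds (by rw [he']; exact e.map_source he)
  obtain ⟨V, hV, hVt⟩ := comap_zCoord_le_nhds hk hlam hz het
  obtain ⟨r₀, hr₀, hrV⟩ := Metric.mem_nhds_iff.1 hV
  obtain ⟨r₁, hr₁, hconn⟩ := exists_isPreconnected_punctured (k := k) hlam hz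
  set r := min (min r₀ r₁) (lam - lam⁻¹) with hr
  have hr0 : 0 < r := lt_min (lt_min hr₀ hr₁) (by linarith)
  have hD := hconn r hr0 ((min_le_left _ _).trans (min_le_right _ _))
  set D := {P : puncturedCurve k lam | zCoord P ≠ zCoord (π x) ∧ ‖zCoord P - zCoord (π x)‖ < r}
  have hDt : D ⊆ e.target := fun P hP => hVt (hrV (by
    rw [mem_ball_iff_norm]
    exact hP.2.trans_le ((min_le_left _ _).trans (min_le_left _ _))))
  have hA := hD.image e.symm (e.continuousOn_symm.mono hDt)
  have hd := frequently_zCoord_im_ne_zero hk hlam hπ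
  have hll : ‖(lam : ℂ) - (lam : ℂ)⁻¹‖ = lam - lam⁻¹ := by
    rw [← Complex.ofReal_inv, ← Complex.ofReal_sub, Complex.norm_real, Real.norm_eq_abs,
      abs_of_pos (by linarith)]
  -- the radius excludes the other branch point
  have hne : ∀ P ∈ D, zCoord P ≠ lam ∧ zCoord P ≠ (lam : ℂ)⁻¹ := by
    rintro P ⟨hP1, hP2⟩
    replace hP2 := hP2.trans_le (min_le_right _ _)
    rcases hz with hz | hz <;> rw [hz] at hP1 hP2
    · refine ⟨hP1, fun h' => ?_⟩
      rw [h', norm_sub_rev, hll] at hP2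
      exact lt_irrefl _ hP2
    · refine ⟨fun h' => ?_, hP1⟩
      rw [h', hll] at hP2
      exact lt_irrefl _ hP2
  have hLC : ∀ y ∈ e.symm '' D, CosetLocConst π F Y H N y := by
    rintro _ ⟨P, hP, rfl⟩
    have h1 : π (e.symm P) = P := by rw [he']; exact e.right_inv (hDt hP)
    exact cosetLocConst_of_ne h hlam hπ hF hN hB (by assumption) hQ
      (by rw [h1]; exact (hne P hP).1) (by rw [h1]; exact (hne P hP).2)
  have hW : ∀ᶠ y in 𝓝 x, (zCoord (π y)).im ≠ 0 → y ∈ e.symm '' D := by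
    have hc : ContinuousAt (fun y => zCoord (π y)) x :=
      (continuous_zCoord.comp hπ.continuous).continuousAt
    filter_upwards [e.open_source.mem_nhds he,
      hc.eventually_mem (Metric.ball_mem_nhds _ hr0)] with y hy1 hy2 hy3
    refine ⟨π y, ⟨fun h' => hy3 ?_, mem_ball_iff_norm.1 hy2⟩, by rw [he']; exact e.left_inv hy1⟩
    rw [h']
    rcases hz with hz | hz <;> simp [hz]
  by_cases hex : ∃ y ∈ e.symm '' D, ∀ᶠ y' in 𝓝 y, (zCoord (π y')).im ≠ 0 → InCoset π F Y H N y'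
  · obtain ⟨y, hy, hy'⟩ := hex
    exact Or.inl (hW.mono fun y₁ h₁ h₂ =>
      (CosetLocConst.of_isPreconnected hA hd hLC hy (h₁ h₂) hy').self_of_nhds h₂)
  · simp only [not_exists, not_and] at hex
    exact Or.inr (hW.mono fun y₁ h₁ h₂ =>
      ((hLC y₁ (h₁ h₂)).resolve_left (hex y₁ (h₁ h₂))).self_of_nhds h₂)

/-- If the conjugated connection matrices lie in the group `N`, so do all the quotients of values
of `F` at two points of one fibre over the upper or lower half plane. -/
lemma inv_mul_mem_of_im_ne_zero [PreconnectedSpace E] {e₀ : E} (he₀ : (π e₀).1 = basePair k lam)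
    (hH : F e₀ = H) {x y : E} (hxy : π x = π y) (hx : (zCoord (π x)).im ≠ 0) :
    (F x)⁻¹ * F y ∈ N := by
  have hd := frequently_zCoord_im_ne_zero hk hlam hπ
  have hbase : ∀ᶠ y in 𝓝 e₀, (zCoord (π y)).im ≠ 0 → InCoset π F Y H N y := by
    obtain ⟨d, C, h'⟩ := exists_eventually_onSheet (x := e₀) hπ hF
      (isBranch_branchMid (k := k) hlam) (isOpen_slitDomain isOpen_Ioo) (starConvex_mid hlam)
      h.mid (by rw [((eq_basePair hlam).1 he₀).1]; exact one_mem_slitDomain hlam)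
    have h0 := h'.self_of_nhds
    have hC : H⁻¹ * C ∈ N := by
      refine (h0.inCoset_iff hN).1 ⟨1, H, by simp, ?_⟩
      rw [← hH]
      exact onSheet_base h hlam he₀
    exact h'.mono fun y hy _ => ⟨d, C, hC, hy⟩
  have hall : ∀ z, (zCoord (π z)).im ≠ 0 → InCoset π F Y H N z := fun z hz =>
    (CosetLocConst.of_isPreconnected isPreconnected_univ hd
      (fun x _ => cosetLocConst h hk hlam hπ hF hN hB hP hQ x) (Set.mem_univ e₀) (Set.mem_univ z)
      hbase).self_of_nhds hz
  obtain ⟨d, C, hC, h1⟩ := hall x hx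
  obtain ⟨d', C', hC', h2⟩ := hall y (hxy ▸ hx)
  have hd2 : (d' : ℂ) ^ 2 = (d : ℂ) ^ 2 := by
    refine mul_right_cancel₀ (branchMid_ne_zero (k := k) (lam := lam) (zCoord (π x))) ?_
    rw [← h1.1, hxy, h2.1]
  have hkey : C⁻¹ * C' ∈ N := by
    have := N.mul_mem (N.inv_mem hC) hC'
    rwa [mul_inv_rev, inv_inv, mul_assoc, mul_inv_cancel_left] at this
  rw [h1.2, h2.2, ← hxy]
  rcases sq_eq_sq_iff_eq_or_eq_neg.1 hd2 with h3 | h3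
  · rw [show d' = d from Units.ext h3]
    convert hkey using 1
    group
  · rw [show d' = -d from Units.ext (by simpa using h3), diagSL_neg, neg_mul, neg_mul, mul_neg,
      neg_mem_iff_of_neg_one_mem hN]
    convert hkey using 1
    group

/-- A continuous function of `F N` is well defined on the curve. -/
lemma closesUp_of_mem [PreconnectedSpace E] {e₀ : E} (he₀ : (π e₀).1 = basePair k lam)
    (hH : F e₀ = H) {X : Type} [TopologicalSpace X] [T2Space X] {f : E → X} (hf : Continuous f)
    (hfN : ∀ x y, (F x)⁻¹ * F y ∈ N → f x = f y) : ClosesUp π f := by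
  have hfac : Function.FactorsThrough f π := by
    intro x y hxy
    obtain ⟨e, he, he'⟩ := hπ.isLocalHomeomorph x
    obtain ⟨e₁, he₁, he₁'⟩ := hπ.isLocalHomeomorph y
    have hx : π x ∈ e.target := by rw [he']; exact e.map_source he
    have hy : π x ∈ e₁.target := by rw [hxy, he₁']; exact e₁.map_source he₁
    have hex : e.symm (π x) = x := by rw [he']; exact e.left_inv he
    have hey : e₁.symm (π x) = y := by rw [hxy, he₁']; exact e₁.left_inv he₁
    have hd := frequently_zCoord_im_ne_zero hk hlam hπ x
    have h1 : Filter.Tendsto (fun P => f (e.symm P)) (𝓝 (π x)) (𝓝 (f x)) := by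
      have := (hf.continuousAt.comp (e.continuousAt_symm hx)).tendsto
      rwa [Function.comp_apply, hex] at this
    have h2 : Filter.Tendsto (fun P => f (e₁.symm P)) (𝓝 (π x)) (𝓝 (f y)) := by
      have := (hf.continuousAt.comp (e₁.continuousAt_symm hy)).tendsto
      rwa [Function.comp_apply, hey] at this
    refine tendsto_nhds_unique_of_frequently_eq h1 h2 ?_
    have hd' : ∃ᶠ P in 𝓝 (π x), (zCoord P).im ≠ 0 := by
      rw [← map_nhds_eq_of_covering hπ, Filter.frequently_map]
      exact hd
    refine (hd'.and_eventually (Filter.inter_mem (e.open_target.mem_nhds hx)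
      (e₁.open_target.mem_nhds hy))).mono fun P hP => hfN _ _ ?_
    have h3 : π (e.symm P) = P := by
      have := e.right_inv hP.2.1
      rwa [← he'] at this
    have h4 : π (e₁.symm P) = P := by
      have := e₁.right_inv hP.2.2
      rwa [← he₁'] at this
    exact inv_mul_mem_of_im_ne_zero h hk hlam hπ hF hN hB (by assumption) hQ he₀ hH
      (h3.trans h4.symm) (by rw [h3]; exact hP.1)
  exact ⟨Function.extend π f fun _ => f e₀, fun x => hfac.extend_apply _ x⟩

end

end Closing

/-! ### Explicit loops -/

section ExplicitLoops

variable {k : ℕ} {lam : ℝ}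

/-- A path in the curve from continuous logarithms `b` of `m(z)` and `a` of `z`. Since `m` maps
the upper half plane to itself, the sign of `Im z` is that of `Im (exp b)`. -/
lemma exists_path_of_logs (hlam : 1 < lam) {a b : I → ℂ} (ha : Continuous a) (hb : Continuous b)
    (h0 : ∀ t, 1 + Complex.exp (b t) ≠ 0)
    (h : ∀ t, Complex.exp (a t) * (1 + Complex.exp (b t)) =
      lam * Complex.exp (b t) + (lam : ℂ)⁻¹) :
    ∃ γ : I → puncturedCurve k lam, Continuous γ ∧
      (∀ t, (γ t).1 = finPoint (Complex.exp (a t)) (rootExp k (a t) (b t))) ∧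
      (∀ t, (Complex.exp (b t)).im < 0 → (zCoord (γ t)).im < 0) ∧
      (∀ t, 0 < (Complex.exp (b t)).im → 0 < (zCoord (γ t)).im) := by
  have hl : (lam : ℂ) - (lam : ℂ)⁻¹ ≠ 0 := by
    have : lam⁻¹ < 1 := inv_lt_one_of_one_lt₀ hlam
    rw [← Complex.ofReal_inv]
    exact_mod_cast (by linarith : lam - lam⁻¹ ≠ 0)
  have hz : ∀ t, (lam : ℂ) - Complex.exp (a t) =
      ((lam : ℂ) - (lam : ℂ)⁻¹) / (1 + Complex.exp (b t)) := fun t => by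
    rw [eq_div_iff (h0 t), sub_mul, h]
    ring
  have hne : ∀ t, Complex.exp (a t) ≠ lam := fun t => by
    rw [Ne, eq_comm, ← sub_eq_zero, hz]
    exact div_ne_zero hl (h0 t)
  have hm : ∀ t, mobius lam (Complex.exp (a t)) = Complex.exp (b t) := fun t => by
    rw [mobius, div_eq_iff (sub_ne_zero.2 (hne t).symm)]
    linear_combination h t
  let γ : I → puncturedCurve k lam := fun t => curvePoint (Complex.exp (a t))
    (rootExp k (a t) (b t)) (Complex.exp_ne_zero _) (hne t) (by rw [rootExp_pow, hm])
  have hzγ : ∀ t, zCoord (γ t) = Complex.exp (a t) := fun t => rfl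
  refine ⟨γ, ?_, fun t => rfl, fun t ht => ?_, fun t ht => ?_⟩
  · rw [← continuousOn_univ]
    refine continuousOn_curve (a := fun t => Complex.exp (a t))
      (b := fun t => rootExp k (a t) (b t)) (by fun_prop) ?_ fun _ _ => rfl
    rw [continuousOn_univ]
    exact continuous_iff_continuousAt.2 fun t => continuousAt_rootExp ha.continuousAt
      hb.continuousAt
  · obtain ⟨r, hr, h'⟩ := mobius_im _ hlam (hne t)
    rw [hm] at h'
    rw [hzγ]
    rw [h'] at ht
    exact neg_of_mul_neg_right ht hr.le
  · obtain ⟨r, hr, h'⟩ := mobius_im _ hlam (hne t)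
    rw [hm] at h'
    rw [hzγ]
    rw [h'] at ht
    exact pos_of_mul_pos_right ht hr.le

lemma exp_im_neg {x θ : ℝ} (h0 : 0 < θ) (h1 : θ < Real.pi) :
    (Complex.exp (x - θ * Complex.I)).im < 0 := by
  rw [Complex.exp_im]
  simp only [Complex.sub_re, Complex.ofReal_re, Complex.mul_re, Complex.I_re, mul_zero,
    Complex.ofReal_im, Complex.I_im, mul_one, sub_self, sub_zero, Complex.sub_im, Complex.mul_im,
    add_zero, zero_sub, Real.sin_neg]
  have := Real.sin_pos_of_pos_of_lt_pi h0 h1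
  have := Real.exp_pos x
  nlinarith

lemma exp_im_pos {x θ : ℝ} (h0 : Real.pi < θ) (h1 : θ < 2 * Real.pi) :
    0 < (Complex.exp (x - θ * Complex.I)).im := by
  rw [Complex.exp_im]
  simp only [Complex.sub_re, Complex.ofReal_re, Complex.mul_re, Complex.I_re, mul_zero,
    Complex.ofReal_im, Complex.I_im, mul_one, sub_self, sub_zero, Complex.sub_im, Complex.mul_im,
    add_zero, zero_sub, Real.sin_neg]
  have h2 := Real.sin_pos_of_pos_of_lt_pi (x := θ - Real.pi) (by linarith) (by linarith)
  rw [Real.sin_sub_pi] at h2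
  exact mul_pos (Real.exp_pos x) h2

lemma exp_neg_log_sub (hlam : 1 < lam) (θ : ℂ) :
    Complex.exp (-(Real.log lam : ℂ) - θ) = (lam : ℂ)⁻¹ * Complex.exp (-θ) := by
  rw [sub_eq_add_neg, Complex.exp_add, Complex.exp_neg (Real.log lam : ℂ), ← Complex.ofReal_exp,
    Real.exp_log (by linarith)]

/-- On `|z| = 1` one has `|m(z)| = 1/lam`; this circle is a loop `γ₂`. -/
lemma exists_isLoop₂ (hlam : 1 < lam) :
    ∃ γ : I → puncturedCurve k lam, IsLoop₂ γ := by
  have hl0 : (lam : ℂ) ≠ 0 := by exact_mod_cast (by linarith : lam ≠ 0)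
  have hl1 : lam⁻¹ < 1 := inv_lt_one_of_one_lt₀ hlam
  have hl2 : 0 < lam⁻¹ := by positivity
  set θ : I → ℝ := fun t => 2 * Real.pi * t with hθ
  have hθc : Continuous θ := by fun_prop
  have hs : ∀ x : ℝ, 1 + (lam : ℂ)⁻¹ * Complex.exp (x * Complex.I) ∈ Complex.slitPlane := by
    intro x
    left
    rw [← Complex.ofReal_inv, Complex.add_re, Complex.re_ofReal_mul, Complex.exp_ofReal_mul_I_re,
      Complex.one_re]
    nlinarith [Real.neg_one_le_cos x]
  have hs' : ∀ t, 1 + (lam : ℂ)⁻¹ * Complex.exp (-(θ t * Complex.I)) ∈ Complex.slitPlane := by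
    intro t
    have := hs (-θ t)
    rwa [Complex.ofReal_neg, neg_mul] at this
  set b : I → ℂ := fun t => -(Real.log lam : ℂ) - θ t * Complex.I with hb
  set a : I → ℂ := fun t => -(θ t * Complex.I) +
    (Complex.log (1 + (lam : ℂ)⁻¹ * Complex.exp (θ t * Complex.I)) -
      Complex.log (1 + (lam : ℂ)⁻¹ * Complex.exp (-(θ t * Complex.I)))) with ha
  have hbc : Continuous b := by fun_prop
  have hac : Continuous a := by
    refine Continuous.add (by fun_prop) (Continuous.sub ?_ ?_)
    · exact Continuous.clog (by fun_prop) fun t => hs (θ t)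
    · exact Continuous.clog (by fun_prop) hs'
  have hexpb : ∀ t, Complex.exp (b t) = (lam : ℂ)⁻¹ * Complex.exp (-(θ t * Complex.I)) :=
    fun t => exp_neg_log_sub hlam _
  obtain ⟨γ, hγ, hγz, hγn, hγp⟩ := exists_path_of_logs (k := k) hlam hac hbc
    (fun t => by rw [hexpb]; exact Complex.slitPlane_ne_zero (hs' t)) (fun t => by
      have h1 := Complex.slitPlane_ne_zero (hs' t)
      have h2 := Complex.slitPlane_ne_zero (hs (θ t))
      have h3 : Complex.exp (-(θ t * Complex.I)) * Complex.exp (θ t * Complex.I) = 1 := by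
        rw [← Complex.exp_add, neg_add_cancel, Complex.exp_zero]
      rw [hexpb, ha]
      simp only
      rw [Complex.exp_add, Complex.exp_sub, Complex.exp_log h1, Complex.exp_log h2, mul_assoc,
        div_mul_cancel₀ _ h1, mul_add, mul_one, mul_left_comm, h3, mul_inv_cancel_left₀ hl0,
        mul_one])
  have hb' : ∀ t, b t = ((-Real.log lam : ℝ) : ℂ) - θ t * Complex.I := fun t => by simp [hb]
  have hpi := Real.pi_pos
  refine ⟨γ, hγ, ⟨1 / 2, by norm_num, by norm_num⟩, -1, ?_, ?_, by norm_num, ?_, ?_, ?_, ?_, ?_⟩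
  · rw [← Subtype.coe_lt_coe]; norm_num
  · rw [← Subtype.coe_lt_coe]; norm_num
  · rw [hγz, basePair]
    have h1 : a 0 = 0 := by simp [ha, hθ]
    have h2 : b 0 = -(Real.log lam : ℂ) := by simp [hb, hθ]
    rw [h1, h2, Complex.exp_zero, rootExp_zero_neg_log hlam]
  · intro t ht0 ht1
    rw [← Subtype.coe_lt_coe] at ht0 ht1
    refine hγn t ?_
    rw [hb' t]
    refine exp_im_neg ?_ ?_
    · exact mul_pos (by linarith) ht0
    · have : (t : ℝ) < 1 / 2 := ht1
      simp only [hθ]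
      nlinarith
  · have h1 := hγz ⟨1 / 2, by norm_num, by norm_num⟩
    rw [zCoord_of_eq h1]
    have h2 : (θ ⟨1 / 2, by norm_num, by norm_num⟩ : ℂ) = Real.pi := by
      simp [hθ]
      ring
    have h3 : Complex.exp (-(Real.pi * Complex.I)) = -1 := by
      rw [Complex.exp_neg, Complex.exp_pi_mul_I]; norm_num
    simp only [ha, h2, Complex.exp_pi_mul_I, h3, sub_self, add_zero]
    simp
  · intro t ht0 ht1
    rw [← Subtype.coe_lt_coe] at ht0 ht1
    refine hγp t ?_
    rw [hb' t]
    refine exp_im_pos ?_ ?_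
    · have : 1 / 2 < (t : ℝ) := ht0
      simp only [hθ]
      nlinarith
    · have : (t : ℝ) < 1 := ht1
      simp only [hθ]
      nlinarith
  · rw [hγz, basePair]
    have h2 : (θ 1 : ℂ) = 2 * Real.pi := by simp [hθ]
    have h3 : Complex.exp (-(2 * Real.pi * Complex.I)) = 1 := by
      rw [Complex.exp_neg, Complex.exp_two_pi_mul_I, inv_one]
    have h4 : a 1 = -(2 * Real.pi * Complex.I) := by
      simp only [ha, h2, Complex.exp_two_pi_mul_I, h3, sub_self, add_zero]
    have h5 : b 1 = -(Real.log lam : ℂ) + -(2 * Real.pi * Complex.I) := by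
      simp only [hb, h2]
      ring
    rw [h4, h5, h3, ← zero_add (-(2 * Real.pi * Complex.I)), rootExp_add, zero_add,
      rootExp_zero_neg_log hlam, rootExp_neg_two_pi, mul_one]

/-- The loop is given by the logarithm of `m(z)`: its argument runs from `0` to `-2π` and back,
while its modulus first passes through `lam ^ (-3)` (for `0 < z < 1/lam`) and on the way back
through `lam` (for `z > lam`). -/
lemma exists_isLoop₁ (hlam : 1 < lam) :
    ∃ γ : I → puncturedCurve k lam, IsLoop₁ γ := by
  have hl : 0 < lam := by linarith
  have hl1 : lam⁻¹ < 1 := inv_lt_one_of_one_lt₀ hlam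
  have hl2 : 0 < lam⁻¹ := by positivity
  have hL : 0 < Real.log lam := Real.log_pos hlam
  have hpi := Real.pi_pos
  have hl0 : (lam : ℂ) ≠ 0 := by exact_mod_cast hl.ne'
  set ρ : I → ℝ := fun t => -Real.log lam - 2 * Real.log lam * Real.sin (2 * Real.pi * t) with hρ
  set θ : I → ℝ := fun t => Real.pi * (1 - Real.cos (2 * Real.pi * t)) with hθ
  set b : I → ℂ := fun t => ρ t - θ t * Complex.I with hb
  have hbc : Continuous b := by fun_prop
  set z : I → ℂ := fun t => (lam * Complex.exp (b t) + (lam : ℂ)⁻¹) / (1 + Complex.exp (b t))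
    with hz
  set x : ℝ := lam * (lam - 1) / (lam ^ 3 - 1) with hx
  have h31 : 0 < lam ^ 3 - 1 := sub_pos.2 (one_lt_pow₀ hlam (by norm_num))
  have hx0 : 0 < x := div_pos (mul_pos hl (by linarith)) h31
  have hx1 : x < lam⁻¹ := by
    rw [hx, div_lt_iff₀ h31, inv_mul_eq_div, lt_div_iff₀ hl]
    nlinarith
  have hxC : ((lam : ℂ) ^ 3 - 1) ≠ 0 := by exact_mod_cast h31.ne'
  have hlC : ((lam : ℂ) - 1) ≠ 0 := by exact_mod_cast (by linarith : lam - 1 ≠ 0)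
  have hlC' : ((lam : ℂ) + 1) ≠ 0 := by exact_mod_cast (by linarith : lam + 1 ≠ 0)
  let t₁ : I := ⟨1 / 4, by norm_num, by norm_num⟩
  let t₂ : I := ⟨1 / 2, by norm_num, by norm_num⟩
  let t₃ : I := ⟨3 / 4, by norm_num, by norm_num⟩
  -- the five special parameter values
  have hb0 : b 0 = -(Real.log lam : ℂ) := by simp [hb, hρ, hθ]
  have hb1 : b t₁ = -(3 * Real.log lam : ℂ) - Real.pi * Complex.I := by
    have : 2 * Real.pi * (1 / 4) = Real.pi / 2 := by ring
    simp only [hb, hρ, hθ, t₁, this, Real.sin_pi_div_two, Real.cos_pi_div_two]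
    push_cast
    ring
  have hb2 : b t₂ = -(Real.log lam : ℂ) + -(2 * Real.pi * Complex.I) := by
    have : 2 * Real.pi * (1 / 2) = Real.pi := by ring
    simp only [hb, hρ, hθ, t₂, this, Real.sin_pi, Real.cos_pi]
    push_cast
    ring
  have hb3 : b t₃ = (Real.log lam : ℂ) - Real.pi * Complex.I := by
    have : 2 * Real.pi * (3 / 4) = Real.pi / 2 + Real.pi := by ring
    simp only [hb, hρ, hθ, t₃, this, Real.sin_add_pi, Real.cos_add_pi, Real.sin_pi_div_two,
      Real.cos_pi_div_two]
    push_cast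
    ring
  have hb4 : b 1 = -(Real.log lam : ℂ) := by simp [hb, hρ, hθ]
  have hexpL : Complex.exp (Real.log lam : ℂ) = lam := by
    rw [← Complex.ofReal_exp, Real.exp_log hl]
  have hE0 : Complex.exp (-(Real.log lam : ℂ)) = (lam : ℂ)⁻¹ := by
    rw [Complex.exp_neg, hexpL]
  have hE1 : Complex.exp (b t₁) = -((lam : ℂ) ^ 3)⁻¹ := by
    rw [hb1, Complex.exp_sub, Complex.exp_pi_mul_I, Complex.exp_neg,
      show (3 * Real.log lam : ℂ) = ((3 : ℕ) : ℂ) * (Real.log lam : ℂ) by norm_num,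
      Complex.exp_nat_mul, hexpL]
    ring
  have hE2 : Complex.exp (b t₂) = (lam : ℂ)⁻¹ := by
    rw [hb2, Complex.exp_add, hE0, Complex.exp_neg, Complex.exp_two_pi_mul_I, inv_one, mul_one]
  have hE3 : Complex.exp (b t₃) = -(lam : ℂ) := by
    rw [hb3, Complex.exp_sub, hexpL, Complex.exp_pi_mul_I]
    ring
  have hzone : (lam * (lam : ℂ)⁻¹ + (lam : ℂ)⁻¹) / (1 + (lam : ℂ)⁻¹) = 1 := by
    field_simp
  have hz0 : z 0 = 1 := by simp only [hz, hb0, hE0]; exact hzone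
  have hz4 : z 1 = 1 := by simp only [hz, hb4, hE0]; exact hzone
  have hz2 : z t₂ = 1 := by simp only [hz, hE2]; exact hzone
  have hz1 : z t₁ = x := by
    simp only [hz, hE1, hx]
    push_cast
    have h1 : 1 + -((lam : ℂ) ^ 3)⁻¹ = ((lam : ℂ) ^ 3 - 1) / lam ^ 3 := by field_simp; ring
    rw [h1]
    field_simp
    ring
  have hz3 : z t₃ = ((x⁻¹ : ℝ) : ℂ) := by
    simp only [hz, hE3, hx]
    push_cast
    have h1 : 1 + -(lam : ℂ) ≠ 0 := by
      rw [← sub_eq_add_neg, ← neg_sub]; exact neg_ne_zero.2 hlC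
    field_simp
    ring
  -- the sign of `Im (exp b)` is the opposite of that of `cos (2π t)`
  have hneg : ∀ t : I, 0 < Real.cos (2 * Real.pi * t) → Real.cos (2 * Real.pi * t) < 1 →
      (Complex.exp (b t)).im < 0 := fun t h1 h2 =>
    exp_im_neg (mul_pos hpi (by linarith)) (by simp only [hθ]; nlinarith)
  have hpos : ∀ t : I, Real.cos (2 * Real.pi * t) < 0 → -1 < Real.cos (2 * Real.pi * t) →
      0 < (Complex.exp (b t)).im := fun t h1 h2 =>
    exp_im_pos (by simp only [hθ]; nlinarith) (by simp only [hθ]; nlinarith)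
  have s1 : ∀ t : I, 0 < t → t < t₁ → (Complex.exp (b t)).im < 0 := by
    intro t h0 h1
    have h0 : (0 : ℝ) < t := h0
    have h1 : (t : ℝ) < 1 / 4 := h1
    refine hneg t (Real.cos_pos_of_mem_Ioo ⟨by nlinarith, by nlinarith⟩) ?_
    rw [← Real.cos_zero]
    exact Real.cos_lt_cos_of_nonneg_of_le_pi le_rfl (by nlinarith) (by nlinarith)
  have s2 : ∀ t : I, t₁ < t → t < t₂ → 0 < (Complex.exp (b t)).im := by
    intro t h0 h1
    have h0 : (1 / 4 : ℝ) < t := h0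
    have h1 : (t : ℝ) < 1 / 2 := h1
    refine hpos t (Real.cos_neg_of_pi_div_two_lt_of_lt (by nlinarith) (by nlinarith)) ?_
    rw [← Real.cos_pi]
    exact Real.cos_lt_cos_of_nonneg_of_le_pi (by nlinarith) le_rfl (by nlinarith)
  have hcos : ∀ t : I, Real.cos (2 * Real.pi * t) = Real.cos (2 * Real.pi * (1 - t)) := fun t => by
    rw [mul_sub, mul_one, Real.cos_two_pi_sub]
  have s3 : ∀ t : I, t₂ < t → t < t₃ → 0 < (Complex.exp (b t)).im := by
    intro t h0 h1
    have h0 : (1 / 2 : ℝ) < t := h0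
    have h1 : (t : ℝ) < 3 / 4 := h1
    refine hpos t ?_ ?_ <;> rw [hcos]
    · exact Real.cos_neg_of_pi_div_two_lt_of_lt (by nlinarith) (by nlinarith)
    · rw [← Real.cos_pi]
      exact Real.cos_lt_cos_of_nonneg_of_le_pi (by nlinarith) le_rfl (by nlinarith)
  have s4 : ∀ t : I, t₃ < t → t < 1 → (Complex.exp (b t)).im < 0 := by
    intro t h0 h1
    have h0 : (3 / 4 : ℝ) < t := h0
    have h1 : (t : ℝ) < 1 := h1
    refine hneg t ?_ ?_ <;> rw [hcos]
    · exact Real.cos_pos_of_mem_Ioo ⟨by nlinarith, by nlinarith⟩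
    · have := Real.cos_lt_cos_of_nonneg_of_le_pi (x := 0) (y := 2 * Real.pi * (1 - t)) le_rfl
        (by nlinarith) (by nlinarith)
      rwa [Real.cos_zero] at this
  have hcases : ∀ t : I, (Complex.exp (b t)).im ≠ 0 ∨ t = 0 ∨ t = t₁ ∨ t = t₂ ∨ t = t₃ ∨ t = 1 := by
    intro t
    rcases eq_or_lt_of_le t.2.1 with h0 | h0
    · exact Or.inr (Or.inl (Subtype.ext h0.symm))
    rcases lt_trichotomy t t₁ with h1 | h1 | h1
    · exact Or.inl (s1 t h0 h1).ne
    · tauto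
    rcases lt_trichotomy t t₂ with h2 | h2 | h2
    · exact Or.inl (s2 t h1 h2).ne'
    · tauto
    rcases lt_trichotomy t t₃ with h3 | h3 | h3
    · exact Or.inl (s3 t h2 h3).ne'
    · tauto
    rcases eq_or_lt_of_le t.2.2 with h4 | h4
    · have : t = 1 := Subtype.ext h4
      tauto
    · exact Or.inl (s4 t h3 h4).ne
  have hden : ∀ t, 1 + Complex.exp (b t) ≠ 0 := by
    intro t h0
    have h1 : Complex.exp (b t) = -1 := by linear_combination h0
    rcases hcases t with h | rfl | rfl | rfl | rfl | rfl
    · simp [h1] at h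
    · rw [hb0, hE0, ← Complex.ofReal_inv] at h1
      have : lam⁻¹ = -1 := by exact_mod_cast h1
      linarith
    · rw [hE1, neg_inj, inv_eq_one] at h1
      exact hxC (by rw [h1, sub_self])
    · rw [hE2, ← Complex.ofReal_inv] at h1
      have : lam⁻¹ = -1 := by exact_mod_cast h1
      linarith
    · rw [hE3, neg_inj] at h1
      exact hlC (by rw [h1, sub_self])
    · rw [hb4, hE0, ← Complex.ofReal_inv] at h1
      have : lam⁻¹ = -1 := by exact_mod_cast h1
      linarith
  have hzm : ∀ t, mobius lam (z t) = Complex.exp (b t) := by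
    intro t
    have h1 := hden t
    have h2 : (lam : ℂ) ^ 2 - 1 ≠ 0 := by
      rw [show (lam : ℂ) ^ 2 - 1 = (lam - 1) * (lam + 1) by ring]
      exact mul_ne_zero hlC hlC'
    have h3 : (lam : ℂ) - z t = (lam ^ 2 - 1) / (lam * (1 + Complex.exp (b t))) := by
      simp only [hz]; field_simp; ring
    have h4 : z t - (lam : ℂ)⁻¹ =
        (lam ^ 2 - 1) * Complex.exp (b t) / (lam * (1 + Complex.exp (b t))) := by
      simp only [hz]; field_simp; ring
    rw [mobius, h3, h4]
    field_simp
  have hslit : ∀ t, z t ∈ Complex.slitPlane := by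
    intro t
    rcases hcases t with h | rfl | rfl | rfl | rfl | rfl
    · right
      intro h'
      obtain ⟨y, hy⟩ : ∃ y : ℝ, z t = y := ⟨(z t).re, Complex.ext rfl h'⟩
      rw [← hzm, hy, mobius_ofReal, Complex.ofReal_im] at h
      exact h rfl
    · rw [hz0]; exact Complex.one_mem_slitPlane
    · rw [hz1]; exact Or.inl (by simpa using hx0)
    · rw [hz2]; exact Complex.one_mem_slitPlane
    · rw [hz3]; exact Or.inl (by simpa using hx0)
    · rw [hz4]; exact Complex.one_mem_slitPlane
  have hzc : Continuous z := Continuous.div (by fun_prop) (by fun_prop) hden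
  have hexpz : ∀ t, Complex.exp (Complex.log (z t)) = z t := fun t =>
    Complex.exp_log (Complex.slitPlane_ne_zero (hslit t))
  obtain ⟨γ, hγ, hγz, hγn, hγp⟩ := exists_path_of_logs (k := k) (a := fun t => Complex.log (z t))
    hlam (hzc.clog hslit) hbc hden (fun t => by rw [hexpz, hz]; exact div_mul_cancel₀ _ (hden t))
  simp only [hexpz] at hγz
  refine ⟨γ, hγ, t₁, t₂, t₃, x, rootExp k (Complex.log x) (b t₁), ?_, ?_, ?_, ?_, hx0, hx1, ?_,
    fun t h0 h1 => hγn t (s1 t h0 h1), ?_, fun t h0 h1 => hγp t (s2 t h0 h1), ?_,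
    fun t h0 h1 => hγp t (s3 t h0 h1), ?_, fun t h0 h1 => hγn t (s4 t h0 h1), ?_⟩
  · rw [← Subtype.coe_lt_coe]; norm_num [t₁]
  · rw [← Subtype.coe_lt_coe]; norm_num [t₁, t₂]
  · rw [← Subtype.coe_lt_coe]; norm_num [t₂, t₃]
  · rw [← Subtype.coe_lt_coe]; norm_num [t₃]
  · rw [hγz, basePair, hz0, Complex.log_one, hb0, rootExp_zero_neg_log hlam]
  · rw [hγz, hz1]
  · rw [hγz, hz2, Complex.log_one, hb2, ← add_zero (0 : ℂ), rootExp_add,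
      rootExp_zero_neg_log hlam, rootExp_zero_neg_two_pi, rootEps_sq, mul_comm]
  · have hg : ((lam ^ (2 * (k : ℝ) / ((k : ℝ) + 1)) : ℝ) : ℂ) = rootExp k 0 (2 * Real.log lam) := by
      rw [rootExp_zero_log hlam, gFactor, ← Complex.ofReal_pow, ← Real.rpow_natCast,
        ← Real.rpow_mul hl.le]
      congr 2
      push_cast
      ring
    have hlog : Complex.log ((x⁻¹ : ℝ) : ℂ) = -Complex.log x := by
      rw [← Complex.ofReal_log (by positivity), ← Complex.ofReal_log hx0.le, Real.log_inv,
        Complex.ofReal_neg]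
    rw [hγz, hz3, hlog, hg, ← rootEps_sq, ← rootExp_zero_neg_two_pi, ← rootExp_add,
      div_eq_mul_inv (rootExp k 0 _), ← rootExp_neg, ← rootExp_add, hb1, hb3, one_div,
      Complex.ofReal_inv]
    congr 2 <;> ring
  · rw [hγz, basePair, hz4, Complex.log_one, hb4, rootExp_zero_neg_log hlam]

/-- The loops lift to the cover. -/
lemma exists_lift {E : Type} [TopologicalSpace E] {π : E → puncturedCurve k lam} {e₀ : E}
    (hπ : IsCoveringMap π) (he₀ : (π e₀).1 = basePair k lam) {γ : I → puncturedCurve k lam}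
    (hγ : Continuous γ) (h0 : (γ 0).1 = basePair k lam) :
    ∃ Γ : C(I, E), Γ 0 = e₀ ∧ π ∘ Γ = γ := by
  obtain ⟨Γ, h1, h2⟩ := hπ.exists_path_lifts ⟨γ, hγ⟩ e₀ (Subtype.ext (h0.trans he₀.symm))
  exact ⟨Γ, h2, h1⟩

lemma exists_lift_isLoop₁ {E : Type} [TopologicalSpace E] {π : E → puncturedCurve k lam} {e₀ : E}
    (hlam : 1 < lam) (hπ : IsCoveringMap π) (he₀ : (π e₀).1 = basePair k lam) :
    ∃ Γ : C(I, E), Γ 0 = e₀ ∧ IsLoop₁ (π ∘ Γ) := by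
  obtain ⟨γ, hγ⟩ := exists_isLoop₁ (k := k) hlam
  have h0 : (γ 0).1 = basePair k lam := by
    obtain ⟨-, -, -, -, -, -, -, -, -, -, -, -, h, -⟩ := hγ
    exact h
  obtain ⟨Γ, h1, h2⟩ := exists_lift hπ he₀ hγ.1 h0
  exact ⟨Γ, h1, h2 ▸ hγ⟩

lemma exists_lift_isLoop₂ {E : Type} [TopologicalSpace E] {π : E → puncturedCurve k lam} {e₀ : E}
    (hlam : 1 < lam) (hπ : IsCoveringMap π) (he₀ : (π e₀).1 = basePair k lam) :
    ∃ Γ : C(I, E), Γ 0 = e₀ ∧ IsLoop₂ (π ∘ Γ) := by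
  obtain ⟨γ, hγ⟩ := exists_isLoop₂ (k := k) hlam
  have h0 : (γ 0).1 = basePair k lam := by
    obtain ⟨-, -, -, -, -, -, h, -⟩ := hγ
    exact h
  obtain ⟨Γ, h1, h2⟩ := exists_lift hπ he₀ hγ.1 h0
  exact ⟨Γ, h1, h2 ▸ hγ⟩

end ExplicitLoops

/-! ### Stabilizers of Hermitian forms -/

section Stabilizers

/-- The group of all `a ∈ SL(2, ℂ)` with `a J a* = J`. It is `SU(2)` for `J = 1` and `SU(1, 1)`
for `J = e₃`. -/
def formStabilizer (J : Matrix (Fin 2) (Fin 2) ℂ) : Subgroup SL(2, ℂ) where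
  carrier := {a | a.1 * J * a.1ᴴ = J}
  one_mem' := by simp
  mul_mem' {a b} ha hb := by
    simp only [Set.mem_ofPred_eq, Matrix.SpecialLinearGroup.coe_mul,
      Matrix.conjTranspose_mul] at ha hb ⊢
    calc a.1 * b.1 * J * (b.1ᴴ *
          a.1ᴴ)
        = a * (b.1 * J * b.1ᴴ) * a.1ᴴ := by
          simp only [mul_assoc]
      _ = J := by rw [hb, ha]
  inv_mem' {a} ha := by
    simp only [Set.mem_ofPred_eq] at ha ⊢
    have h1 : a⁻¹.1 * a.1 = 1 := by
      rw [← Matrix.SpecialLinearGroup.coe_mul, inv_mul_cancel, Matrix.SpecialLinearGroup.coe_one]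
    calc a⁻¹.1 * J *
          a⁻¹.1ᴴ
        = (a⁻¹.1 * a.1) * J *
          (a⁻¹.1 * a.1)ᴴ := by
          rw [Matrix.conjTranspose_mul]
          nth_rw 1 [← ha]
          simp only [mul_assoc]
      _ = J := by rw [h1, Matrix.conjTranspose_one, one_mul, mul_one]

variable {J : Matrix (Fin 2) (Fin 2) ℂ}

lemma mem_formStabilizer {a : SL(2, ℂ)} : a ∈ formStabilizer J ↔
    a.1 * J * a.1ᴴ = J := Iff.rfl

lemma neg_one_mem_formStabilizer : -1 ∈ formStabilizer J := by
  rw [mem_formStabilizer, Matrix.SpecialLinearGroup.coe_neg, Matrix.SpecialLinearGroup.coe_one]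
  simp

lemma inv_mul_mem_formStabilizer (a b : SL(2, ℂ)) : a⁻¹ * b ∈ formStabilizer J ↔
    a.1 * J * a.1ᴴ =
      b.1 * J * b.1ᴴ := by
  have h1 : a.1 * a⁻¹.1 = 1 := by
    rw [← Matrix.SpecialLinearGroup.coe_mul, mul_inv_cancel, Matrix.SpecialLinearGroup.coe_one]
  have h2 : a⁻¹.1 * a.1 = 1 := by
    rw [← Matrix.SpecialLinearGroup.coe_mul, inv_mul_cancel, Matrix.SpecialLinearGroup.coe_one]
  rw [mem_formStabilizer, Matrix.SpecialLinearGroup.coe_mul, Matrix.conjTranspose_mul]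
  constructor
  · intro h
    nth_rw 1 [← h]
    calc _ = (a.1 * a⁻¹.1) *
          (b.1 * J * b.1ᴴ) *
          (a.1 * a⁻¹.1)ᴴ := by
          rw [Matrix.conjTranspose_mul]
          simp only [mul_assoc]
      _ = _ := by rw [h1, Matrix.conjTranspose_one, one_mul, mul_one]
  · intro h
    calc _ = a⁻¹.1 *
          (b.1 * J * b.1ᴴ) *
          a⁻¹.1ᴴ := by
          simp only [mul_assoc]
      _ = (a⁻¹.1 * a.1) * J *
          (a⁻¹.1 * a.1)ᴴ := by
          rw [← h, Matrix.conjTranspose_mul]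
          simp only [mul_assoc]
      _ = _ := by rw [h2, Matrix.conjTranspose_one, one_mul, mul_one]

lemma mem_formStabilizer_iff_inv {a : SL(2, ℂ)} : a ∈ formStabilizer J ↔
    J * a.1ᴴ = a⁻¹.1 * J := by
  have h1 : a.1 * a⁻¹.1 = 1 := by
    rw [← Matrix.SpecialLinearGroup.coe_mul, mul_inv_cancel, Matrix.SpecialLinearGroup.coe_one]
  have h2 : a⁻¹.1 * a.1 = 1 := by
    rw [← Matrix.SpecialLinearGroup.coe_mul, inv_mul_cancel, Matrix.SpecialLinearGroup.coe_one]
  rw [mem_formStabilizer]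
  constructor
  · intro h
    nth_rw 2 [← h]
    rw [← mul_assoc, ← mul_assoc, h2, one_mul]
  · intro h
    rw [mul_assoc, h, ← mul_assoc, h1, one_mul]

lemma coe_formStabilizer_one : (formStabilizer 1 : Set SL(2, ℂ)) = SU2 := by
  ext a
  rw [SetLike.mem_coe, mem_formStabilizer, mul_one, SU2, Set.mem_ofPred_eq,
    Matrix.mem_specialUnitaryGroup_iff, Matrix.mem_unitaryGroup_iff, Matrix.star_eq_conjTranspose]
  exact ⟨fun h => ⟨h, a.2⟩, fun h => h.1⟩

lemma coe_formStabilizer_e₃ : (formStabilizer e₃ : Set SL(2, ℂ)) = SU11 := rfl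

lemma mem_formStabilizer_one_iff {a : SL(2, ℂ)} : a ∈ formStabilizer 1 ↔
    starRingEnd ℂ (a.1 0 0) = a.1 1 1 ∧ starRingEnd ℂ (a.1 0 1) = -a.1 1 0 := by
  rw [mem_formStabilizer_iff_inv, one_mul, mul_one, coe_inv_SL, ← Matrix.ext_iff]
  simp only [Fin.forall_fin_two, Matrix.conjTranspose_apply, Complex.star_def, Matrix.of_apply,
    Matrix.cons_val_zero, Matrix.cons_val_one, Matrix.cons_val', Matrix.cons_val_fin_one]
  constructor
  · rintro ⟨⟨h1, h2⟩, h3, h4⟩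
    exact ⟨h1, h3⟩
  · rintro ⟨h1, h2⟩
    refine ⟨⟨h1, ?_⟩, h2, ?_⟩
    · rw [← Complex.conj_conj (a.1 0 1), h2, map_neg, neg_neg]
    · rw [← h1, Complex.conj_conj]

lemma mem_formStabilizer_e₃_iff {a : SL(2, ℂ)} : a ∈ formStabilizer e₃ ↔
    starRingEnd ℂ (a.1 0 0) = a.1 1 1 ∧ starRingEnd ℂ (a.1 0 1) = a.1 1 0 := by
  rw [mem_formStabilizer_iff_inv, coe_inv_SL, ← Matrix.ext_iff]
  simp [Fin.forall_fin_two, Matrix.mul_apply, Fin.sum_univ_two, e₃]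
  constructor
  · rintro ⟨⟨h1, h2⟩, h3, h4⟩
    exact ⟨h1, h3⟩
  · rintro ⟨h1, h2⟩
    refine ⟨⟨h1, ?_⟩, h2, ?_⟩
    · rw [← h2, Complex.conj_conj]
    · rw [← h1, Complex.conj_conj]

end Stabilizers

/-! ### Conjugation by the initial values -/

section InitialValues

/-- The relation `conjSL A = A⁻¹`, entry by entry. -/
lemma entries_of_mul_conj {A : SL(2, ℂ)} (hA : A * conjSL A = 1) :
    A.1 1 1 = starRingEnd ℂ (A.1 0 0) ∧ A.1 0 1 = Complex.I * ((A.1 0 1).im : ℝ) ∧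
      A.1 1 0 = Complex.I * ((A.1 1 0).im : ℝ) := by
  have h : conjSL A = A⁻¹ := eq_inv_of_mul_eq_one_right hA
  have h0 : ∀ i j, starRingEnd ℂ (A.1 i j) = (A⁻¹).1 i j := fun i j => by
    rw [← h, conjSL_apply]
  have im : ∀ z : ℂ, starRingEnd ℂ z = -z → z = Complex.I * (z.im : ℝ) := fun z hz => by
    have := congrArg Complex.re hz
    simp only [Complex.conj_re, Complex.neg_re] at this
    apply Complex.ext <;> simp
    linarith
  refine ⟨?_, im _ ?_, im _ ?_⟩ <;> rw [h0] <;>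
    simp [coe_inv_SL, -Matrix.SpecialLinearGroup.coe_inv]

variable {a p q : ℂ} {s t r₁ r₂ α β : ℝ} {A C H : SL(2, ℂ)}

/-- The monodromy along the first loop, computed from the connection matrix across `(0, 1/lam)`. -/
lemma coe_flip_mul (hA : A.1 = !![a, Complex.I * s; Complex.I * t, starRingEnd ℂ a]) :
    (flipSL * A * flipSL⁻¹ * A).1 =
      !![((Complex.normSq a - t ^ 2 : ℝ) : ℂ), Complex.I * starRingEnd ℂ a * (s + t);
        -starRingEnd ℂ (Complex.I * starRingEnd ℂ a * (s + t)),
        ((Complex.normSq a - s ^ 2 : ℝ) : ℂ)] := by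
  have hI : Complex.I ^ 2 = -1 := Complex.I_sq
  have hn : (Complex.normSq a : ℂ) = starRingEnd ℂ a * a := Complex.normSq_eq_conj_mul_self
  rw [flipSL_inv]
  ext i j
  fin_cases i <;> fin_cases j <;>
    simp [Matrix.SpecialLinearGroup.coe_mul, coe_flipSL, hA, Matrix.mul_apply, Fin.sum_univ_two,
      -Matrix.cons_mul, hn]
  · linear_combination (-(starRingEnd ℂ a * a) + t ^ 2 - Complex.I ^ 2 * t ^ 2) * hI
  · linear_combination (-(Complex.I * starRingEnd ℂ a * s) - Complex.I * starRingEnd ℂ a * t) * hI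
  · linear_combination (-(Complex.I * a * s) - Complex.I * a * t) * hI
  · linear_combination (-(starRingEnd ℂ a * a) + s ^ 2 - Complex.I ^ 2 * s ^ 2) * hI

lemma coe_conj_H (hH : H.1 = !![(α : ℂ), (β : ℂ); (β : ℂ), (α : ℂ)]) (A : SL(2, ℂ)) :
    (H⁻¹ * A * H).1 = !![α * (A.1 0 0 * α + A.1 0 1 * β) - β * (A.1 1 0 * α + A.1 1 1 * β),
      α * (A.1 0 0 * β + A.1 0 1 * α) - β * (A.1 1 0 * β + A.1 1 1 * α);
      -β * (A.1 0 0 * α + A.1 0 1 * β) + α * (A.1 1 0 * α + A.1 1 1 * β),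
      -β * (A.1 0 0 * β + A.1 0 1 * α) + α * (A.1 1 0 * β + A.1 1 1 * α)] := by
  ext i j
  fin_cases i <;> fin_cases j <;>
    simp [Matrix.SpecialLinearGroup.coe_mul, coe_inv_SL, -Matrix.SpecialLinearGroup.coe_inv, hH,
      Matrix.mul_apply, Fin.sum_univ_two, -Matrix.cons_mul] <;> ring

lemma coe_conj_S (hH : H.1 = !![(α : ℂ), (β : ℂ); (α : ℂ), -(β : ℂ)]) (A : SL(2, ℂ)) :
    (H⁻¹ * A * H).1 = !![-(α * β * (A.1 0 0 + A.1 0 1 + A.1 1 0 + A.1 1 1)),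
      -(β ^ 2 * (A.1 0 0 - A.1 0 1 + A.1 1 0 - A.1 1 1));
      α ^ 2 * (-A.1 0 0 - A.1 0 1 + A.1 1 0 + A.1 1 1),
      α * β * (-A.1 0 0 + A.1 0 1 + A.1 1 0 - A.1 1 1)] := by
  ext i j
  fin_cases i <;> fin_cases j <;>
    simp [Matrix.SpecialLinearGroup.coe_mul, coe_inv_SL, -Matrix.SpecialLinearGroup.coe_inv, hH,
      Matrix.mul_apply, Fin.sum_univ_two, -Matrix.cons_mul] <;> ring

/-- All conditions for membership in `SU(2)` but one real equation hold automatically, because of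
the shape of `A`. -/
lemma conj_mem_SU2_iff (hA : A.1 = !![a, Complex.I * s; Complex.I * t, starRingEnd ℂ a])
    (hH : H.1 = !![(α : ℂ), (β : ℂ); (β : ℂ), (α : ℂ)]) :
    H⁻¹ * A * H ∈ formStabilizer 1 ↔ 4 * α * β * a.im = (t - s) * (α ^ 2 + β ^ 2) := by
  rw [mem_formStabilizer_one_iff, coe_conj_H hH, hA]
  simp [Complex.ext_iff]
  constructor
  · rintro ⟨-, h⟩
    linarith
  · intro h
    refine ⟨⟨?_, ?_⟩, ?_, ?_⟩ <;> linarith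

lemma conj_mem_SU2_iff_real (hC : C.1 = !![(r₁ : ℂ), p; -starRingEnd ℂ p, (r₂ : ℂ)])
    (hH : H.1 = !![(α : ℂ), (β : ℂ); (β : ℂ), (α : ℂ)]) :
    H⁻¹ * C * H ∈ formStabilizer 1 ↔ 4 * α * β * p.re = (r₂ - r₁) * (α ^ 2 + β ^ 2) := by
  rw [mem_formStabilizer_one_iff, coe_conj_H hH, hC]
  simp [Complex.ext_iff]
  constructor
  · rintro ⟨⟨h, -⟩, -⟩
    linarith
  · intro h
    refine ⟨⟨?_, ?_⟩, ?_⟩ <;> linarith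

lemma conj_mem_SU11_iff (hA : A.1 = !![a, Complex.I * s; Complex.I * t, starRingEnd ℂ a])
    (hH : H.1 = !![(α : ℂ), (β : ℂ); (α : ℂ), -(β : ℂ)]) :
    H⁻¹ * A * H ∈ formStabilizer e₃ ↔
      2 * a.im * (α ^ 2 + β ^ 2) = (t - s) * (α ^ 2 - β ^ 2) := by
  rw [mem_formStabilizer_e₃_iff, coe_conj_S hH, hA]
  simp [Complex.ext_iff, pow_two]
  constructor
  · rintro ⟨-, h⟩
    linarith
  · intro h
    refine ⟨⟨?_, ?_⟩, ?_⟩ <;> linarith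

lemma conj_mem_SU11_iff_real (hC : C.1 = !![(r₁ : ℂ), p; -starRingEnd ℂ p, (r₂ : ℂ)])
    (hH : H.1 = !![(α : ℂ), (β : ℂ); (α : ℂ), -(β : ℂ)]) :
    H⁻¹ * C * H ∈ formStabilizer e₃ ↔
      2 * p.re * (α ^ 2 + β ^ 2) = (r₂ - r₁) * (α ^ 2 - β ^ 2) := by
  rw [mem_formStabilizer_e₃_iff, coe_conj_S hH, hC]
  simp [Complex.ext_iff, pow_two]
  constructor
  · rintro ⟨-, h⟩
    linarith
  · intro h
    refine ⟨⟨?_, ?_⟩, ?_⟩ <;> linarith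

lemma sq_sub_sq_of_initialH (hH : H.1 = !![(α : ℂ), (β : ℂ); (β : ℂ), (α : ℂ)]) :
    α ^ 2 - β ^ 2 = 1 := by
  have := H.2
  rw [hH, Matrix.det_fin_two_of] at this
  rw [pow_two, pow_two]
  exact_mod_cast this

lemma mul_of_initialS (hH : H.1 = !![(α : ℂ), (β : ℂ); (α : ℂ), -(β : ℂ)]) :
    α * β = -1 / 2 := by
  have := H.2
  rw [hH, Matrix.det_fin_two_of] at this
  have h : α * -β - β * α = 1 := by exact_mod_cast this
  linarith

lemma conj_flipSL_mem_SU2 (hH : H.1 = !![(α : ℂ), (β : ℂ); (β : ℂ), (α : ℂ)]) :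
    H⁻¹ * flipSL * H ∈ formStabilizer 1 := by
  rw [mem_formStabilizer_one_iff, coe_conj_H hH, coe_flipSL]
  simp
  ring

lemma conj_flipSL_mem_SU11 (hH : H.1 = !![(α : ℂ), (β : ℂ); (α : ℂ), -(β : ℂ)]) :
    H⁻¹ * flipSL * H ∈ formStabilizer e₃ := by
  rw [mem_formStabilizer_e₃_iff, coe_conj_S hH, coe_flipSL]
  simp
  ring

lemma exists_initialH {α β : ℝ} (h : α ^ 2 - β ^ 2 = 1) :
    ∃ H : SL(2, ℂ), H.1 = !![(α : ℂ), (β : ℂ); (β : ℂ), (α : ℂ)] :=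
  ⟨⟨_, by rw [Matrix.det_fin_two_of, ← pow_two, ← pow_two]; exact_mod_cast h⟩, rfl⟩

lemma exists_initialS {α β : ℝ} (h : α * β = -1 / 2) :
    ∃ H : SL(2, ℂ), H.1 = !![(α : ℂ), (β : ℂ); (α : ℂ), -(β : ℂ)] :=
  ⟨⟨_, by
    rw [Matrix.det_fin_two_of]
    have : α * -β - β * α = 1 := by linarith
    exact_mod_cast this⟩, rfl⟩

end InitialValues

/-! ### The range of the closing parameter -/

section Parameters

variable {α β h : ℝ}

lemma one_lt_abs_of_initialH (h1 : α ^ 2 - β ^ 2 = 1) (h2 : α * β ≠ 0) :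
    1 < |(α ^ 2 + β ^ 2) / (2 * α * β)| := by
  have h3 : 2 * α * β ≠ 0 := by rw [mul_assoc]; exact mul_ne_zero two_ne_zero h2
  have h4 : (α - β) * (α + β) ≠ 0 := by
    rw [show (α - β) * (α + β) = α ^ 2 - β ^ 2 by ring, h1]
    exact one_ne_zero
  have h5 := pow_pos (abs_pos.2 (left_ne_zero_of_mul h4)) 2
  have h6 := pow_pos (abs_pos.2 (right_ne_zero_of_mul h4)) 2
  rw [sq_abs] at h5 h6
  rw [abs_div, one_lt_div (abs_pos.2 h3),
    abs_of_nonneg (by positivity : 0 ≤ α ^ 2 + β ^ 2), abs_lt]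
  constructor <;> nlinarith

lemma exists_pow_four_eq (h0 : 0 < h) : ∃ u : ℝ, 0 < u ∧ u ^ 4 = h :=
  ⟨√√h, Real.sqrt_pos.2 (Real.sqrt_pos.2 h0), by
    rw [show (4 : ℕ) = 2 * 2 from rfl, pow_mul, Real.sq_sqrt (Real.sqrt_nonneg _),
      Real.sq_sqrt h0.le]⟩

/-- With `α = (u + 1/u)/2` and `β = (u - 1/u)/2` the quotient is `(u⁴ + 1)/(u⁴ - 1)`. -/
lemma exists_initialH_of_one_lt_abs (hh : 1 < |h|) :
    ∃ α β : ℝ, α ^ 2 - β ^ 2 = 1 ∧ α * β ≠ 0 ∧ h = (α ^ 2 + β ^ 2) / (2 * α * β) := by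
  have h1 : h - 1 ≠ 0 := by
    intro h0
    rw [sub_eq_zero.1 h0, abs_one] at hh
    exact lt_irrefl _ hh
  have h2 : 0 < (h + 1) / (h - 1) := by
    rcases lt_abs.1 hh with h3 | h3
    · exact div_pos (by linarith) (by linarith)
    · exact div_pos_of_neg_of_neg (by linarith) (by linarith)
  obtain ⟨u, hu, hu4⟩ := exists_pow_four_eq h2
  have hu4' : u ^ 4 - 1 = 2 / (h - 1) := by rw [hu4]; field_simp; ring
  have hu1 : u ^ 4 - 1 ≠ 0 := by rw [hu4']; positivity
  have h3 : (u + u⁻¹) / 2 * ((u - u⁻¹) / 2) = (u ^ 4 - 1) / (4 * u ^ 2) := by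
    field_simp
    ring
  refine ⟨(u + u⁻¹) / 2, (u - u⁻¹) / 2, ?_, ?_, ?_⟩
  · field_simp
    ring
  · rw [h3]
    positivity
  · rw [mul_assoc, h3, show ((u + u⁻¹) / 2) ^ 2 + ((u - u⁻¹) / 2) ^ 2 =
      (u ^ 4 + 1) / (2 * u ^ 2) by field_simp; ring]
    have : u ^ 4 + 1 = h * (u ^ 4 - 1) := by rw [hu4', hu4]; field_simp; ring
    rw [this]
    field_simp
    ring

lemma abs_lt_one_of_initialS (h1 : α * β = -1 / 2) :
    |(α ^ 2 - β ^ 2) / (α ^ 2 + β ^ 2)| < 1 := by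
  have h2 : α * β ≠ 0 := by rw [h1]; norm_num
  have h3 : 0 < α ^ 2 := by have := left_ne_zero_of_mul h2; positivity
  have h4 : 0 < β ^ 2 := by have := right_ne_zero_of_mul h2; positivity
  rw [abs_div, div_lt_one (by positivity), abs_of_pos (by positivity : 0 < α ^ 2 + β ^ 2), abs_lt]
  constructor <;> linarith

/-- With `α = u` and `β = -1/(2u)` the quotient is `(4u⁴ - 1)/(4u⁴ + 1)`. -/
lemma exists_initialS_of_abs_lt_one (hh : |h| < 1) :
    ∃ α β : ℝ, α * β = -1 / 2 ∧ h = (α ^ 2 - β ^ 2) / (α ^ 2 + β ^ 2) := by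
  obtain ⟨h1, h2⟩ := abs_lt.1 hh
  have h3 : (1 - h) ≠ 0 := by linarith
  obtain ⟨u, hu, hu4⟩ := exists_pow_four_eq
    (div_pos (by linarith : 0 < 1 + h) (by linarith : 0 < 4 * (1 - h)))
  refine ⟨u, -1 / (2 * u), by field_simp, ?_⟩
  rw [show u ^ 2 - (-1 / (2 * u)) ^ 2 = (4 * u ^ 4 - 1) / (4 * u ^ 2) by field_simp; ring,
    show u ^ 2 + (-1 / (2 * u)) ^ 2 = (4 * u ^ 4 + 1) / (4 * u ^ 2) by field_simp; ring,
    div_div_div_cancel_right₀ (by positivity), eq_div_iff (by positivity), hu4]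
  field_simp
  ring

end Parameters

/-! ### Equivalence of the closing conditions -/

section Equivalence

lemma surfaceH_eq_iff {E : Type} {F : E → SL(2, ℂ)} (x y : E) :
    (F x)⁻¹ * F y ∈ formStabilizer 1 ↔
    surfaceH F x = surfaceH F y := by
  rw [inv_mul_mem_formStabilizer, mul_one, mul_one, Subtype.ext_iff]
  rfl

lemma surfaceS_eq_iff {E : Type} {F : E → SL(2, ℂ)} (x y : E) :
    (F x)⁻¹ * F y ∈ formStabilizer e₃ ↔
    surfaceS F x = surfaceS F y := by
  rw [inv_mul_mem_formStabilizer, Subtype.ext_iff]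
  rfl

variable {k : ℕ} {lam c : ℝ} {E : Type} [TopologicalSpace E] {π : E → puncturedCurve k lam}
  {F : E → SL(2, ℂ)} {Y Y₁ Y₂ Y₃ : ℂ → SL(2, ℂ)} {B P Q : SL(2, ℂ)} {e₀ : E}

lemma IsSolution.mul_right (hF : IsSolution c π F) (H : SL(2, ℂ)) :
    IsSolution c π fun x => F x * H := by
  refine ⟨?_, fun x h1 h2 => ?_⟩
  · simp only [Matrix.SpecialLinearGroup.coe_mul]
    exact hF.1.matrix_mul continuous_const
  · obtain ⟨Y, hY, hY'⟩ := hF.2 x h1 h2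
    refine ⟨fun ζ => Y ζ * H.1, ?_, fun i j => ?_⟩
    · filter_upwards [hY] with y hy
      rw [Matrix.SpecialLinearGroup.coe_mul, hy]
    · rw [Matrix.SpecialLinearGroup.coe_mul, ← mul_assoc]
      simp only [Matrix.mul_apply (N := H.1)]
      exact HasDerivAt.fun_sum fun l _ => (hY' i l).mul_const _

/-- Every loop of type `γ₁` or `γ₂` is closed. -/
lemma eq_of_isLoop {Γ : C(I, E)} (h : IsLoop₁ (π ∘ Γ) ∨ IsLoop₂ (π ∘ Γ)) :
    π (Γ 1) = π (Γ 0) := by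
  apply Subtype.ext
  rcases h with ⟨-, t₁, t₂, t₃, x, w, -, -, -, -, -, -, h0, -, -, -, -, -, -, -, h1⟩ |
    ⟨-, t₁, x, -, -, -, h0, -, -, -, h1⟩
  · exact h1.trans h0.symm
  · exact h1.trans h0.symm

/-- The abstract form of the closing conditions: `f` is a complete invariant of the cosets of the
group `N`, and `cond` expresses that the monodromies along the two loops lie in `N`. -/
lemma tfae_closesUp [PreconnectedSpace E] (h : IsConnectionData k lam c Y Y₁ Y₂ Y₃ B P Q)
    (hk : 1 ≤ k) (hlam : 1 < lam) (hπ : IsCoveringMap π) (he₀ : (π e₀).1 = basePair k lam)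
    (hF : IsSolution c π F) {N : Subgroup SL(2, ℂ)} (hN : -1 ∈ N)
    (hflip : (F e₀)⁻¹ * flipSL * F e₀ ∈ N) {X : Type} [TopologicalSpace X] [T2Space X] {f : E → X}
    (hf : Continuous f) (hfN : ∀ x y, (F x)⁻¹ * F y ∈ N ↔ f x = f y) {cond : Prop}
    (hcond : cond ↔ (F e₀)⁻¹ * (Q⁻¹ * B) * F e₀ ∈ N ∧ (F e₀)⁻¹ * P * F e₀ ∈ N)
    (hB : (F e₀)⁻¹ * (Q⁻¹ * B) * F e₀ ∈ N → (F e₀)⁻¹ * B * F e₀ ∈ N) :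
    List.TFAE [ClosesUp π f, AllMonodromiesIn π F e₀ N, LoopMonodromiesIn π F e₀ N, cond] := by
  tfae_have 1 → 2 := by
    rintro ⟨g, hg⟩ Γ h0 h1
    rw [monodromy, SetLike.mem_coe, hfN, ← hg, ← hg, h1, h0]
  tfae_have 2 → 3 := by
    intro h2 Γ h0 h1
    exact h2 Γ h0 (by rw [eq_of_isLoop h1, h0])
  tfae_have 3 → 4 := by
    intro h3
    obtain ⟨Γ₁, h01, h1⟩ := exists_lift_isLoop₁ hlam hπ he₀
    obtain ⟨Γ₂, h02, h2⟩ := exists_lift_isLoop₂ hlam hπ he₀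
    have m1 := h3 Γ₁ h01 (Or.inl h1)
    have m2 := h3 Γ₂ h02 (Or.inr h2)
    rw [monodromy_of_isLoop₁ h hlam hπ hF h1, h01] at m1
    rw [monodromy_of_isLoop₂ h hlam hπ hF h2, h02] at m2
    exact hcond.2 ⟨m1, m2⟩
  tfae_have 4 → 1 := by
    intro h4
    obtain ⟨h5, hP⟩ := hcond.1 h4
    have hB' := hB h5
    refine closesUp_of_mem h hk hlam hπ hF hN hB' hP ?_ he₀ rfl hf fun x y => (hfN x y).1
    have hQ : Q = (flipSL * B * flipSL⁻¹)⁻¹ := eq_inv_of_mul_eq_one_left (h.right_mul_flip hlam)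
    have := N.inv_mem (N.mul_mem (N.mul_mem hflip hB') (N.inv_mem hflip))
    rw [hQ]
    convert this using 1
    group
  tfae_finish

lemma continuous_surfaceH (hF : IsSolution c π F) : Continuous (surfaceH F) :=
  (hF.1.matrix_mul hF.1.matrix_conjTranspose).subtype_mk _

lemma continuous_surfaceS (hF : IsSolution c π F) : Continuous (surfaceS F) :=
  ((hF.1.matrix_mul continuous_const).matrix_mul hF.1.matrix_conjTranspose).subtype_mk _

variable [PreconnectedSpace E] {a q p : ℂ} {s t r₁ r₂ r₃ r₄ α β h₁ h₂ : ℝ}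

lemma tfae_closesUp_surfaceH (h : IsConnectionData k lam c Y Y₁ Y₂ Y₃ B P Q)
    (hk : 1 ≤ k) (hlam : 1 < lam) (hπ : IsCoveringMap π) (he₀ : (π e₀).1 = basePair k lam)
    (hF : IsSolution c π F) (hH : HasInitialH F e₀ α β)
    (hB : B.1 = !![a, Complex.I * s; Complex.I * t, starRingEnd ℂ a])
    (hP : P.1 = !![q, Complex.I * r₃; Complex.I * r₄, starRingEnd ℂ q])
    (hQ : (Q⁻¹ * B).1 = !![(r₁ : ℂ), p; -starRingEnd ℂ p, (r₂ : ℂ)])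
    (hp : p.re = (s + t) * a.im) (hr : r₂ - r₁ = (s + t) * (t - s))
    (h12 : r₁ ≠ r₂) (h34 : r₃ ≠ r₄)
    (hh₁ : h₁ = 2 * p.re / (r₂ - r₁)) (hh₂ : h₂ = 2 * q.im / (r₄ - r₃)) :
    List.TFAE [ClosesUp π (surfaceH F), AllMonodromiesIn π F e₀ SU2,
      LoopMonodromiesIn π F e₀ SU2,
      α * β ≠ 0 ∧ h₁ = h₂ ∧ h₁ = (α ^ 2 + β ^ 2) / (2 * α * β)] := by
  have hd := sq_sub_sq_of_initialH hH
  have h12' : r₂ - r₁ ≠ 0 := sub_ne_zero.2 h12.symm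
  have h34' : r₄ - r₃ ≠ 0 := sub_ne_zero.2 h34.symm
  rw [← coe_formStabilizer_one]
  refine tfae_closesUp h hk hlam hπ he₀ hF neg_one_mem_formStabilizer (conj_flipSL_mem_SU2 hH)
    (continuous_surfaceH hF) surfaceH_eq_iff ?_ ?_
  · rw [conj_mem_SU2_iff_real hQ hH, conj_mem_SU2_iff hP hH]
    have key : ∀ x r : ℝ, r ≠ 0 → α * β ≠ 0 →
        (2 * x / r = (α ^ 2 + β ^ 2) / (2 * α * β) ↔ 4 * α * β * x = r * (α ^ 2 + β ^ 2)) := by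
      intro x r hr h0
      rw [div_eq_div_iff hr (by rw [mul_assoc]; exact mul_ne_zero two_ne_zero h0)]
      constructor <;> intro h <;> linarith
    constructor
    · rintro ⟨h0, h1, h2⟩
      exact ⟨(key _ _ h12' h0).1 (hh₁ ▸ h2), (key _ _ h34' h0).1 (hh₂ ▸ h1 ▸ h2)⟩
    · rintro ⟨h1, h2⟩
      have h0 : α * β ≠ 0 := by
        intro h0
        rw [mul_assoc 4, h0, mul_zero, zero_mul] at h1
        have : 0 < α ^ 2 + β ^ 2 := by nlinarith [sq_nonneg β]
        exact mul_ne_zero h12' this.ne' h1.symm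
      rw [← key _ _ h12' h0, ← hh₁] at h1
      rw [← key _ _ h34' h0, ← hh₂] at h2
      exact ⟨h0, h1.trans h2.symm, h1⟩
  -- the two conditions differ by the factor `s + t`
  · rw [conj_mem_SU2_iff_real hQ hH, conj_mem_SU2_iff hB hH, hp, hr]
    intro h1
    have h0 : s + t ≠ 0 := left_ne_zero_of_mul (hr ▸ h12')
    refine mul_left_cancel₀ h0 ?_
    linarith

lemma tfae_closesUp_surfaceS (h : IsConnectionData k lam c Y Y₁ Y₂ Y₃ B P Q)
    (hk : 1 ≤ k) (hlam : 1 < lam) (hπ : IsCoveringMap π) (he₀ : (π e₀).1 = basePair k lam)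
    (hF : IsSolution c π F) (hH : HasInitialS F e₀ α β)
    (hB : B.1 = !![a, Complex.I * s; Complex.I * t, starRingEnd ℂ a])
    (hP : P.1 = !![q, Complex.I * r₃; Complex.I * r₄, starRingEnd ℂ q])
    (hQ : (Q⁻¹ * B).1 = !![(r₁ : ℂ), p; -starRingEnd ℂ p, (r₂ : ℂ)])
    (hp : p.re = (s + t) * a.im) (hr : r₂ - r₁ = (s + t) * (t - s))
    (h12 : r₁ ≠ r₂) (h34 : r₃ ≠ r₄)
    (hh₁ : h₁ = 2 * p.re / (r₂ - r₁)) (hh₂ : h₂ = 2 * q.im / (r₄ - r₃)) :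
    List.TFAE [ClosesUp π (surfaceS F), AllMonodromiesIn π F e₀ SU11,
      LoopMonodromiesIn π F e₀ SU11,
      h₁ = h₂ ∧ h₁ = (α ^ 2 - β ^ 2) / (α ^ 2 + β ^ 2)] := by
  have hd := mul_of_initialS hH
  have h12' : r₂ - r₁ ≠ 0 := sub_ne_zero.2 h12.symm
  have h34' : r₄ - r₃ ≠ 0 := sub_ne_zero.2 h34.symm
  have hαβ : α ^ 2 + β ^ 2 ≠ 0 := by nlinarith [sq_nonneg (α + β)]
  rw [← coe_formStabilizer_e₃]
  refine tfae_closesUp h hk hlam hπ he₀ hF neg_one_mem_formStabilizer (conj_flipSL_mem_SU11 hH)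
    (continuous_surfaceS hF) surfaceS_eq_iff ?_ ?_
  · rw [conj_mem_SU11_iff_real hQ hH, conj_mem_SU11_iff hP hH]
    have key : ∀ x r : ℝ, r ≠ 0 → (2 * x / r = (α ^ 2 - β ^ 2) / (α ^ 2 + β ^ 2) ↔
        2 * x * (α ^ 2 + β ^ 2) = r * (α ^ 2 - β ^ 2)) := by
      intro x r hr
      rw [div_eq_div_iff hr hαβ, mul_comm r]
    rw [← key _ _ h12', ← key _ _ h34', ← hh₁, ← hh₂]
    constructor
    · rintro ⟨h1, h2⟩
      exact ⟨h2, h1 ▸ h2⟩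
    · rintro ⟨h1, h2⟩
      exact ⟨h1.trans h2.symm, h1⟩
  -- the two conditions differ by the factor `s + t`
  · rw [conj_mem_SU11_iff_real hQ hH, conj_mem_SU11_iff hB hH, hp, hr]
    intro h1
    have h0 : s + t ≠ 0 := left_ne_zero_of_mul (hr ▸ h12')
    refine mul_left_cancel₀ h0 ?_
    linarith

end Equivalence

end HigherGenusCatenoid

end

open HigherGenusCatenoid in
theorem mainTheorem1 (k : ℕ) (hk : 1 ≤ k) (lam : ℝ) (hlam : 1 < lam) (c : ℝ) (hc : c ≠ 0) :
    ∃ (r₁ r₂ r₃ r₄ : ℝ) (p q : ℂ),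
      ∀ (E : Type) [TopologicalSpace E] [SimplyConnectedSpace E]
        (π : E → HigherGenusCatenoid.puncturedCurve k lam) (e₀ : E) (F : E → SL(2, ℂ)),
        IsCoveringMap π → (π e₀).1 = HigherGenusCatenoid.basePair k lam →
        HigherGenusCatenoid.IsSolution c π F → F e₀ = 1 →
        -- the monodromies along the two loops
        (∀ Γ : C(I, E), Γ 0 = e₀ → HigherGenusCatenoid.IsLoop₁ (π ∘ Γ) →
          (HigherGenusCatenoid.monodromy F Γ : Matrix (Fin 2) (Fin 2) ℂ) =
            !![(r₁ : ℂ), p; -(starRingEnd ℂ p), (r₂ : ℂ)]) ∧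
        (∀ Γ : C(I, E), Γ 0 = e₀ → HigherGenusCatenoid.IsLoop₂ (π ∘ Γ) →
          (HigherGenusCatenoid.monodromy F Γ : Matrix (Fin 2) (Fin 2) ℂ) =
            !![q, Complex.I * (r₃ : ℂ); Complex.I * (r₄ : ℂ), starRingEnd ℂ q]) ∧
        -- the closing condition, whenever the two quotients are defined
        (r₁ ≠ r₂ → r₃ ≠ r₄ → ∀ h₁ h₂ : ℝ,
          h₁ = 2 * p.re / (r₂ - r₁) → h₂ = 2 * q.im / (r₄ - r₃) →
          -- for a given initial condition
          (∀ (α β : ℝ) (F' : E → SL(2, ℂ)), HigherGenusCatenoid.IsSolution c π F' →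
            HigherGenusCatenoid.HasInitialH F' e₀ α β →
            List.TFAE [
              HigherGenusCatenoid.ClosesUp π (HigherGenusCatenoid.surfaceH F'),
              HigherGenusCatenoid.AllMonodromiesIn π F' e₀ HigherGenusCatenoid.SU2,
              HigherGenusCatenoid.LoopMonodromiesIn π F' e₀ HigherGenusCatenoid.SU2,
              α * β ≠ 0 ∧ h₁ = h₂ ∧ h₁ = (α ^ 2 + β ^ 2) / (2 * α * β)]) ∧
          (∀ (α β : ℝ) (F' : E → SL(2, ℂ)), HigherGenusCatenoid.IsSolution c π F' →
            HigherGenusCatenoid.HasInitialS F' e₀ α β →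
            List.TFAE [
              HigherGenusCatenoid.ClosesUp π (HigherGenusCatenoid.surfaceS F'),
              HigherGenusCatenoid.AllMonodromiesIn π F' e₀ HigherGenusCatenoid.SU11,
              HigherGenusCatenoid.LoopMonodromiesIn π F' e₀ HigherGenusCatenoid.SU11,
              h₁ = h₂ ∧ h₁ = (α ^ 2 - β ^ 2) / (α ^ 2 + β ^ 2)]) ∧
          -- existence of an appropriate initial condition
          ((∃ (α β : ℝ) (F' : E → SL(2, ℂ)), HigherGenusCatenoid.IsSolution c π F' ∧
              HigherGenusCatenoid.HasInitialH F' e₀ α β ∧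
              HigherGenusCatenoid.ClosesUp π (HigherGenusCatenoid.surfaceH F')) ↔
            h₁ = h₂ ∧ 1 < |h₁|) ∧
          ((∃ (α β : ℝ) (F' : E → SL(2, ℂ)), HigherGenusCatenoid.IsSolution c π F' ∧
              HigherGenusCatenoid.HasInitialS F' e₀ α β ∧
              HigherGenusCatenoid.ClosesUp π (HigherGenusCatenoid.surfaceS F')) ↔
            h₁ = h₂ ∧ |h₁| < 1)) := by
  by_cases hdata : ∃ (Y Y₁ Y₂ Y₃ : ℂ → SL(2, ℂ)) (B P Q : SL(2, ℂ)),
      IsConnectionData k lam c Y Y₁ Y₂ Y₃ B P Q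
  swap
  -- without a solution on some covering there is nothing to prove
  · refine ⟨0, 0, 0, 0, 0, 0, fun E _ _ π e₀ F hπ he₀ hF hF₀ => ?_⟩
    exact absurd (exists_isConnectionData hlam hπ he₀ hF hF₀) hdata
  obtain ⟨Y, Y₁, Y₂, Y₃, B, P, Q, h⟩ := hdata
  obtain ⟨hB11, hB01, hB10⟩ := entries_of_mul_conj (h.mul_conj_left hlam)
  obtain ⟨hP11, hP01, hP10⟩ := entries_of_mul_conj (h.mul_conj_neg hlam)
  have hBm : B.1 = !![B.1 0 0, Complex.I * ((B.1 0 1).im : ℝ); Complex.I * ((B.1 1 0).im : ℝ),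
      starRingEnd ℂ (B.1 0 0)] := by
    rw [← hB01, ← hB10, ← hB11]
    exact Matrix.eta_fin_two _
  have hPm : P.1 = !![P.1 0 0, Complex.I * ((P.1 0 1).im : ℝ); Complex.I * ((P.1 1 0).im : ℝ),
      starRingEnd ℂ (P.1 0 0)] := by
    rw [← hP01, ← hP10, ← hP11]
    exact Matrix.eta_fin_two _
  generalize B.1 0 0 = a, (B.1 0 1).im = s, (B.1 1 0).im = t at hBm
  generalize P.1 0 0 = q, (P.1 0 1).im = r₃, (P.1 1 0).im = r₄ at hPm
  have hQ := coe_flip_mul hBm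
  rw [← inv_eq_of_mul_eq_one_right (h.right_mul_flip hlam)] at hQ
  set p : ℂ := Complex.I * starRingEnd ℂ a * (s + t) with hp_def
  have hp : p.re = (s + t) * a.im := by
    rw [hp_def]
    simp
    ring
  refine ⟨Complex.normSq a - t ^ 2, Complex.normSq a - s ^ 2, r₃, r₄, p, q,
    fun E _ _ π e₀ F hπ he₀ hF hF₀ => ⟨?_, ?_, ?_⟩⟩
  · intro Γ h0 hΓ
    rw [monodromy_of_isLoop₁ h hlam hπ hF hΓ, h0, hF₀, inv_one, one_mul, mul_one]
    exact hQ
  · intro Γ h0 hΓ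
    rw [monodromy_of_isLoop₂ h hlam hπ hF hΓ, h0, hF₀, inv_one, one_mul, mul_one]
    exact hPm
  intro h12 h34 h₁ h₂ hh₁ hh₂
  have hr : Complex.normSq a - s ^ 2 - (Complex.normSq a - t ^ 2) = (s + t) * (t - s) := by ring
  have tH : ∀ (α β : ℝ) (F' : E → SL(2, ℂ)), IsSolution c π F' → HasInitialH F' e₀ α β → _ :=
    fun α β F' hF' hH =>
      tfae_closesUp_surfaceH h hk hlam hπ he₀ hF' hH hBm hPm hQ hp hr h12 h34 hh₁ hh₂
  have tS : ∀ (α β : ℝ) (F' : E → SL(2, ℂ)), IsSolution c π F' → HasInitialS F' e₀ α β → _ :=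
    fun α β F' hF' hH =>
      tfae_closesUp_surfaceS h hk hlam hπ he₀ hF' hH hBm hPm hQ hp hr h12 h34 hh₁ hh₂
  refine ⟨tH, tS, ⟨?_, ?_⟩, ⟨?_, ?_⟩⟩
  · rintro ⟨α, β, F', hF', hH, hcl⟩
    obtain ⟨h0, h1, h2⟩ := ((tH α β F' hF' hH).out 0 3).1 hcl
    exact ⟨h1, h2 ▸ one_lt_abs_of_initialH (sq_sub_sq_of_initialH hH) h0⟩
  · rintro ⟨h1, h2⟩
    obtain ⟨α, β, hd, h0, h3⟩ := exists_initialH_of_one_lt_abs h2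
    obtain ⟨H, hH⟩ := exists_initialH hd
    have hH' : HasInitialH (fun x => F x * H) e₀ α β := by
      rw [HasInitialH, hF₀, one_mul]
      exact hH
    have hcl := (tH α β _ (hF.mul_right H) hH').out 0 3
    exact ⟨α, β, _, hF.mul_right H, hH', hcl.2 ⟨h0, h1, h3⟩⟩
  · rintro ⟨α, β, F', hF', hH, hcl⟩
    obtain ⟨h1, h2⟩ := ((tS α β F' hF' hH).out 0 3).1 hcl
    exact ⟨h1, h2 ▸ abs_lt_one_of_initialS (mul_of_initialS hH)⟩
  · rintro ⟨h1, h2⟩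
    obtain ⟨α, β, hd, h3⟩ := exists_initialS_of_abs_lt_one h2
    obtain ⟨H, hH⟩ := exists_initialS hd
    have hH' : HasInitialS (fun x => F x * H) e₀ α β := by
      rw [HasInitialS, hF₀, one_mul]
      exact hH
    have hcl := (tS α β _ (hF.mul_right H) hH').out 0 3
    exact ⟨α, β, _, hF.mul_right H, hH', hcl.2 ⟨h1, h3⟩⟩
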